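/- Let $f\in C^2(\mathbb R)$ satisfy $f(0)=f(1)=0$, $f'(0)<0$, $f'(1)<0$ and, with $F(u)=\int_0^u f(s)\,ds$, $F(1)=0$ and $F(u)\neq 0$ for all $u\in(0,1)$. Let $(a_k)_{k\in\mathbb Z}$ be real numbers with $\sum_{k\in\mathbb Z}a_k=0$, $a_0<0$, $a_k=a_{-k}$ and $\sum_{k\ge1}|a_k|k^2<\infty$, and write $\Delta u(z)=\sum_{k\in\mathbb Z}a_k\,u(z-k)$. Let $u_0$ be a heteroclinic solution of $u''+f(u)=0$ with $u_0(z)\to0$ as $z\to-\infty$ and $u_0(z)\to1$ as $z\to\infty$, and let $u_1\in H^2(\mathbb R)$ be the function with $\int_{\mathbb R}u_1u_0'\,dz=0$ and $u_1''+f'(u_0)u_1=\Delta u_0$. For $\varepsilon\ge0$ let $L^\varepsilon$ be the operator in $L^2(\mathbb R)$ with domain $H^2(\mathbb R)$ given by $$L^\varepsilon\psi=\psi''+f'(u_0+\varepsilon u_1)\psi-\varepsilon\Delta\psi .$$ Then $u_0'\in H^2(\mathbb R)\setminus\{0\}$, and there are constants $\varepsilon_0>0$, $c>0$, $C$ and,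 for every $\varepsilon\in[0,\varepsilon_0]$, a number $\lambda_1(\varepsilon)\in\mathbb R$ and a real-valued function $\phi_1(\varepsilon)\in H^2(\mathbb R)$ with $\|\phi_1(\varepsilon)\|_{H^2}=1$, such that for all $\varepsilon\in[0,\varepsilon_0]$: 1. $\sigma(-L^\varepsilon)\subset\{\lambda_1(\varepsilon)\}\cup[c,\infty)$; 2. $\lambda_1(\varepsilon)$ is a simple eigenvalue of $-L^\varepsilon$ with eigenfunction $\phi_1(\varepsilon)$; 3. $|\lambda_1(\varepsilon)|\le C\varepsilon^2$ and $\displaystyle\Big\|\phi_1(\varepsilon)-\frac{u_0'}{\|u_0'\|_{H^2}}\Big\|_{H^2}\le C\varepsilon$. Moreover $\lambda_1$ and $\phi_1$ depend smoothly on $\varepsilon$ up to $\varepsilon=0$, to the order that the smoothness of $f$ permits: the maps $\lambda_1:[0,\varepsilon_0]\to\mathbb R$ and $\phi_1:[0,\varepsilon_0]\to H^2(\mathbb R)$ are $C^1$, and for every integer $m\ge1$ they are $C^m$ if $f\in C^{m+1}(\mathbb R)$ (so $C^\infty$ if $f\in C^\infty(\mathbb R)$). -/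

import Mathlib

open MeasureTheory Filter Topology Set
open scoped ContDiff ENNReal

/-- The Hilbert space `L²(ℝ; 𝕜)`, `𝕜 = ℝ` or `ℂ`. -/
noncomputable abbrev L2 (𝕜 : Type) [RCLike 𝕜] : Type := Lp 𝕜 2 (volume : Measure ℝ)

/-- `v` is the weak derivative of `u`: `∫ φ' u = - ∫ φ v` for all real test functions `φ`. -/
def IsWeakDeriv {𝕜 : Type} [RCLike 𝕜] (u v : L2 𝕜) : Prop :=
  ∀ φ : ℝ → ℝ, ContDiff ℝ ∞ φ → HasCompactSupport φ →
    ∫ z, deriv φ z • u z = - ∫ z, φ z • v z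

theorem integrable_smul_L2 {𝕜 : Type} [RCLike 𝕜] (u : L2 𝕜) {φ : ℝ → ℝ}
    (h : Continuous φ) (hc : HasCompactSupport φ) : Integrable (fun z => φ z • u z) :=
  ((Lp.memLp u).locallyIntegrable (by norm_num)).integrable_smul_left_of_hasCompactSupport h hc

theorem IsWeakDeriv.add {𝕜 : Type} [RCLike 𝕜] {u v u' v' : L2 𝕜}
    (h : IsWeakDeriv u v) (h' : IsWeakDeriv u' v') : IsWeakDeriv (u + u') (v + v') := by
  intro φ hφ hc
  have e1 : ∫ z, deriv φ z • (u + u') z = ∫ z, (deriv φ z • u z + deriv φ z • u' z) := by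
    refine integral_congr_ae ?_
    filter_upwards [Lp.coeFn_add u u'] with z hz
    rw [hz, Pi.add_apply, smul_add]
  have e2 : ∫ z, φ z • (v + v') z = ∫ z, (φ z • v z + φ z • v' z) := by
    refine integral_congr_ae ?_
    filter_upwards [Lp.coeFn_add v v'] with z hz
    rw [hz, Pi.add_apply, smul_add]
  have hd : Continuous (deriv φ) := hφ.continuous_deriv (by simp)
  rw [e1, e2, integral_add (integrable_smul_L2 u hd hc.deriv) (integrable_smul_L2 u' hd hc.deriv),
    integral_add (integrable_smul_L2 v hφ.continuous hc) (integrable_smul_L2 v' hφ.continuous hc),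
    h φ hφ hc, h' φ hφ hc, neg_add]

theorem IsWeakDeriv.smul {𝕜 : Type} [RCLike 𝕜] (c : 𝕜) {u v : L2 𝕜}
    (h : IsWeakDeriv u v) : IsWeakDeriv (c • u) (c • v) := by
  intro φ hφ hc
  have e1 : ∫ z, deriv φ z • (c • u) z = ∫ z, c • (deriv φ z • u z) := by
    refine integral_congr_ae ?_
    filter_upwards [Lp.coeFn_smul c u] with z hz
    rw [hz, Pi.smul_apply, smul_comm]
  have e2 : ∫ z, φ z • (c • v) z = ∫ z, c • (φ z • v z) := by
    refine integral_congr_ae ?_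
    filter_upwards [Lp.coeFn_smul c v] with z hz
    rw [hz, Pi.smul_apply, smul_comm]
  rw [e1, e2, integral_smul, integral_smul, h φ hφ hc, smul_neg]

theorem isWeakDeriv_zero {𝕜 : Type} [RCLike 𝕜] : IsWeakDeriv (0 : L2 𝕜) 0 := by
  have e : ∀ ψ : ℝ → ℝ, ∫ z, ψ z • (0 : L2 𝕜) z = 0 := by
    intro ψ
    refine integral_eq_zero_of_ae ?_
    filter_upwards [Lp.coeFn_zero 𝕜 2 (volume : Measure ℝ)] with z _
    simp
  intro φ _ _
  rw [e, e, neg_zero]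

theorem IsWeakDeriv.eq_zero {𝕜 : Type} [RCLike 𝕜] {v : L2 𝕜}
    (h : IsWeakDeriv 0 v) : v = 0 := by
  rw [Lp.eq_zero_iff_ae_eq_zero]
  refine ae_eq_zero_of_integral_contDiff_smul_eq_zero
    ((Lp.memLp v).locallyIntegrable (by norm_num)) ?_
  intro φ hφ hc
  have e : ∫ z, deriv φ z • (0 : L2 𝕜) z = 0 := by
    refine integral_eq_zero_of_ae ?_
    filter_upwards [Lp.coeFn_zero 𝕜 2 (volume : Measure ℝ)] with z _
    simp
  have := h φ hφ hc
  rw [e] at this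
  exact neg_eq_zero.mp this.symm

/-- The Sobolev space `H²(ℝ; 𝕜)`. An element is the triple `(u, u', u'')` of a function of
`L²(ℝ; 𝕜)` and its first two weak derivatives, which are again in `L²(ℝ; 𝕜)`; the triple is
determined by `u`. The norm is `(‖u‖² + ‖u'‖² + ‖u''‖²)^{1/2}` with `L²`-norms. -/
noncomputable def sobolevTwo (𝕜 : Type) [RCLike 𝕜] : Submodule 𝕜 (PiLp 2 (fun _ : Fin 3 => L2 𝕜)) where
  carrier := {U | IsWeakDeriv (U 0) (U 1) ∧ IsWeakDeriv (U 1) (U 2)}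
  add_mem' := fun h h' => ⟨h.1.add h'.1, h.2.add h'.2⟩
  zero_mem' := ⟨isWeakDeriv_zero, isWeakDeriv_zero⟩
  smul_mem' := fun c _ h => ⟨h.1.smul c, h.2.smul c⟩

/-- `H²(ℝ; 𝕜)` as a normed space. -/
noncomputable abbrev H2 (𝕜 : Type) [RCLike 𝕜] : Type := sobolevTwo 𝕜

/-- The function `u ∈ L²` underlying an element of `H²`. -/
noncomputable def H2.fn {𝕜 : Type} [RCLike 𝕜] (U : H2 𝕜) : L2 𝕜 := U.1 0

/-- The second weak derivative `u'' ∈ L²` of an element `u` of `H²`. -/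
noncomputable def H2.deriv2 {𝕜 : Type} [RCLike 𝕜] (U : H2 𝕜) : L2 𝕜 := U.1 2

/-- The infinite-range lattice operator `(Δ u)(z) = ∑_{k ∈ ℤ} a_k u(z - k)`. -/
noncomputable def latticeOp {𝕜 : Type} [RCLike 𝕜] (a : ℤ → ℝ) (u : ℝ → 𝕜) (z : ℝ) : 𝕜 :=
  ∑' k : ℤ, a k • u (z - k)

theorem ae_shift_eq {𝕜 : Type} {f g : ℝ → 𝕜} (h : f =ᵐ[volume] g) :
    ∀ᵐ z : ℝ, ∀ k : ℤ, f (z - k) = g (z - k) := by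
  rw [ae_all_iff]
  intro k
  exact (measurePreserving_sub_right volume (k : ℝ)).quasiMeasurePreserving.ae h

/-- The graph, in `L²(ℝ; ℂ) × L²(ℝ; ℂ)`, of the operator with domain `H²(ℝ; ℂ)`
`ψ ↦ - (ψ'' + V ψ - ε Δ ψ)`. The summability clause says that `Δ ψ` is given by an absolutely
convergent series almost everywhere; it holds for every `ψ ∈ L²` if `∑ |a_k| < ∞`. -/
noncomputable def negLinGraph (a : ℤ → ℝ) (V : ℝ → ℝ) (ε : ℝ) :
    Submodule ℂ (L2 ℂ × L2 ℂ) where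
  carrier := {p | ∃ U : H2 ℂ, U.fn = p.1 ∧
    (∀ᵐ z : ℝ, Summable fun k : ℤ => a k • U.fn (z - k)) ∧
    ∀ᵐ z : ℝ, p.2 z = - (U.deriv2 z + V z • U.fn z - ε • latticeOp a U.fn z)}
  add_mem' := by
    rintro ⟨x, y⟩ ⟨x', y'⟩ ⟨U, rfl, hs, h⟩ ⟨U', rfl, hs', h'⟩
    have e0 : (U + U').fn = U.fn + U'.fn := rfl
    have e2 : (U + U').deriv2 = U.deriv2 + U'.deriv2 := rfl
    have hae := Lp.coeFn_add U.fn U'.fn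
    refine ⟨U + U', e0, ?_, ?_⟩
    · rw [e0]
      filter_upwards [hs, hs', ae_shift_eq hae] with z h1 h2 h3
      simpa only [h3, Pi.add_apply, smul_add] using h1.add h2
    · rw [e0, e2]
      filter_upwards [hs, hs', ae_shift_eq hae, hae, Lp.coeFn_add U.deriv2 U'.deriv2,
        Lp.coeFn_add y y', h, h'] with z h1 h2 h3 h4 h5 h6 h7 h8
      have h7' : y z = _ := h7
      have h8' : y' z = _ := h8
      change (y + y') z = _
      have hl : latticeOp a (↑↑(U.fn + U'.fn)) z = latticeOp a U.fn z + latticeOp a U'.fn z := by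
        unfold latticeOp
        simp only [h3, Pi.add_apply, smul_add]
        exact h1.tsum_add h2
      rw [h6, hl, h4, h5]
      simp only [Pi.add_apply, smul_add]
      rw [h7', h8']
      ring
  zero_mem' := by
    have hae := Lp.coeFn_zero ℂ 2 (volume : Measure ℝ)
    have e0 : (0 : H2 ℂ).fn = 0 := rfl
    have e2 : (0 : H2 ℂ).deriv2 = 0 := rfl
    refine ⟨0, rfl, ?_, ?_⟩
    · rw [e0]
      filter_upwards [ae_shift_eq hae] with z h3
      simp [summable_zero]
    · rw [e0, e2]
      filter_upwards [hae, ae_shift_eq hae] with z h2 h3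
      change (0 : L2 ℂ) z = _
      simp [latticeOp, h2, h3]
  smul_mem' := by
    rintro c ⟨x, y⟩ ⟨U, rfl, hs, h⟩
    have e0 : (c • U).fn = c • U.fn := rfl
    have e2 : (c • U).deriv2 = c • U.deriv2 := rfl
    have hae := Lp.coeFn_smul c U.fn
    refine ⟨c • U, e0, ?_, ?_⟩
    · rw [e0]
      filter_upwards [hs, ae_shift_eq hae] with z h1 h3
      simpa only [h3, Pi.smul_apply, smul_comm c] using h1.const_smul c
    · rw [e0, e2]
      filter_upwards [hs, ae_shift_eq hae, hae, Lp.coeFn_smul c U.deriv2,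
        Lp.coeFn_smul c y, h] with z h1 h3 h4 h5 h6 h7
      have h7' : y z = _ := h7
      change (c • y) z = _
      have hl : latticeOp a (↑↑(c • U.fn)) z = c • latticeOp a U.fn z := by
        unfold latticeOp
        simp only [h3, Pi.smul_apply, smul_comm _ c]
        exact h1.tsum_const_smul c
      rw [h6, hl, h4, h5]
      simp only [Pi.smul_apply, smul_comm _ c]
      rw [h7']
      simp only [smul_eq_mul, Complex.real_smul]
      ring

/-- `negLinGraph` is the graph of a function. -/
theorem negLinGraph_functional (a : ℤ → ℝ) (V : ℝ → ℝ) (ε : ℝ) :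
    ∀ p ∈ negLinGraph a V ε, p.1 = 0 → p.2 = 0 := by
  rintro ⟨x, y⟩ ⟨U, rfl, hs, h⟩ hx
  have hx' : U.fn = 0 := hx
  have hU := U.2
  have h1 : U.1 1 = 0 := by
    have := hU.1
    rw [show U.1 0 = 0 from hx] at this
    exact this.eq_zero
  have h2 : U.deriv2 = 0 := by
    have := hU.2
    rw [h1] at this
    exact this.eq_zero
  have hae := Lp.coeFn_zero ℂ 2 (volume : Measure ℝ)
  rw [hx', h2] at h
  change y = 0
  rw [Lp.eq_zero_iff_ae_eq_zero]
  filter_upwards [h, hae, ae_shift_eq hae] with z h3 h4 h5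
  have h3' : y z = _ := h3
  rw [h3']
  simp [latticeOp, h4, h5]

/-- The unbounded operator `- L` on `L²(ℝ; ℂ)` with domain `H²(ℝ; ℂ)`, where
`L ψ = ψ'' + V ψ - ε Δ ψ`. -/
noncomputable def negLinOp (a : ℤ → ℝ) (V : ℝ → ℝ) (ε : ℝ) : L2 ℂ →ₗ.[ℂ] L2 ℂ :=
  (negLinGraph a V ε).toLinearPMap

theorem negLinOp_graph (a : ℤ → ℝ) (V : ℝ → ℝ) (ε : ℝ) :
    (negLinOp a V ε).graph = negLinGraph a V ε :=
  Submodule.toLinearPMap_graph_eq _ (negLinGraph_functional a V ε)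

/-- `μ` is in the resolvent set of the unbounded operator `T`: the map `T - μ` from the domain of
`T` to the whole space is bijective with bounded inverse `R`. -/
def InResolventSet {H : Type} [NormedAddCommGroup H] [NormedSpace ℂ H]
    (T : H →ₗ.[ℂ] H) (μ : ℂ) : Prop :=
  ∃ R : H →L[ℂ] H,
    (∀ y : H, ∃ x : T.domain, (x : H) = R y ∧ T x - μ • (x : H) = y) ∧
    (∀ x : T.domain, R (T x - μ • (x : H)) = x)

/-- The spectrum of an unbounded operator, the complement of the resolvent set. -/
def unboundedSpectrum {H : Type} [NormedAddCommGroup H] [NormedSpace ℂ H]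
    (T : H →ₗ.[ℂ] H) : Set ℂ := {μ | ¬ InResolventSet T μ}

/-- `μ` is an (algebraically) simple eigenvalue of `T` with eigenvector `x`: the kernel of `T - μ`
is the line spanned by `x ≠ 0`, and there is no generalized eigenvector. -/
def IsSimpleEigenpair {H : Type} [NormedAddCommGroup H] [NormedSpace ℂ H]
    (T : H →ₗ.[ℂ] H) (μ : ℂ) (x : H) : Prop :=
  x ≠ 0 ∧ (∃ hx : x ∈ T.domain, T ⟨x, hx⟩ = μ • x) ∧
    (∀ y : T.domain, T y = μ • (y : H) → ∃ c : ℂ, (y : H) = c • x) ∧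
    (∀ y : T.domain, T y - μ • (y : H) ≠ x)

/-- A real-valued `L²` function, regarded as complex-valued. -/
noncomputable def complexify (g : L2 ℝ) : L2 ℂ := Complex.ofRealCLM.compLp g

/-- Balanced bistable nonlinearity: `f ∈ C²(ℝ)`, `f(0) = f(1) = 0`, `f'(0), f'(1) < 0`, and
`F(u) = ∫₀ᵘ f` satisfies `F(1) = 0` and `F ≠ 0` on `(0, 1)`. -/
structure IsBalancedBistable (f : ℝ → ℝ) : Prop where
  contDiff : ContDiff ℝ 2 f
  zero : f 0 = 0
  one : f 1 = 0
  deriv_zero : deriv f 0 < 0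
  deriv_one : deriv f 1 < 0
  primitive_one : ∫ s in (0 : ℝ)..1, f s = 0
  primitive_ne : ∀ u ∈ Ioo (0 : ℝ) 1, ∫ s in (0 : ℝ)..u, f s ≠ 0

/-- Coupling coefficients: `∑ a_k = 0`, `a_0 < 0`, `a_k = a_{-k}`, `∑_{k ≥ 1} |a_k| k² < ∞`
(the added term `k = 0` below vanishes). -/
structure IsLatticeCoupling (a : ℤ → ℝ) : Prop where
  sum_zero : HasSum a 0
  neg_zero : a 0 < 0
  symm : ∀ k, a (-k) = a k
  moment : Summable fun k : ℕ => |a k| * (k : ℝ) ^ 2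

/-- A heteroclinic solution of `u'' + f(u) = 0` from `0` to `1`. -/
structure IsHeteroclinic (f u₀ : ℝ → ℝ) : Prop where
  contDiff : ContDiff ℝ 2 u₀
  ode : ∀ z, deriv (deriv u₀) z + f (u₀ z) = 0
  atBot : Tendsto u₀ atBot (𝓝 0)
  atTop : Tendsto u₀ atTop (𝓝 1)

/-- The first-order corrector: `u₁ ∈ H²(ℝ)`, `u₁ ⊥ u₀'` in `L²` and
`u₁'' + f'(u₀) u₁ = Δ u₀`. -/
structure IsFirstCorrector (f : ℝ → ℝ) (a : ℤ → ℝ) (u₀ : ℝ → ℝ) (u₁ : H2 ℝ) : Prop where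
  orth : ∫ z, u₁.fn z * deriv u₀ z = 0
  eqn : ∀ᵐ z : ℝ, u₁.deriv2 z + deriv f (u₀ z) * u₁.fn z = latticeOp a u₀ z

/-!
Everything takes place around the bounded operators `T ε = -(∂² + f'(u₀ + ε u₁) - ε Δ)` from `H²` to
`L²` (`schrL`), which are symmetric with respect to the embedding `J` of `H²` in `L²`.

*Spectrum at `ε = 0`.* By conservation of energy `u₀'` is positive (`IsHeteroclinic.deriv_pos`) and
differentiating the equation shows `T 0 u₀' = 0`. Positivity gives the factorization
`-∂² - f'(u₀) = D* D` with `D = ∂ - u₀'' / u₀'`, where `u₀'' / u₀'` is bounded by l'Hôpital's rule.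
Since the potential `-f'(u₀)` is positive near both ends, a function vanishing at the origin is
controlled by `D`, and this gives a lower bound `c > 0` for the quadratic form on the orthogonal
complement of `u₀'` (`exists_gap`); neither compactness nor Weyl's theorem is needed.

*The branch.* By the gap the bordered operator `(s, x) ↦ (T 0 x - s J φ₀, ⟨J φ₀, J x⟩)` is bijective,
and the inverse function theorem continues `(0, u₀')` to a branch of eigenpairs
(`exists_eigenbranch`). It is as smooth as `ε ↦ T ε`, hence as `v ↦ f' ∘ v` on bounded continuous
functions: `C^m` for `f ∈ C^{m+1}` (`contDiff_superpos`).

*Spectrum at `ε > 0`.* The perturbation `T ε - T 0` is a small bounded operator on `L²`, so a gap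
persists on the complement of `u₀'`, and by an algebraic argument on the complement of the
eigenvector (`gap_of_eigenvector`). A number away from the eigenvalue and from `[c / 2, ∞)` is then
in the resolvent set, because a bounded symmetric perturbation of the isomorphism `1 - ∂²` is
bijective as soon as it and its adjoint are bounded below (`bijective_of_lower_bound`).

*The eigenvalue is `O(ε²)`.* Let `r = u'' + f(u) - ε Δ u` be the residual of `u = u₀ + ε u₁`; the
equations for `u₀` and `u₁` make it of order `ε²`, and `-T ε u' = r'`. Pairing `T ε φ = l φ` with `u'`
gives `l ⟨φ, u'⟩ = ⟨φ', r⟩`, where `⟨φ, u'⟩` is close to `⟨φ, u₀'⟩`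
(`exists_eigenvalue_pairing_bound`).
-/

open scoped InnerProductSpace

/-! ### Primitives and weak derivatives -/

/-- `U` is a primitive of the locally integrable function `v`; equivalently `U` is locally
absolutely continuous with derivative `v` almost everywhere. -/
structure IsPrimitive (U v : ℝ → ℝ) : Prop where
  locInt : LocallyIntegrable v
  sub_eq : ∀ a b, U b - U a = ∫ z in a..b, v z

namespace IsPrimitive

variable {U v U' v' : ℝ → ℝ}

theorem intervalIntegrable (h : IsPrimitive U v) (a b : ℝ) : IntervalIntegrable v volume a b :=
  intervalIntegrable_iff.mpr <|
    (h.locInt.integrableOn_isCompact isCompact_uIcc).mono_set uIoc_subset_uIcc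

theorem eq_add (h : IsPrimitive U v) (a : ℝ) : U = fun x => U a + ∫ z in a..x, v z := by
  ext x
  rw [← h.sub_eq]
  ring

theorem absolutelyContinuous (h : IsPrimitive U v) (a b : ℝ) :
    AbsolutelyContinuousOnInterval U a b := by
  rw [h.eq_add a]
  refine AbsolutelyContinuousOnInterval.fun_add ?_ ?_
  · exact contDiff_const.contDiffOn.absolutelyContinuousOnInterval
  · exact (h.intervalIntegrable a b).absolutelyContinuousOnInterval_intervalIntegral left_mem_uIcc

theorem continuous (h : IsPrimitive U v) : Continuous U := by
  rw [h.eq_add 0]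
  exact continuous_const.add (intervalIntegral.continuous_primitive h.intervalIntegrable 0)

theorem ae_hasDerivAt (h : IsPrimitive U v) : ∀ᵐ x, HasDerivAt U (v x) x := by
  filter_upwards [_root_.LocallyIntegrable.ae_hasDerivAt_integral h.locInt] with x hx
  rw [h.eq_add 0]
  exact (hx 0).const_add _

theorem of_hasDerivAt (h : ∀ x, HasDerivAt U (v x) x) (hc : Continuous v) : IsPrimitive U v where
  locInt := hc.locallyIntegrable
  sub_eq a b := (intervalIntegral.integral_eq_sub_of_hasDerivAt (fun x _ => h x)
    (hc.intervalIntegrable a b)).symm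

theorem mul (h : IsPrimitive U v) (h' : IsPrimitive U' v') :
    IsPrimitive (fun x => U x * U' x) (fun x => v x * U' x + U x * v' x) where
  locInt := by
    refine LocallyIntegrable.add ?_ ?_
    · exact h.locInt.mul_continuous h'.continuous
    · exact h'.locInt.continuous_mul h.continuous
  sub_eq a b := by
    rw [← (h.absolutelyContinuous a b).integral_deriv_mul_eq_sub (h'.absolutelyContinuous a b)]
    refine intervalIntegral.integral_congr_ae ?_
    filter_upwards [h.ae_hasDerivAt, h'.ae_hasDerivAt] with x h1 h2 _
    rw [h1.deriv, h2.deriv]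

theorem add (h : IsPrimitive U v) (h' : IsPrimitive U' v') :
    IsPrimitive (fun x => U x + U' x) (fun x => v x + v' x) where
  locInt := h.locInt.add h'.locInt
  sub_eq a b := by
    rw [intervalIntegral.integral_add (h.intervalIntegrable a b) (h'.intervalIntegrable a b),
      ← h.sub_eq, ← h'.sub_eq]
    ring

theorem const_mul (h : IsPrimitive U v) (c : ℝ) :
    IsPrimitive (fun x => c * U x) (fun x => c * v x) where
  locInt := h.locInt.smul c
  sub_eq a b := by
    rw [intervalIntegral.integral_const_mul, ← h.sub_eq]
    ring

theorem congr_ae (h : IsPrimitive U v) (e : v =ᵐ[volume] v') : IsPrimitive U v' where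
  locInt := h.locInt.congr e
  sub_eq a b := by
    rw [h.sub_eq]
    refine intervalIntegral.integral_congr_ae ?_
    filter_upwards [e] with x hx _ using hx

/-- An integrable function with integrable derivative has a limit at infinity, which is `0`. -/
theorem tendsto_atTop (h : IsPrimitive U v) (hU : Integrable U) (hv : Integrable v) :
    Tendsto U atTop (𝓝 0) := by
  have h1 : Tendsto U atTop (𝓝 (U 0 + ∫ z in Ioi 0, v z)) := by
    rw [h.eq_add 0]
    simpa using (intervalIntegral_tendsto_integral_Ioi 0 hv.integrableOn tendsto_id).const_add _
  have h2 : U 0 + ∫ z in Ioi 0, v z = 0 := by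
    refine IntegrableAtFilter.eq_zero_of_tendsto (μ := volume) (l := atTop)
      ⟨univ, univ_mem, hU.integrableOn⟩ ?_ h1
    intro s hs
    obtain ⟨b, hb⟩ := mem_atTop_sets.1 hs
    rw [← top_le_iff, ← Real.volume_Ici (a := b)]
    exact measure_mono hb
  rwa [h2] at h1

theorem tendsto_atBot (h : IsPrimitive U v) (hU : Integrable U) (hv : Integrable v) :
    Tendsto U atBot (𝓝 0) := by
  have h1 : Tendsto U atBot (𝓝 (U 0 - ∫ z in Iic 0, v z)) := by
    rw [h.eq_add 0]
    have := (intervalIntegral_tendsto_integral_Iic 0 hv.integrableOn tendsto_id).const_sub (U 0)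
    simpa [sub_eq_add_neg, ← intervalIntegral.integral_symm] using this
  have h2 : U 0 - ∫ z in Iic 0, v z = 0 := by
    refine IntegrableAtFilter.eq_zero_of_tendsto (μ := volume) (l := atBot)
      ⟨univ, univ_mem, hU.integrableOn⟩ ?_ h1
    intro s hs
    obtain ⟨b, hb⟩ := mem_atBot_sets.1 hs
    rw [← top_le_iff, ← Real.volume_Iic (a := b)]
    exact measure_mono hb
  rwa [h2] at h1

theorem integral_eq_zero (h : IsPrimitive U v) (hU : Integrable U) (hv : Integrable v) :
    ∫ z, v z = 0 := by
  have h1 := intervalIntegral_tendsto_integral hv tendsto_neg_atTop_atBot tendsto_id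
  have h2 := (h.tendsto_atTop hU hv).sub ((h.tendsto_atBot hU hv).comp tendsto_neg_atTop_atBot)
  refine tendsto_nhds_unique h1 ?_
  simpa [← h.sub_eq] using h2

/-- Integration by parts against a compactly supported `C¹` function. -/
theorem integral_deriv_mul (h : IsPrimitive U v) {φ : ℝ → ℝ} (hφ : ContDiff ℝ 1 φ)
    (hc : HasCompactSupport φ) : ∫ z, deriv φ z * U z = - ∫ z, φ z * v z := by
  have hd : Continuous (deriv φ) := hφ.continuous_deriv le_rfl
  have hp : IsPrimitive φ (deriv φ) :=
    of_hasDerivAt (fun x => (hφ.differentiable (by simp) x).hasDerivAt) hd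
  have i1 : Integrable fun z => deriv φ z * U z :=
    (h.continuous.locallyIntegrable).integrable_smul_left_of_hasCompactSupport hd hc.deriv
  have i2 : Integrable fun z => φ z * v z :=
    h.locInt.integrable_smul_left_of_hasCompactSupport hφ.continuous hc
  have i3 : Integrable fun z => φ z * U z :=
    (h.continuous.locallyIntegrable).integrable_smul_left_of_hasCompactSupport hφ.continuous hc
  have := (hp.mul h).integral_eq_zero i3 (i1.add i2)
  rw [integral_add i1 i2] at this
  linarith

theorem isWeakDeriv {u v : L2 ℝ} (h : IsPrimitive U v) (hu : u =ᵐ[volume] U) :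
    IsWeakDeriv u v := by
  intro φ hφ hc
  have e : ∫ z, deriv φ z • u z = ∫ z, deriv φ z * U z := by
    refine integral_congr_ae ?_
    filter_upwards [hu] with z hz
    rw [hz, smul_eq_mul]
  rw [e, h.integral_deriv_mul (hφ.of_le (by simp)) hc]
  rfl

end IsPrimitive

/-- A locally integrable function with vanishing distributional derivative is almost everywhere
constant: a test function of mean zero is the derivative of a test function, and every test function
differs by a multiple of a fixed bump `ρ` from one of mean zero. -/
theorem ae_eq_const_of_integral_deriv_mul_eq_zero {d : ℝ → ℝ} (hd : LocallyIntegrable d)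
    (h : ∀ φ : ℝ → ℝ, ContDiff ℝ ∞ φ → HasCompactSupport φ → ∫ z, deriv φ z * d z = 0) :
    ∃ c, ∀ᵐ z, d z = c := by
  obtain ⟨ρ, hρ, hρc, hρ1⟩ : ∃ ρ : ℝ → ℝ, ContDiff ℝ ∞ ρ ∧ HasCompactSupport ρ ∧ ∫ z, ρ z = 1 := by
    let b : ContDiffBump (0 : ℝ) := ⟨1, 2, by norm_num, by norm_num⟩
    exact ⟨b.normed volume, b.contDiff_normed, b.hasCompactSupport_normed, b.integral_normed⟩
  have key : ∀ η : ℝ → ℝ, ContDiff ℝ ∞ η → HasCompactSupport η → ∫ z, η z = 0 →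
      ∫ z, η z * d z = 0 := by
    intro η hη hηc h0
    have hi : Integrable η := hη.continuous.integrable_of_hasCompactSupport hηc
    obtain ⟨R, hR⟩ := hηc.isCompact.isBounded.subset_closedBall 0
    have hout : ∀ z, R < |z| → η z = 0 := by
      intro z hz
      refine image_eq_zero_of_notMem_tsupport fun hm => ?_
      have := hR hm
      rw [mem_closedBall_zero_iff, Real.norm_eq_abs] at this
      linarith
    set ψ : ℝ → ℝ := fun x => ∫ z in (-R)..x, η z with hψ
    have hder : ∀ x, HasDerivAt ψ (η x) x := fun x =>
      intervalIntegral.integral_hasDerivAt_right (hη.continuous.intervalIntegrable _ _)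
        (hη.continuous.stronglyMeasurableAtFilter _ _) hη.continuous.continuousAt
    have hdψ : deriv ψ = η := funext fun x => (hder x).deriv
    have hsm : ContDiff ℝ ∞ ψ := by
      rw [contDiff_infty_iff_deriv, hdψ]
      exact ⟨fun x => (hder x).differentiableAt, hη⟩
    have hleft : ∀ x < -R, ψ x = 0 := by
      intro x hx
      rw [hψ]
      simp only
      rw [intervalIntegral.integral_symm, neg_eq_zero,
        intervalIntegral.integral_of_le hx.le, integral_Ioc_eq_integral_Ioo]
      refine setIntegral_eq_zero_of_forall_eq_zero fun z hz => hout z ?_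
      rw [lt_abs]
      right
      linarith [hz.2]
    have hright : ∀ x > R, ψ x = 0 := by
      intro x hx
      rcases le_or_gt (-R) x with hRx | hRx
      · rw [← h0, hψ]
        simp only
        rw [intervalIntegral.integral_of_le hRx, ← integral_Icc_eq_integral_Ioc]
        refine setIntegral_eq_integral_of_forall_compl_eq_zero fun z hz => hout z ?_
        rw [mem_Icc, not_and_or, not_le, not_le] at hz
        rw [lt_abs]
        rcases hz with hz | hz
        · right; linarith
        · left; linarith
      · exact hleft x hRx
    have hcs : HasCompactSupport ψ := by
      refine HasCompactSupport.of_support_subset_isCompact (isCompact_closedBall (0 : ℝ) R) ?_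
      intro x hx
      rw [mem_closedBall_zero_iff, Real.norm_eq_abs, abs_le]
      by_contra hcon
      rw [not_and_or, not_le, not_le] at hcon
      rcases hcon with hcon | hcon
      · exact hx (hleft x hcon)
      · exact hx (hright x hcon)
    have := h ψ hsm hcs
    rwa [hdψ] at this
  refine ⟨∫ z, ρ z * d z, ?_⟩
  have hl : LocallyIntegrable (fun z => d z - ∫ z, ρ z * d z) :=
    hd.sub (locallyIntegrable_const _)
  have := ae_eq_zero_of_integral_contDiff_smul_eq_zero hl ?_
  · filter_upwards [this] with z hz
    linarith
  intro g hg hgc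
  have hgi : Integrable g := hg.continuous.integrable_of_hasCompactSupport hgc
  have hρi : Integrable ρ := hρ.continuous.integrable_of_hasCompactSupport hρc
  have i1 : Integrable fun z => g z * d z :=
    hd.integrable_smul_left_of_hasCompactSupport hg.continuous hgc
  have i2 : Integrable fun z => ρ z * d z :=
    hd.integrable_smul_left_of_hasCompactSupport hρ.continuous hρc
  have := key (fun z => g z - (∫ x, g x) * ρ z) (hg.sub (contDiff_const.mul hρ))
    (hgc.sub hρc.mul_left) (by
      rw [integral_sub hgi (hρi.const_mul _), integral_const_mul, hρ1]; ring)
  simp only [sub_mul, mul_assoc] at this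
  rw [integral_sub i1 (i2.const_mul _), integral_const_mul] at this
  simp only [smul_eq_mul, mul_sub]
  rw [integral_sub i1 (hgi.mul_const _), integral_mul_const]
  exact this

theorem L2.locallyIntegrable (v : L2 ℝ) : LocallyIntegrable v :=
  (Lp.memLp v).locallyIntegrable (by norm_num)

/-- A function in `H¹(ℝ)` has an absolutely continuous representative. -/
theorem IsWeakDeriv.exists_isPrimitive {u v : L2 ℝ} (h : IsWeakDeriv u v) :
    ∃ U : ℝ → ℝ, u =ᵐ[volume] U ∧ IsPrimitive U v := by
  have hp : IsPrimitive (fun x => ∫ z in (0 : ℝ)..x, v z) v := by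
    refine ⟨L2.locallyIntegrable v, fun a b => ?_⟩
    have hi : ∀ a b, IntervalIntegrable v volume a b := fun a b => intervalIntegrable_iff.mpr <|
      ((L2.locallyIntegrable v).integrableOn_isCompact isCompact_uIcc).mono_set uIoc_subset_uIcc
    exact intervalIntegral.integral_interval_sub_left (hi _ _) (hi _ _)
  obtain ⟨c, hc⟩ := ae_eq_const_of_integral_deriv_mul_eq_zero
    ((L2.locallyIntegrable u).sub hp.continuous.locallyIntegrable) (by
      intro φ hφ hφc
      have hd : Continuous (deriv φ) := hφ.continuous_deriv (by simp)
      have i1 : Integrable fun z => deriv φ z * u z := integrable_smul_L2 u hd hφc.deriv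
      have i2 : Integrable fun x => deriv φ x * ∫ z in (0 : ℝ)..x, v z :=
        hp.continuous.locallyIntegrable.integrable_smul_left_of_hasCompactSupport hd hφc.deriv
      simp only [Pi.sub_apply, mul_sub]
      rw [integral_sub i1 i2, hp.integral_deriv_mul (hφ.of_le (by simp)) hφc, sub_eq_zero]
      exact h φ hφ hφc)
  refine ⟨fun x => (∫ z in (0 : ℝ)..x, v z) + c, ?_, hp.locInt, fun a b => ?_⟩
  · filter_upwards [hc] with z hz
    rw [Pi.sub_apply] at hz
    linarith
  · rw [add_sub_add_right_eq_sub]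
    exact hp.sub_eq a b

theorem L2.integrable_mul (u v : L2 ℝ) : Integrable fun z => u z * v z :=
  (Lp.memLp u).integrable_mul (Lp.memLp v)

/-- Integration by parts in `H¹(ℝ)`. -/
theorem IsWeakDeriv.integral_mul_add {u v u' v' : L2 ℝ} (h : IsWeakDeriv u v)
    (h' : IsWeakDeriv u' v') : ∫ z, (v z * u' z + u z * v' z) = 0 := by
  obtain ⟨U, hU, hp⟩ := h.exists_isPrimitive
  obtain ⟨U', hU', hp'⟩ := h'.exists_isPrimitive
  have e : (fun z => v z * u' z + u z * v' z) =ᵐ[volume] fun z => v z * U' z + U z * v' z := by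
    filter_upwards [hU, hU'] with z h1 h2
    rw [h1, h2]
  have e' : (fun z => u z * u' z) =ᵐ[volume] fun z => U z * U' z := by
    filter_upwards [hU, hU'] with z h1 h2
    rw [h1, h2]
  rw [integral_congr_ae e]
  exact (hp.mul hp').integral_eq_zero ((L2.integrable_mul u u').congr e')
    (((L2.integrable_mul v u').add (L2.integrable_mul u v')).congr e)

theorem L2.integrable_mul_of_ae_eq {U : ℝ → ℝ} {u : L2 ℝ} (v : L2 ℝ)
    (hU : u =ᵐ[volume] U) : Integrable (fun z => U z * U z) ∧
      Integrable (fun z => v z * U z + U z * v z) := by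
  constructor
  · refine (L2.integrable_mul u u).congr ?_
    filter_upwards [hU] with z h1
    rw [h1]
  · refine ((L2.integrable_mul v u).add (L2.integrable_mul u v)).congr ?_
    filter_upwards [hU] with z h1
    simp only [Pi.add_apply]
    rw [h1]

/-- A function in `H¹(ℝ)` is bounded, since the derivative `2 U U'` of `U²` is integrable. -/
theorem IsPrimitive.exists_bound {U : ℝ → ℝ} {u v : L2 ℝ} (hp : IsPrimitive U v)
    (hU : u =ᵐ[volume] U) : ∃ B, ∀ z, |U z| ≤ B := by
  obtain ⟨h1, h2⟩ := L2.integrable_mul_of_ae_eq v hU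
  set I := ∫ z, ‖v z * U z + U z * v z‖
  have hb : ∀ z, U z * U z ≤ U 0 * U 0 + I := by
    intro z
    have e := (hp.mul hp).sub_eq 0 z
    have : |∫ x in (0 : ℝ)..z, (v x * U x + U x * v x)| ≤ I := by
      refine (intervalIntegral.norm_integral_le_integral_norm_uIoc
        (f := fun x => v x * U x + U x * v x)).trans ?_
      exact setIntegral_le_integral h2.norm (Eventually.of_forall fun _ => norm_nonneg _)
    rw [← e] at this
    linarith [(abs_le.1 this).2]
  refine ⟨U 0 * U 0 + I + 1, fun z => ?_⟩
  nlinarith [hb z, sq_abs (U z), sq_nonneg (|U z| - 1), abs_nonneg (U z)]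

/-! ### Real and imaginary parts, and the isomorphism `1 - ∂²` -/

section Components

variable {𝕜 : Type} [RCLike 𝕜]

/-- The real part of an `L²` function, as a real-linear map. -/
noncomputable def reL (𝕜 : Type) [RCLike 𝕜] : L2 𝕜 →L[ℝ] L2 ℝ :=
  (RCLike.reCLM : 𝕜 →L[ℝ] ℝ).compLpL 2 volume

/-- The imaginary part of an `L²` function, as a real-linear map. -/
noncomputable def imL (𝕜 : Type) [RCLike 𝕜] : L2 𝕜 →L[ℝ] L2 ℝ :=
  (RCLike.imCLM : 𝕜 →L[ℝ] ℝ).compLpL 2 volume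

theorem coeFn_reL (u : L2 𝕜) : ∀ᵐ z, reL 𝕜 u z = RCLike.re (u z) :=
  (RCLike.reCLM : 𝕜 →L[ℝ] ℝ).coeFn_compLp u

theorem coeFn_imL (u : L2 𝕜) : ∀ᵐ z, imL 𝕜 u z = RCLike.im (u z) :=
  (RCLike.imCLM : 𝕜 →L[ℝ] ℝ).coeFn_compLp u

theorem L2.inner_real (u v : L2 ℝ) : ⟪u, v⟫_ℝ = ∫ z, u z * v z := by
  rw [L2.inner_def]
  simp [mul_comm]

theorem re_inner_eq (u v : L2 𝕜) :
    RCLike.re ⟪u, v⟫_𝕜 = ⟪reL 𝕜 u, reL 𝕜 v⟫_ℝ + ⟪imL 𝕜 u, imL 𝕜 v⟫_ℝ := by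
  rw [L2.inner_real, L2.inner_real, ← integral_add (L2.integrable_mul _ _)
    (L2.integrable_mul _ _), L2.inner_def, ← integral_re (L2.integrable_inner u v)]
  refine integral_congr_ae ?_
  filter_upwards [coeFn_reL u, coeFn_imL u, coeFn_reL v, coeFn_imL v] with z h1 h2 h3 h4
  rw [h1, h2, h3, h4, RCLike.inner_apply]
  simp
  ring

theorem im_inner_eq (u v : L2 𝕜) :
    RCLike.im ⟪u, v⟫_𝕜 = ⟪reL 𝕜 u, imL 𝕜 v⟫_ℝ - ⟪imL 𝕜 u, reL 𝕜 v⟫_ℝ := by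
  rw [L2.inner_real, L2.inner_real, ← integral_sub (L2.integrable_mul _ _)
    (L2.integrable_mul _ _), L2.inner_def, ← integral_im (L2.integrable_inner u v)]
  refine integral_congr_ae ?_
  filter_upwards [coeFn_reL u, coeFn_imL u, coeFn_reL v, coeFn_imL v] with z h1 h2 h3 h4
  rw [h1, h2, h3, h4, RCLike.inner_apply]
  simp
  ring

theorem norm_sq_eq_reL_add_imL (u : L2 𝕜) : ‖u‖ ^ 2 = ‖reL 𝕜 u‖ ^ 2 + ‖imL 𝕜 u‖ ^ 2 := by
  rw [← inner_self_eq_norm_sq (𝕜 := 𝕜), re_inner_eq, real_inner_self_eq_norm_sq,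
    real_inner_self_eq_norm_sq]

theorem IsWeakDeriv.compLp {u v : L2 𝕜} (h : IsWeakDeriv u v) {𝕜' : Type} [RCLike 𝕜']
    (L : 𝕜 →L[ℝ] 𝕜') : IsWeakDeriv (L.compLp u) (L.compLp v) := by
  have e : ∀ (w : L2 𝕜) (φ : ℝ → ℝ), Continuous φ → HasCompactSupport φ →
      ∫ z, φ z • L.compLp w z = L (∫ z, φ z • w z) := by
    intro w φ hφ hc
    rw [← L.integral_comp_comm (integrable_smul_L2 w hφ hc)]
    refine integral_congr_ae ?_
    filter_upwards [L.coeFn_compLp w] with z hz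
    rw [hz, map_smul]
  intro φ hφ hc
  rw [e u _ (hφ.continuous_deriv (by simp)) hc.deriv, e v _ hφ.continuous hc, h φ hφ hc, map_neg]

theorem IsWeakDeriv.inner_real {u v u' v' : L2 ℝ} (h : IsWeakDeriv u v)
    (h' : IsWeakDeriv u' v') : ⟪v, u'⟫_ℝ = -⟪u, v'⟫_ℝ := by
  rw [L2.inner_real, L2.inner_real, eq_neg_iff_add_eq_zero,
    ← integral_add (L2.integrable_mul _ _) (L2.integrable_mul _ _)]
  exact h.integral_mul_add h'

/-- Integration by parts in `H¹`, real or complex. -/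
theorem IsWeakDeriv.inner_eq {u v u' v' : L2 𝕜} (h : IsWeakDeriv u v)
    (h' : IsWeakDeriv u' v') : ⟪v, u'⟫_𝕜 = -⟪u, v'⟫_𝕜 := by
  have hr : IsWeakDeriv (reL 𝕜 u) (reL 𝕜 v) := h.compLp _
  have hi : IsWeakDeriv (imL 𝕜 u) (imL 𝕜 v) := h.compLp _
  have hr' : IsWeakDeriv (reL 𝕜 u') (reL 𝕜 v') := h'.compLp _
  have hi' : IsWeakDeriv (imL 𝕜 u') (imL 𝕜 v') := h'.compLp _
  refine RCLike.ext ?_ ?_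
  · rw [map_neg, re_inner_eq, re_inner_eq, hr.inner_real hr', hi.inner_real hi']
    ring
  · rw [map_neg, im_inner_eq, im_inner_eq, hr.inner_real hi', hi.inner_real hr']
    ring

end Components

section Sobolev

variable {𝕜 : Type} [RCLike 𝕜]

/-- A continuous compactly supported function as an element of `L²`, characterized by its
pairing with `L²`. -/
theorem exists_L2_test (𝕜 : Type) [RCLike 𝕜] {φ : ℝ → ℝ} (hφ : Continuous φ)
    (hc : HasCompactSupport φ) : ∃ p : L2 𝕜, (∀ᵐ z, p z = (φ z : 𝕜)) ∧
      ∀ u : L2 𝕜, ∫ z, φ z • u z = ⟪p, u⟫_𝕜 := by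
  have hm : MemLp (fun z => (φ z : 𝕜)) 2 volume :=
    (RCLike.continuous_ofReal.comp hφ).memLp_of_hasCompactSupport
      (hc.comp_left (g := fun x : ℝ => (x : 𝕜)) (by simp))
  refine ⟨hm.toLp, hm.coeFn_toLp, fun u => ?_⟩
  rw [L2.inner_def]
  refine integral_congr_ae ?_
  filter_upwards [hm.coeFn_toLp] with z hz
  rw [hz, RCLike.inner_apply, RCLike.conj_ofReal, RCLike.real_smul_eq_coe_mul, mul_comm]

theorem isClosed_isWeakDeriv (𝕜 : Type) [RCLike 𝕜] :
    IsClosed {p : L2 𝕜 × L2 𝕜 | IsWeakDeriv p.1 p.2} := by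
  simp only [IsWeakDeriv, Set.ofPred_forall]
  refine isClosed_iInter fun φ => isClosed_iInter fun hφ => isClosed_iInter fun hc => ?_
  obtain ⟨p, -, hp⟩ := exists_L2_test 𝕜 hφ.continuous hc
  obtain ⟨q, -, hq⟩ := exists_L2_test 𝕜 (hφ.continuous_deriv (by simp)) hc.deriv
  simp only [hp, hq]
  exact isClosed_eq (by fun_prop) (by fun_prop)

instance : CompleteSpace (H2 𝕜) := by
  have hcl : IsClosed (sobolevTwo 𝕜 : Set (PiLp 2 (fun _ : Fin 3 => L2 𝕜))) := by
    have h1 : Continuous fun U : PiLp 2 (fun _ : Fin 3 => L2 𝕜) => (U 0, U 1) := by fun_prop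
    have h2 : Continuous fun U : PiLp 2 (fun _ : Fin 3 => L2 𝕜) => (U 1, U 2) := by fun_prop
    exact ((isClosed_isWeakDeriv 𝕜).preimage h1).inter ((isClosed_isWeakDeriv 𝕜).preimage h2)
  exact hcl.completeSpace_coe

/-- The inclusion `H² → L²`. -/
noncomputable def H2.fnL (𝕜 : Type) [RCLike 𝕜] : H2 𝕜 →L[𝕜] L2 𝕜 :=
  (PiLp.proj 2 (fun _ : Fin 3 => L2 𝕜) 0) ∘L (sobolevTwo 𝕜).subtypeL

/-- The weak derivative `H² → L²`. -/
noncomputable def H2.derivL (𝕜 : Type) [RCLike 𝕜] : H2 𝕜 →L[𝕜] L2 𝕜 :=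
  (PiLp.proj 2 (fun _ : Fin 3 => L2 𝕜) 1) ∘L (sobolevTwo 𝕜).subtypeL

/-- The second weak derivative `H² → L²`. -/
noncomputable def H2.deriv2L (𝕜 : Type) [RCLike 𝕜] : H2 𝕜 →L[𝕜] L2 𝕜 :=
  (PiLp.proj 2 (fun _ : Fin 3 => L2 𝕜) 2) ∘L (sobolevTwo 𝕜).subtypeL

theorem H2.fnL_apply (U : H2 𝕜) : H2.fnL 𝕜 U = U.fn := rfl

theorem H2.isWeakDeriv_fnL (U : H2 𝕜) : IsWeakDeriv (H2.fnL 𝕜 U) (H2.derivL 𝕜 U) := U.2.1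

theorem H2.isWeakDeriv_derivL (U : H2 𝕜) : IsWeakDeriv (H2.derivL 𝕜 U) (H2.deriv2L 𝕜 U) := U.2.2

/-- The element of `H²` with given function and derivatives. -/
noncomputable def H2.mk {u v w : L2 𝕜} (h : IsWeakDeriv u v) (h' : IsWeakDeriv v w) : H2 𝕜 :=
  ⟨WithLp.toLp 2 ![u, v, w], h, h'⟩

theorem H2.fnL_mk {u v w : L2 𝕜} (h : IsWeakDeriv u v) (h' : IsWeakDeriv v w) :
    H2.fnL 𝕜 (H2.mk h h') = u := rfl

theorem H2.deriv2L_mk {u v w : L2 𝕜} (h : IsWeakDeriv u v) (h' : IsWeakDeriv v w) :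
    H2.deriv2L 𝕜 (H2.mk h h') = w := rfl

theorem H2.fnL_injective : Function.Injective (H2.fnL 𝕜) := by
  rw [injective_iff_map_eq_zero]
  intro U h0
  have h1 : H2.derivL 𝕜 U = 0 := by
    have := U.isWeakDeriv_fnL
    rw [h0] at this
    exact this.eq_zero
  have h2 : H2.deriv2L 𝕜 U = 0 := by
    have := U.isWeakDeriv_derivL
    rw [h1] at this
    exact this.eq_zero
  refine Subtype.ext ?_
  ext1 i
  fin_cases i
  · exact h0
  · exact h1
  · exact h2

theorem H2.inner_deriv2L (U V : H2 𝕜) :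
    ⟪H2.deriv2L 𝕜 U, H2.fnL 𝕜 V⟫_𝕜 = -⟪H2.derivL 𝕜 U, H2.derivL 𝕜 V⟫_𝕜 :=
  U.isWeakDeriv_derivL.inner_eq V.isWeakDeriv_fnL

theorem H2.inner_deriv2L_right (U V : H2 𝕜) :
    ⟪H2.fnL 𝕜 U, H2.deriv2L 𝕜 V⟫_𝕜 = -⟪H2.derivL 𝕜 U, H2.derivL 𝕜 V⟫_𝕜 := by
  rw [eq_neg_iff_add_eq_zero, U.isWeakDeriv_fnL.inner_eq V.isWeakDeriv_derivL, add_neg_cancel]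

/-- The operator `1 - ∂²` from `H²` to `L²`. -/
noncomputable def H2.helmholtzL (𝕜 : Type) [RCLike 𝕜] : H2 𝕜 →L[𝕜] L2 𝕜 :=
  H2.fnL 𝕜 - H2.deriv2L 𝕜

theorem H2.inner_helmholtzL (U V : H2 𝕜) :
    ⟪H2.helmholtzL 𝕜 U, H2.fnL 𝕜 V⟫_𝕜 = ⟪H2.fnL 𝕜 U, H2.helmholtzL 𝕜 V⟫_𝕜 := by
  simp only [H2.helmholtzL, sub_apply, inner_sub_left, inner_sub_right,
    H2.inner_deriv2L, H2.inner_deriv2L_right]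

theorem H2.helmholtzL_injective : Function.Injective (H2.helmholtzL 𝕜) := by
  rw [injective_iff_map_eq_zero]
  intro U h
  have h1 : RCLike.re ⟪H2.helmholtzL 𝕜 U, H2.fnL 𝕜 U⟫_𝕜 = 0 := by simp [h]
  rw [H2.helmholtzL, sub_apply, inner_sub_left, H2.inner_deriv2L,
    sub_neg_eq_add, map_add, inner_self_eq_norm_sq, inner_self_eq_norm_sq] at h1
  refine H2.fnL_injective ?_
  rw [map_zero, ← norm_eq_zero]
  nlinarith [sq_nonneg ‖H2.fnL 𝕜 U‖, sq_nonneg ‖H2.derivL 𝕜 U‖]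

/-- The graph of the weak derivative as a closed subspace of the Hilbert sum `L² ⊕ L²`; with the
induced norm it is the Sobolev space `H¹`. -/
noncomputable def weakDerivGraph (𝕜 : Type) [RCLike 𝕜] : Submodule 𝕜 (WithLp 2 (L2 𝕜 × L2 𝕜)) where
  carrier := {p | IsWeakDeriv p.fst p.snd}
  add_mem' := fun h h' => h.add h'
  zero_mem' := isWeakDeriv_zero
  smul_mem' := fun c _ h => h.smul c

/-- Weak solvability of `u - u'' = g`: the `H¹` solution is the orthogonal projection of `(g, 0)`
onto the graph of the weak derivative. -/
theorem H2.helmholtzL_surjective : Function.Surjective (H2.helmholtzL 𝕜) := by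
  intro g
  have hcl : IsClosed (weakDerivGraph 𝕜 : Set (WithLp 2 (L2 𝕜 × L2 𝕜))) := by
    have h1 : Continuous fun p : WithLp 2 (L2 𝕜 × L2 𝕜) => (p.fst, p.snd) := by
      exact WithLp.prod_continuous_ofLp 2 _ _
    exact (isClosed_isWeakDeriv 𝕜).preimage h1
  have : CompleteSpace (weakDerivGraph 𝕜) := hcl.completeSpace_coe
  set G : WithLp 2 (L2 𝕜 × L2 𝕜) := WithLp.toLp 2 (g, 0)
  set P := (weakDerivGraph 𝕜).starProjection G with hP
  have hPm : IsWeakDeriv P.fst P.snd := (weakDerivGraph 𝕜).starProjection_apply_mem G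
  have hP2 : IsWeakDeriv P.snd (P.fst - g) := by
    intro φ hφ hc
    have hd : Continuous (deriv φ) := hφ.continuous_deriv (by simp)
    obtain ⟨p, hpe, hp⟩ := exists_L2_test 𝕜 hφ.continuous hc
    obtain ⟨q, hqe, hq⟩ := exists_L2_test 𝕜 hd hc.deriv
    have hpq : IsWeakDeriv p q := by
      intro χ hχ hχc
      have e1 : ∫ z, deriv χ z • p z = ((∫ z, deriv χ z * φ z : ℝ) : 𝕜) := by
        rw [← integral_ofReal]
        refine integral_congr_ae ?_
        filter_upwards [hpe] with z hz
        rw [hz, RCLike.real_smul_eq_coe_mul, RCLike.ofReal_mul]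
      have e2 : ∫ z, χ z • q z = ((∫ z, χ z * deriv φ z : ℝ) : 𝕜) := by
        rw [← integral_ofReal]
        refine integral_congr_ae ?_
        filter_upwards [hqe] with z hz
        rw [hz, RCLike.real_smul_eq_coe_mul, RCLike.ofReal_mul]
      have hprim : IsPrimitive φ (deriv φ) :=
        .of_hasDerivAt (fun x => (hφ.differentiable (by simp) x).hasDerivAt) hd
      rw [e1, e2, hprim.integral_deriv_mul (hχ.of_le (by simp)) hχc, RCLike.ofReal_neg]
    have horth := (weakDerivGraph 𝕜).sub_starProjection_mem_orthogonal G
      (WithLp.toLp 2 (p, q)) hpq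
    rw [WithLp.prod_inner_apply] at horth
    change ⟪p, g - P.fst⟫_𝕜 + ⟪q, 0 - P.snd⟫_𝕜 = 0 at horth
    rw [hp, hq]
    rw [inner_sub_right] at horth ⊢
    rw [zero_sub, inner_neg_right] at horth
    linear_combination -horth
  refine ⟨H2.mk hPm hP2, ?_⟩
  rw [H2.helmholtzL, sub_apply, H2.fnL_mk, H2.deriv2L_mk]
  abel

/-- `1 - ∂²` is an isomorphism from `H²` onto `L²`. -/
noncomputable def H2.helmholtzEquiv (𝕜 : Type) [RCLike 𝕜] : H2 𝕜 ≃L[𝕜] L2 𝕜 :=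
  ContinuousLinearEquiv.ofBijective (H2.helmholtzL 𝕜)
    (LinearMap.ker_eq_bot.2 H2.helmholtzL_injective)
    (LinearMap.range_eq_top.2 H2.helmholtzL_surjective)

theorem H2.helmholtzEquiv_apply (U : H2 𝕜) :
    H2.helmholtzEquiv 𝕜 U = H2.fnL 𝕜 U - H2.deriv2L 𝕜 U := rfl

end Sobolev

/-! ### Symmetric operators with a spectral gap -/

section Abstract

variable {𝕜 X Y : Type*} [RCLike 𝕜] [NormedAddCommGroup X] [NormedSpace 𝕜 X]
  [NormedAddCommGroup Y] [InnerProductSpace 𝕜 Y]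

/-- A bounded symmetric perturbation of a symmetric isomorphism `S` (relative to the embedding `J`)
is bijective as soon as it and its adjoint are bounded below: the range is closed, and an element
of its orthogonal complement lies in the range of `J` and is a null vector of the adjoint. -/
theorem bijective_of_lower_bound [CompleteSpace X] [CompleteSpace Y] (S : X ≃L[𝕜] Y)
    (J : X →L[𝕜] Y) (K : Y →L[𝕜] Y)
    (hS : ∀ x y, ⟪S x, J y⟫_𝕜 = ⟪J x, S y⟫_𝕜) (hK : ∀ x y, ⟪K x, y⟫_𝕜 = ⟪x, K y⟫_𝕜) (μ : 𝕜)
    {δ : ℝ} (hδ : 0 < δ) (hlow : ∀ x, δ * ‖J x‖ ≤ ‖S x + K (J x) - μ • J x‖)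
    (hlow' : ∀ x, δ * ‖J x‖ ≤ ‖S x + K (J x) - (starRingEnd 𝕜 μ) • J x‖) :
    Function.Bijective fun x => S x + K (J x) - μ • J x := by
  set T : X →L[𝕜] Y := (S : X →L[𝕜] Y) + K ∘L J - μ • J with hT
  have hTx : ∀ x, T x = S x + K (J x) - μ • J x := fun x => rfl
  have hbd : ∀ x, ‖x‖ ≤ ‖(S.symm : Y →L[𝕜] X)‖ * (1 + (‖K‖ + ‖μ‖) / δ) * ‖T x‖ := by
    intro x
    have h1 : ‖x‖ ≤ ‖(S.symm : Y →L[𝕜] X)‖ * ‖S x‖ := by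
      simpa using (S.symm : Y →L[𝕜] X).le_opNorm (S x)
    have h2 : ‖S x‖ ≤ ‖T x‖ + (‖K‖ + ‖μ‖) * ‖J x‖ := by
      have e : S x = T x - (K (J x) - μ • J x) := by rw [hTx]; abel
      rw [e]
      refine (norm_sub_le _ _).trans ?_
      gcongr
      refine (norm_sub_le _ _).trans ?_
      rw [norm_smul, add_mul]
      gcongr
      exact K.le_opNorm _
    have h3 : ‖J x‖ ≤ ‖T x‖ / δ := by
      rw [le_div_iff₀ hδ, mul_comm, hTx]
      exact hlow x
    calc ‖x‖ ≤ ‖(S.symm : Y →L[𝕜] X)‖ * (‖T x‖ + (‖K‖ + ‖μ‖) * (‖T x‖ / δ)) := by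
            refine h1.trans ?_
            gcongr
            refine h2.trans ?_
            gcongr
      _ = _ := by ring
  have hanti : AntilipschitzWith
      (Real.toNNReal (‖(S.symm : Y →L[𝕜] X)‖ * (1 + (‖K‖ + ‖μ‖) / δ))) T := by
    refine AddMonoidHomClass.antilipschitz_of_bound T fun x => ?_
    rw [Real.coe_toNNReal _ (by positivity)]
    exact hbd x
  refine ⟨hanti.injective, ?_⟩
  have hclosed : IsClosed (T.range : Set Y) := by
    rw [LinearMap.coe_range]
    exact hanti.isClosed_range T.uniformContinuous
  have hperp : T.rangeᗮ = ⊥ := by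
    rw [Submodule.eq_bot_iff]
    intro g hg
    have hg' : ∀ x, ⟪T x, g⟫_𝕜 = 0 := fun x => hg _ ⟨x, rfl⟩
    set k : Y := K g - (starRingEnd 𝕜 μ) • g with hk
    set x₀ : X := -S.symm k with hx₀
    have hSx₀ : S x₀ = -k := by simp [hx₀]
    have hgJ : g = J x₀ := by
      rw [← sub_eq_zero, ← inner_self_eq_zero (𝕜 := 𝕜)]
      have key : ∀ y, ⟪y, g - J x₀⟫_𝕜 = 0 := by
        intro y
        have h1 := hg' (S.symm y)
        rw [hTx, S.apply_symm_apply, inner_sub_left, inner_add_left, hK, inner_smul_left] at h1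
        have h2 := hS (S.symm y) x₀
        rw [S.apply_symm_apply, hSx₀, inner_neg_right, hk, inner_sub_right, inner_smul_right] at h2
        rw [inner_sub_right]
        linear_combination h1 - h2
      exact key _
    have h0 := hlow' x₀
    rw [hSx₀, ← hgJ, hk] at h0
    have : δ * ‖g‖ ≤ 0 := by
      refine h0.trans_eq ?_
      rw [norm_eq_zero]
      abel
    rw [← norm_eq_zero]
    nlinarith [norm_nonneg g]
  have htop : T.range = ⊤ := by
    rw [← hclosed.submodule_topologicalClosure_eq]
    have : CompleteSpace T.range := hclosed.completeSpace_coe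
    rw [hclosed.submodule_topologicalClosure_eq]
    exact (Submodule.orthogonal_eq_bot_iff).1 hperp
  exact LinearMap.range_eq_top.1 htop

variable {J T : X →L[𝕜] Y}

/-- Lower bound for `T + N P - μ`, where `P` is the projection onto the eigenvector `J φ` and `T`
is bounded below by `c` on its complement. -/
theorem lower_bound_of_gap (hT : ∀ x y, ⟪T x, J y⟫_𝕜 = ⟪J x, T y⟫_𝕜) {φ : X} {l c : ℝ}
    (hφ : ‖J φ‖ = 1) (hTφ : T φ = (l : 𝕜) • J φ)
    (hgap : ∀ x, ⟪J φ, J x⟫_𝕜 = 0 → c * ‖J x‖ ^ 2 ≤ RCLike.re ⟪T x, J x⟫_𝕜)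
    (N : ℝ) (μ : 𝕜) {δ : ℝ} (hδ : 0 ≤ δ) (hδ1 : δ ≤ ‖((l + N : ℝ) : 𝕜) - μ‖)
    (hδ2 : ∀ t : ℝ, c ≤ t → δ ≤ ‖(t : 𝕜) - μ‖) (x : X) :
    δ * ‖J x‖ ≤ ‖T x + (N : 𝕜) • (⟪J φ, J x⟫_𝕜 • J φ) - μ • J x‖ := by
  set β := ⟪J φ, J x⟫_𝕜 with hβ
  set y := x - β • φ with hy
  have hee : ⟪J φ, J φ⟫_𝕜 = 1 := by rw [inner_self_eq_norm_sq_to_K, hφ]; simp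
  have hJx : J x = β • J φ + J y := by rw [hy, map_sub, map_smul]; abel
  have hTx : T x = (β * l) • J φ + T y := by
    rw [hy, map_sub, map_smul, hTφ, smul_smul]
    abel
  have hey : ⟪J φ, J y⟫_𝕜 = 0 := by
    rw [hy, map_sub, map_smul, inner_sub_right, inner_smul_right, hee, hβ]
    ring
  have heT : ⟪J φ, T y⟫_𝕜 = 0 := by
    rw [← hT, hTφ, inner_smul_left, hey, mul_zero]
  set r := T y - μ • J y with hr
  have her : ⟪J φ, r⟫_𝕜 = 0 := by
    rw [hr, inner_sub_right, inner_smul_right, heT, hey]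
    ring
  have hz : T x + (N : 𝕜) • (β • J φ) - μ • J x = (β * (((l + N : ℝ) : 𝕜) - μ)) • J φ + r := by
    rw [hTx, hJx, hr]
    push_cast
    module
  have hr_low : δ * ‖J y‖ ≤ ‖r‖ := by
    rcases eq_or_ne (J y) 0 with h0 | h0
    · rw [h0, norm_zero, mul_zero]
      exact norm_nonneg _
    have hpos : 0 < ‖J y‖ := norm_pos_iff.2 h0
    set t := RCLike.re ⟪T y, J y⟫_𝕜 / ‖J y‖ ^ 2 with ht
    have hct : c ≤ t := by
      rw [ht, le_div_iff₀ (by positivity)]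
      exact hgap y hey
    have hreal : ⟪J y, T y⟫_𝕜 = ((t * ‖J y‖ ^ 2 : ℝ) : 𝕜) := by
      rw [ht, div_mul_cancel₀ _ (by positivity), ← hT y y]
      refine ((RCLike.conj_eq_iff_re).1 ?_).symm
      rw [inner_conj_symm, hT]
    have hir : ⟪J y, r⟫_𝕜 = ((t : 𝕜) - μ) * ((‖J y‖ ^ 2 : ℝ) : 𝕜) := by
      rw [hr, inner_sub_right, inner_smul_right, hreal, inner_self_eq_norm_sq_to_K]
      push_cast
      ring
    have h1 : ‖((t : 𝕜) - μ)‖ * ‖J y‖ ^ 2 ≤ ‖J y‖ * ‖r‖ := by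
      have := norm_inner_le_norm (𝕜 := 𝕜) (J y) r
      rwa [hir, norm_mul, RCLike.norm_ofReal, abs_of_nonneg (by positivity)] at this
    have h2 := hδ2 t hct
    have h3 : δ * ‖J y‖ ^ 2 ≤ ‖J y‖ * ‖r‖ := le_trans (by gcongr) h1
    nlinarith
  rw [hz, hJx]
  have n1 : ‖β • J φ + J y‖ ^ 2 = ‖β‖ ^ 2 + ‖J y‖ ^ 2 := by
    have := norm_add_sq_eq_norm_sq_add_norm_sq_of_inner_eq_zero (𝕜 := 𝕜) (β • J φ) (J y)
      (by rw [inner_smul_left, hey, mul_zero])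
    rw [norm_smul, hφ, mul_one] at this
    rw [sq, this]
    ring
  have n2 : ‖(β * (((l + N : ℝ) : 𝕜) - μ)) • J φ + r‖ ^ 2 =
      (‖β‖ * ‖((l + N : ℝ) : 𝕜) - μ‖) ^ 2 + ‖r‖ ^ 2 := by
    have := norm_add_sq_eq_norm_sq_add_norm_sq_of_inner_eq_zero (𝕜 := 𝕜)
      ((β * (((l + N : ℝ) : 𝕜) - μ)) • J φ) r (by rw [inner_smul_left, her, mul_zero])
    rw [norm_smul, hφ, mul_one, norm_mul] at this
    rw [sq, this]
    ring
  refine le_of_sq_le_sq ?_ (norm_nonneg _)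
  rw [mul_pow, n1, n2, mul_add]
  have a1 : (δ * ‖β‖) ^ 2 ≤ (‖β‖ * ‖((l + N : ℝ) : 𝕜) - μ‖) ^ 2 := by
    rw [mul_comm δ]
    gcongr
  have a2 : (δ * ‖J y‖) ^ 2 ≤ ‖r‖ ^ 2 := by gcongr
  nlinarith

/-- A lower bound on the complement of `w` carries over to the complement of an eigenvector `J φ`
which is not orthogonal to `w` and has eigenvalue at most the bound. -/
theorem gap_of_eigenvector (hT : ∀ x y, ⟪T x, J y⟫_𝕜 = ⟪J x, T y⟫_𝕜) {φ : X} {l c : ℝ} {w : Y}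
    (hTφ : T φ = (l : 𝕜) • J φ) (hlc : l ≤ c) (hw : ⟪w, J φ⟫_𝕜 ≠ 0)
    (hgap : ∀ x, ⟪w, J x⟫_𝕜 = 0 → c * ‖J x‖ ^ 2 ≤ RCLike.re ⟪T x, J x⟫_𝕜) (x : X)
    (hx : ⟪J φ, J x⟫_𝕜 = 0) : c * ‖J x‖ ^ 2 ≤ RCLike.re ⟪T x, J x⟫_𝕜 := by
  set α := -⟪w, J x⟫_𝕜 / ⟪w, J φ⟫_𝕜 with hα
  have h0 : ⟪w, J (x + α • φ)⟫_𝕜 = 0 := by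
    rw [map_add, map_smul, inner_add_right, inner_smul_right, hα, div_mul_cancel₀ _ hw]
    ring
  have h1 := hgap _ h0
  have hx' : ⟪J x, J φ⟫_𝕜 = 0 := by rw [← inner_conj_symm, hx, map_zero]
  have hTx : ⟪T x, J φ⟫_𝕜 = 0 := by rw [hT, hTφ, inner_smul_right, hx', mul_zero]
  have e1 : ‖J (x + α • φ)‖ ^ 2 = ‖J x‖ ^ 2 + ‖α • J φ‖ ^ 2 := by
    rw [map_add, map_smul, sq,
      norm_add_sq_eq_norm_sq_add_norm_sq_of_inner_eq_zero (𝕜 := 𝕜) (J x) (α • J φ)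
        (by rw [inner_smul_right, hx', mul_zero])]
    ring
  have e2 : RCLike.re ⟪T (x + α • φ), J (x + α • φ)⟫_𝕜 =
      RCLike.re ⟪T x, J x⟫_𝕜 + l * ‖α • J φ‖ ^ 2 := by
    have e3 : T (α • φ) = (l : 𝕜) • (α • J φ) := by rw [map_smul, hTφ, smul_comm]
    rw [map_add T, map_add J, e3, map_smul J, inner_add_left, inner_add_right, inner_add_right,
      inner_smul_right, hTx, inner_smul_left, inner_smul_left (α • J φ) (α • J φ),
      inner_smul_left (J φ) (J x), hx, RCLike.conj_ofReal, inner_self_eq_norm_sq_to_K]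
    simp only [mul_zero, add_zero, zero_add, map_add]
    congr 1
    rw [← RCLike.ofReal_pow, ← RCLike.ofReal_mul, RCLike.ofReal_re]
  rw [e1, e2] at h1
  nlinarith [sq_nonneg ‖α • J φ‖]

/-- The bordered operator `(s, x) ↦ (T x - s J φ, ⟨J φ, J x⟩)` is bijective if `φ` is a null vector
of `T` and `T` plus the projection onto `J φ` is bijective. -/
theorem bordered_bijective (hT : ∀ x y, ⟪T x, J y⟫_𝕜 = ⟪J x, T y⟫_𝕜) {φ : X}
    (hφ : ‖J φ‖ = 1) (hTφ : T φ = 0)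
    (hbij : Function.Bijective fun x => T x + ⟪J φ, J x⟫_𝕜 • J φ) :
    Function.Bijective fun p : 𝕜 × X => (T p.2 - p.1 • J φ, ⟪J φ, J p.2⟫_𝕜) := by
  have hee : ⟪J φ, J φ⟫_𝕜 = 1 := by rw [inner_self_eq_norm_sq_to_K, hφ]; simp
  have heT : ∀ x, ⟪J φ, T x⟫_𝕜 = 0 := fun x => by rw [← hT, hTφ, inner_zero_left]
  constructor
  · rintro ⟨s, x⟩ ⟨s', x'⟩ h
    simp only [Prod.mk.injEq] at h
    obtain ⟨h1, h2⟩ := h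
    have hs : s = s' := by
      have := congrArg (fun y => ⟪J φ, y⟫_𝕜) h1
      simpa [inner_sub_right, inner_smul_right, heT, hφ] using this
    subst hs
    have hx : x = x' := by
      refine hbij.1 ?_
      simp only [h2]
      rw [sub_left_injective h1]
    rw [hx]
  · rintro ⟨y, s⟩
    obtain ⟨x, hx⟩ := hbij.2 (y - ⟪J φ, y⟫_𝕜 • J φ + s • J φ)
    simp only at hx
    have hs : ⟪J φ, J x⟫_𝕜 = s := by
      have := congrArg (fun y => ⟪J φ, y⟫_𝕜) hx
      simpa [inner_sub_right, inner_add_right, inner_smul_right, heT, hφ] using this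
    refine ⟨(-⟪J φ, y⟫_𝕜, x), ?_⟩
    simp only [Prod.mk.injEq]
    refine ⟨?_, hs⟩
    rw [hs] at hx
    rw [add_right_cancel hx]
    module

end Abstract

/-! ### Multiplication and lattice operators on `L²` -/

section Operators

open scoped BoundedContinuousFunction

variable {𝕜 𝕜' : Type} [RCLike 𝕜] [RCLike 𝕜']

theorem norm_smul_coe_le (b : ℝ →ᵇ ℝ) (u : L2 𝕜) (z : ℝ) : ‖b z • u z‖ ≤ ‖b‖ * ‖u z‖ := by
  rw [norm_smul]
  gcongr
  exact b.norm_coe_le_norm z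

theorem memLp_smul_coe (b : ℝ →ᵇ ℝ) (u : L2 𝕜) : MemLp (fun z => b z • u z) 2 volume :=
  (Lp.memLp u).of_le_mul (b.continuous.aestronglyMeasurable.smul (Lp.aestronglyMeasurable u))
    (Eventually.of_forall (norm_smul_coe_le b u))

theorem norm_toLp_smul_coe_le (b : ℝ →ᵇ ℝ) (u : L2 𝕜) :
    ‖(memLp_smul_coe b u).toLp‖ ≤ ‖b‖ * ‖u‖ := by
  refine Lp.norm_le_mul_norm_of_ae_le_mul ?_
  filter_upwards [(memLp_smul_coe b u).coeFn_toLp] with z hz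
  rw [hz]
  exact norm_smul_coe_le b u z

/-- Multiplication of `L²` functions by a bounded continuous real function. -/
noncomputable def mulAuxL (𝕜 : Type) [RCLike 𝕜] (b : ℝ →ᵇ ℝ) : L2 𝕜 →L[𝕜] L2 𝕜 :=
  LinearMap.mkContinuous
    { toFun := fun u => (memLp_smul_coe b u).toLp
      map_add' := fun u v => by
        rw [← MemLp.toLp_add]
        refine MemLp.toLp_congr _ _ ?_
        filter_upwards [Lp.coeFn_add u v] with z hz
        rw [hz, Pi.add_apply, smul_add]
        rfl
      map_smul' := fun c u => by
        rw [← MemLp.toLp_const_smul]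
        refine MemLp.toLp_congr _ _ ?_
        filter_upwards [Lp.coeFn_smul c u] with z hz
        rw [hz, Pi.smul_apply, smul_comm]
        rfl }
    ‖b‖ (norm_toLp_smul_coe_le b)

theorem norm_mulAuxL_le (b : ℝ →ᵇ ℝ) : ‖mulAuxL 𝕜 b‖ ≤ ‖b‖ :=
  LinearMap.mkContinuous_norm_le _ (norm_nonneg b) _

/-- Multiplication of `L²` functions by a bounded continuous real function, as a bounded linear
function of the multiplier. -/
noncomputable def mulL (𝕜 : Type) [RCLike 𝕜] : (ℝ →ᵇ ℝ) →L[ℝ] L2 𝕜 →L[𝕜] L2 𝕜 :=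
  LinearMap.mkContinuous
    { toFun := mulAuxL 𝕜
      map_add' := fun b b' => by
        ext1 u
        change (memLp_smul_coe (b + b') u).toLp =
          (memLp_smul_coe b u).toLp + (memLp_smul_coe b' u).toLp
        rw [← MemLp.toLp_add]
        exact MemLp.toLp_congr _ _ (Eventually.of_forall fun z => add_smul _ _ _)
      map_smul' := fun c b => by
        ext1 u
        change (memLp_smul_coe (c • b) u).toLp = c • (memLp_smul_coe b u).toLp
        rw [← MemLp.toLp_const_smul]
        exact MemLp.toLp_congr _ _ (Eventually.of_forall fun z => smul_assoc c (b z) (u z)) }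
    1 (fun b => by
      rw [one_mul]
      exact norm_mulAuxL_le b)

theorem coeFn_mulL (b : ℝ →ᵇ ℝ) (u : L2 𝕜) : ∀ᵐ z, mulL 𝕜 b u z = b z • u z :=
  (memLp_smul_coe b u).coeFn_toLp

theorem inner_mulL (b : ℝ →ᵇ ℝ) (u v : L2 𝕜) : ⟪mulL 𝕜 b u, v⟫_𝕜 = ⟪u, mulL 𝕜 b v⟫_𝕜 := by
  rw [L2.inner_def, L2.inner_def]
  refine integral_congr_ae ?_
  filter_upwards [coeFn_mulL b u, coeFn_mulL b v] with z h1 h2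
  rw [h1, h2, RCLike.inner_apply, RCLike.inner_apply, RCLike.real_smul_eq_coe_mul,
    RCLike.real_smul_eq_coe_mul, map_mul, RCLike.conj_ofReal]
  ring

theorem norm_mulL_le (b : ℝ →ᵇ ℝ) : ‖mulL 𝕜 b‖ ≤ ‖b‖ := norm_mulAuxL_le b

theorem compLp_mulL (L : 𝕜 →L[ℝ] 𝕜') (b : ℝ →ᵇ ℝ) (u : L2 𝕜) :
    L.compLp (mulL 𝕜 b u) = mulL 𝕜' b (L.compLp u) := by
  refine Lp.ext ?_
  filter_upwards [L.coeFn_compLp (mulL 𝕜 b u), coeFn_mulL b u, coeFn_mulL b (L.compLp u),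
    L.coeFn_compLp u] with z h1 h2 h3 h4
  rw [h1, h2, h3, h4, map_smul]

/-- Translation `u ↦ u(· - s)` on `L²`. -/
noncomputable def shiftL (𝕜 : Type) [RCLike 𝕜] (s : ℝ) : L2 𝕜 →ₗᵢ[𝕜] L2 𝕜 :=
  Lp.compMeasurePreservingₗᵢ 𝕜 (fun z => z - s) (measurePreserving_sub_right volume s)

theorem coeFn_shiftL (s : ℝ) (u : L2 𝕜) : ∀ᵐ z, shiftL 𝕜 s u z = u (z - s) :=
  Lp.coeFn_compMeasurePreserving u (measurePreserving_sub_right volume s)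

theorem shiftL_neg_apply (s : ℝ) (u : L2 𝕜) : shiftL 𝕜 s (shiftL 𝕜 (-s) u) = u := by
  refine Lp.ext ?_
  filter_upwards [coeFn_shiftL s (shiftL 𝕜 (-s) u),
    (measurePreserving_sub_right volume s).quasiMeasurePreserving.ae
      (coeFn_shiftL (-s) u)] with z h1 h2
  rw [h1, h2]
  simp

theorem inner_shiftL (s : ℝ) (u v : L2 𝕜) : ⟪shiftL 𝕜 s u, v⟫_𝕜 = ⟪u, shiftL 𝕜 (-s) v⟫_𝕜 := by
  conv_lhs => rw [← shiftL_neg_apply s v]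
  rw [LinearIsometry.inner_map_map]

theorem IsLatticeCoupling.summable_abs {a : ℤ → ℝ} (ha : IsLatticeCoupling a) :
    Summable fun k => |a k| := by
  have h : Summable fun n : ℕ => |a n| := by
    rw [← summable_nat_add_iff 1]
    refine Summable.of_nonneg_of_le (fun _ => abs_nonneg _) (fun n => ?_)
      ((summable_nat_add_iff 1).2 ha.moment)
    refine le_mul_of_one_le_right (abs_nonneg _) ?_
    push_cast
    nlinarith [(Nat.cast_nonneg n : (0 : ℝ) ≤ n)]
  refine Summable.of_nat_of_neg h ?_
  simpa only [ha.symm] using h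

/-- The lattice operator `u ↦ ∑ a_k u(· - k)` as a bounded operator on `L²`. -/
noncomputable def latticeL (𝕜 : Type) [RCLike 𝕜] (a : ℤ → ℝ) : L2 𝕜 →L[𝕜] L2 𝕜 :=
  ∑' k : ℤ, (a k : 𝕜) • (shiftL 𝕜 k).toContinuousLinearMap

variable {a : ℤ → ℝ}

theorem hasSum_latticeL (ha : IsLatticeCoupling a) (u : L2 𝕜) :
    HasSum (fun k : ℤ => (a k : 𝕜) • shiftL 𝕜 k u) (latticeL 𝕜 a u) := by
  have hs : Summable fun k : ℤ => (a k : 𝕜) • (shiftL 𝕜 k).toContinuousLinearMap := by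
    refine Summable.of_norm_bounded ha.summable_abs fun k => ?_
    rw [norm_smul, RCLike.norm_ofReal]
    exact mul_le_of_le_one_right (abs_nonneg _) (LinearIsometry.norm_toContinuousLinearMap_le _)
  exact hs.hasSum.mapL (ContinuousLinearMap.apply 𝕜 (L2 𝕜) u)

theorem ae_hasSum_latticeL (ha : IsLatticeCoupling a) (u : L2 𝕜) :
    ∀ᵐ z, HasSum (fun k : ℤ => a k • u (z - k)) (latticeL 𝕜 a u z) := by
  have hn : Summable fun k : ℤ => ‖(a k : 𝕜) • shiftL 𝕜 k u‖ := by
    refine (ha.summable_abs.mul_right ‖u‖).congr fun k => ?_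
    rw [norm_smul, RCLike.norm_ofReal, LinearIsometry.norm_map]
  have h1 := Lp.hasSum_coeFn_tsum (f := fun k : ℤ => (a k : 𝕜) • shiftL 𝕜 k u)
    (tsum_enorm_ne_top_iff_summable_norm.2 hn)
  rw [(hasSum_latticeL ha u).tsum_eq] at h1
  have h2 : ∀ᵐ z, ∀ k : ℤ, ((a k : 𝕜) • shiftL 𝕜 k u) z = a k • u (z - k) := by
    rw [ae_all_iff]
    intro k
    filter_upwards [Lp.coeFn_smul (a k : 𝕜) (shiftL 𝕜 k u), coeFn_shiftL k u] with z h3 h4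
    rw [h3, Pi.smul_apply, h4, RCLike.real_smul_eq_coe_mul, smul_eq_mul]
  filter_upwards [h1, h2] with z h3 h4
  simpa only [h4] using h3

theorem inner_latticeL (ha : IsLatticeCoupling a) (u v : L2 𝕜) :
    ⟪latticeL 𝕜 a u, v⟫_𝕜 = ⟪u, latticeL 𝕜 a v⟫_𝕜 := by
  have h1 : HasSum (fun k : ℤ => ⟪v, (a k : 𝕜) • shiftL 𝕜 k u⟫_𝕜) ⟪v, latticeL 𝕜 a u⟫_𝕜 :=
    (hasSum_latticeL ha u).mapL (innerSL 𝕜 v)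
  have h2 : HasSum (fun k : ℤ => ⟪u, (a k : 𝕜) • shiftL 𝕜 k v⟫_𝕜) ⟪u, latticeL 𝕜 a v⟫_𝕜 :=
    (hasSum_latticeL ha v).mapL (innerSL 𝕜 u)
  have h3 := h1.mapL (RCLike.conjCLE (K := 𝕜) : 𝕜 →L[ℝ] 𝕜)
  rw [← (Equiv.neg ℤ).hasSum_iff] at h3
  simp only [ContinuousLinearEquiv.coe_coe, RCLike.conjCLE_apply, inner_conj_symm] at h3
  refine h3.unique (h2.congr_fun ?_)
  intro k
  simp only [Function.comp_apply, Equiv.neg_apply, inner_smul_left,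
    inner_smul_right, RCLike.conj_ofReal, ha.symm, inner_shiftL]
  push_cast
  rw [neg_neg]

theorem compLp_latticeL (ha : IsLatticeCoupling a) (L : 𝕜 →L[ℝ] 𝕜') (u : L2 𝕜) :
    L.compLp (latticeL 𝕜 a u) = latticeL 𝕜' a (L.compLp u) := by
  refine Lp.ext ?_
  filter_upwards [L.coeFn_compLp (latticeL 𝕜 a u), ae_hasSum_latticeL ha u,
    ae_hasSum_latticeL ha (L.compLp u), ae_shift_eq (L.coeFn_compLp u)] with z h1 h2 h3 h4
  rw [h1]
  refine (h2.mapL L).unique ?_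
  simpa only [h4, map_smul] using h3

end Operators

section Schrodinger

open scoped BoundedContinuousFunction

variable {𝕜 𝕜' : Type} [RCLike 𝕜] [RCLike 𝕜']

/-- The bounded part of the operator `-(∂² + b - ε Δ)` relative to `1 - ∂²`. -/
noncomputable def potentialL (𝕜 : Type) [RCLike 𝕜] (a : ℤ → ℝ) (b : ℝ →ᵇ ℝ) (ε : ℝ) :
    L2 𝕜 →L[𝕜] L2 𝕜 :=
  (ε : 𝕜) • latticeL 𝕜 a - mulL 𝕜 b - 1

/-- The operator `ψ ↦ -(ψ'' + b ψ - ε Δ ψ)` from `H²` to `L²`. -/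
noncomputable def schrL (𝕜 : Type) [RCLike 𝕜] (a : ℤ → ℝ) (b : ℝ →ᵇ ℝ) (ε : ℝ) :
    H2 𝕜 →L[𝕜] L2 𝕜 :=
  H2.helmholtzL 𝕜 + potentialL 𝕜 a b ε ∘L H2.fnL 𝕜

theorem potentialL_apply (a : ℤ → ℝ) (b : ℝ →ᵇ ℝ) (ε : ℝ) (u : L2 𝕜) :
    potentialL 𝕜 a b ε u = (ε : 𝕜) • latticeL 𝕜 a u - mulL 𝕜 b u - u := rfl

theorem schrL_apply (a : ℤ → ℝ) (b : ℝ →ᵇ ℝ) (ε : ℝ) (U : H2 𝕜) :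
    schrL 𝕜 a b ε U = H2.helmholtzEquiv 𝕜 U + potentialL 𝕜 a b ε (H2.fnL 𝕜 U) := rfl

theorem schrL_apply' (a : ℤ → ℝ) (b : ℝ →ᵇ ℝ) (ε : ℝ) (U : H2 𝕜) :
    schrL 𝕜 a b ε U = (ε : 𝕜) • latticeL 𝕜 a (H2.fnL 𝕜 U) - mulL 𝕜 b (H2.fnL 𝕜 U)
      - H2.deriv2L 𝕜 U := by
  rw [schrL_apply, potentialL_apply, H2.helmholtzEquiv_apply]
  abel

variable {a : ℤ → ℝ}

theorem inner_potentialL (ha : IsLatticeCoupling a) (b : ℝ →ᵇ ℝ) (ε : ℝ) (u v : L2 𝕜) :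
    ⟪potentialL 𝕜 a b ε u, v⟫_𝕜 = ⟪u, potentialL 𝕜 a b ε v⟫_𝕜 := by
  simp only [potentialL_apply, inner_sub_left, inner_sub_right, inner_smul_left, inner_smul_right,
    inner_mulL, inner_latticeL ha, RCLike.conj_ofReal]

theorem inner_schrL (ha : IsLatticeCoupling a) (b : ℝ →ᵇ ℝ) (ε : ℝ) (U V : H2 𝕜) :
    ⟪schrL 𝕜 a b ε U, H2.fnL 𝕜 V⟫_𝕜 = ⟪H2.fnL 𝕜 U, schrL 𝕜 a b ε V⟫_𝕜 := by
  rw [schrL_apply, schrL_apply, inner_add_left, inner_add_right, inner_potentialL ha]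
  congr 1
  exact H2.inner_helmholtzL U V

/-- Composition with a real-linear map of scalar fields, on `H²`. -/
noncomputable def H2.map (L : 𝕜 →L[ℝ] 𝕜') (U : H2 𝕜) : H2 𝕜' :=
  H2.mk (U.isWeakDeriv_fnL.compLp L) (U.isWeakDeriv_derivL.compLp L)

theorem H2.fnL_map (L : 𝕜 →L[ℝ] 𝕜') (U : H2 𝕜) :
    H2.fnL 𝕜' (H2.map L U) = L.compLp (H2.fnL 𝕜 U) := rfl

theorem H2.deriv2L_map (L : 𝕜 →L[ℝ] 𝕜') (U : H2 𝕜) :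
    H2.deriv2L 𝕜' (H2.map L U) = L.compLp (H2.deriv2L 𝕜 U) := rfl

theorem schrL_map (ha : IsLatticeCoupling a) (b : ℝ →ᵇ ℝ) (ε : ℝ) (L : 𝕜 →L[ℝ] 𝕜') (U : H2 𝕜) :
    schrL 𝕜' a b ε (H2.map L U) = L.compLp (schrL 𝕜 a b ε U) := by
  rw [schrL_apply', schrL_apply', H2.fnL_map, H2.deriv2L_map, ← compLp_mulL, ← compLp_latticeL ha]
  have e : ∀ u : L2 𝕜, (ε : 𝕜') • L.compLp u = L.compLp ((ε : 𝕜) • u) := by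
    intro u
    refine Lp.ext ?_
    filter_upwards [L.coeFn_compLp u, L.coeFn_compLp ((ε : 𝕜) • u), Lp.coeFn_smul (ε : 𝕜) u,
      Lp.coeFn_smul (ε : 𝕜') (L.compLp u)] with z h1 h2 h3 h4
    rw [h2, h3, h4, Pi.smul_apply, Pi.smul_apply, h1, smul_eq_mul, smul_eq_mul,
      ← RCLike.real_smul_eq_coe_mul, ← RCLike.real_smul_eq_coe_mul, map_smul]
  rw [e]
  exact ((map_sub (L.compLpL 2 volume) _ _).trans
    (congrArg (· - _) (map_sub (L.compLpL 2 volume) _ _))).symm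

theorem re_inner_schrL (ha : IsLatticeCoupling a) (b : ℝ →ᵇ ℝ) (ε : ℝ) (U : H2 𝕜) :
    RCLike.re ⟪schrL 𝕜 a b ε U, H2.fnL 𝕜 U⟫_𝕜 =
      ⟪schrL ℝ a b ε (H2.map RCLike.reCLM U), H2.fnL ℝ (H2.map RCLike.reCLM U)⟫_ℝ +
      ⟪schrL ℝ a b ε (H2.map RCLike.imCLM U), H2.fnL ℝ (H2.map RCLike.imCLM U)⟫_ℝ := by
  rw [re_inner_eq, schrL_map ha, schrL_map ha]
  rfl

/-- The graph of the unbounded operator in terms of the bounded operator `H² → L²`. -/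
theorem mem_negLinGraph_iff (ha : IsLatticeCoupling a) {V : ℝ → ℝ} {b : ℝ →ᵇ ℝ}
    (hV : V =ᵐ[volume] b) (ε : ℝ) (p : L2 ℂ × L2 ℂ) :
    p ∈ negLinGraph a V ε ↔ ∃ U : H2 ℂ, H2.fnL ℂ U = p.1 ∧ schrL ℂ a b ε U = p.2 := by
  have key : ∀ U : H2 ℂ, ∀ᵐ z, schrL ℂ a b ε U z =
      -(U.deriv2 z + V z • U.fn z - ε • latticeOp a U.fn z) := by
    intro U
    rw [schrL_apply']
    filter_upwards [Lp.coeFn_sub ((ε : ℂ) • latticeL ℂ a (H2.fnL ℂ U) - mulL ℂ b (H2.fnL ℂ U))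
      (H2.deriv2L ℂ U), Lp.coeFn_sub ((ε : ℂ) • latticeL ℂ a (H2.fnL ℂ U))
      (mulL ℂ b (H2.fnL ℂ U)), Lp.coeFn_smul (ε : ℂ) (latticeL ℂ a (H2.fnL ℂ U)),
      coeFn_mulL b (H2.fnL ℂ U), ae_hasSum_latticeL ha (H2.fnL ℂ U), hV] with z h1 h2 h3 h4 h5 h6
    erw [h1]
    rw [Pi.sub_apply, h2, Pi.sub_apply, h3, Pi.smul_apply, h4, ← h6, ← h5.tsum_eq]
    change (ε : ℂ) • latticeOp a U.fn z - V z • U.fn z - U.deriv2 z = _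
    rw [Complex.coe_smul]
    abel
  constructor
  · rintro ⟨U, h1, -, h3⟩
    refine ⟨U, h1, Lp.ext ?_⟩
    filter_upwards [h3, key U] with z h4 h5
    rw [h4, h5]
  · rintro ⟨U, h1, h2⟩
    refine ⟨U, h1, ?_, ?_⟩
    · filter_upwards [ae_hasSum_latticeL ha (H2.fnL ℂ U)] with z hz
      exact hz.summable
    · filter_upwards [key U] with z hz
      rw [← h2, hz]

end Schrodinger

/-! ### The spectral gap at a positive null vector -/

section Gap

open scoped BoundedContinuousFunction

/-- The Cauchy–Schwarz inequality on a set of finite measure. -/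
theorem setIntegral_abs_le (h : L2 ℝ) {s : Set ℝ} (hs : MeasurableSet s) (hμ : volume s ≠ ⊤) :
    ∫ z in s, |h z| ≤ √(volume.real s) * ‖h‖ := by
  have hm : MemLp (fun z => ‖h z‖) 2 volume := (Lp.memLp h).norm
  have e : ∫ z in s, |h z| = ⟪indicatorConstLp 2 hs hμ (1 : ℝ), hm.toLp⟫_ℝ := by
    rw [L2.inner_indicatorConstLp_one]
    refine setIntegral_congr_ae hs ?_
    filter_upwards [hm.coeFn_toLp] with z hz _
    rw [hz, Real.norm_eq_abs]
  have hn : ‖hm.toLp‖ = ‖h‖ := by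
    rw [Lp.norm_toLp, eLpNorm_norm, Lp.norm_def]
  rw [e]
  refine (real_inner_le_norm _ _).trans ?_
  rw [hn, norm_indicatorConstLp (by norm_num) (by norm_num)]
  simp [Real.sqrt_eq_rpow]

variable {w w' : ℝ → ℝ} {b : ℝ →ᵇ ℝ}

/-- The factorization `-∂² - b = D* D` with `D = ∂ - w' / w`, where `w > 0` solves
`w'' + b w = 0`, as an identity of quadratic forms. -/
theorem quadratic_form_eq_norm_sq (hpos : ∀ z, 0 < w z) (hw : ∀ z, HasDerivAt w (w' z) z)
    (hw' : ∀ z, HasDerivAt w' (-(b z * w z)) z) (W : ℝ →ᵇ ℝ) (hW : ∀ z, W z = w' z / w z)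
    {u v : L2 ℝ} {U : ℝ → ℝ} (hU : u =ᵐ[volume] U) (hp : IsPrimitive U v) :
    ‖v - mulL ℝ W u‖ ^ 2 = ‖v‖ ^ 2 - ⟪mulL ℝ b u, u⟫_ℝ := by
  have hcw : Continuous w := continuous_iff_continuousAt.2 fun z => (hw z).continuousAt
  have hWder : ∀ z, HasDerivAt W (-b z - W z * W z) z := by
    intro z
    have h1 := (hw' z).div (hw z) (hpos z).ne'
    have e : (W : ℝ → ℝ) = fun z => w' z / w z := funext hW
    have h2 : HasDerivAt W ((-(b z * w z) * w z - w' z * w' z) / w z ^ 2) z := by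
      rw [e]
      exact h1
    convert h2 using 1
    rw [hW]
    have := (hpos z).ne'
    field_simp
  have hWp : IsPrimitive W (fun z => -b z - W z * W z) :=
    .of_hasDerivAt hWder (by fun_prop)
  have hP := hWp.mul (hp.mul hp)
  obtain ⟨i1, i2⟩ := L2.integrable_mul_of_ae_eq v hU
  have hbd : ∀ z, ‖W z‖ ≤ ‖W‖ := W.norm_coe_le_norm
  have hbd2 : ∀ z, ‖-b z - W z * W z‖ ≤ ‖b‖ + ‖W‖ * ‖W‖ := by
    intro z
    refine (norm_sub_le _ _).trans ?_
    rw [norm_neg, norm_mul]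
    gcongr
    · exact b.norm_coe_le_norm z
    · exact hbd z
    · exact hbd z
  have i3 : Integrable fun z => W z * (U z * U z) :=
    i1.bdd_mul W.continuous.aestronglyMeasurable (Eventually.of_forall hbd)
  have i4 : Integrable fun z => W z * (v z * U z + U z * v z) :=
    i2.bdd_mul W.continuous.aestronglyMeasurable (Eventually.of_forall hbd)
  have i5 : Integrable fun z => (-b z - W z * W z) * (U z * U z) :=
    i1.bdd_mul (by fun_prop) (Eventually.of_forall hbd2)
  have i7 : Integrable fun z => (-b z - W z * W z) * (U z * U z) +
      W z * (v z * U z + U z * v z) := i5.add i4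
  -- the two integrands differ by the derivative of `W U²`
  have hzero := hP.integral_eq_zero i3 i7
  have e1 : ‖v - mulL ℝ W u‖ ^ 2 =
      ∫ z, (v z - W z * U z) * (v z - W z * U z) := by
    rw [← real_inner_self_eq_norm_sq, L2.inner_real]
    refine integral_congr_ae ?_
    filter_upwards [Lp.coeFn_sub v (mulL ℝ W u), coeFn_mulL W u, hU] with z h1 h2 h3
    rw [h1, Pi.sub_apply, h2, h3, smul_eq_mul]
  have e2 : ‖v‖ ^ 2 - ⟪mulL ℝ b u, u⟫_ℝ = ∫ z, (v z * v z - b z * (U z * U z)) := by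
    rw [← real_inner_self_eq_norm_sq, L2.inner_real, L2.inner_real,
      ← integral_sub (L2.integrable_mul _ _) (L2.integrable_mul _ _)]
    refine integral_congr_ae ?_
    filter_upwards [coeFn_mulL b u, hU] with z h2 h3
    rw [h2, h3, smul_eq_mul, mul_assoc]
  have i6 : Integrable fun z => v z * v z - b z * (U z * U z) :=
    (L2.integrable_mul v v).sub
      (i1.bdd_mul b.continuous.aestronglyMeasurable (Eventually.of_forall b.norm_coe_le_norm))
  rw [e1, e2, ← sub_zero (∫ z, (v z * v z - b z * (U z * U z))), ← hzero,
    ← integral_sub i6 i7]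
  refine integral_congr_ae (Eventually.of_forall fun z => ?_)
  ring

/-- Spectral gap for functions vanishing at the origin: `U / w` is a primitive of `h / w` with
`h = U' - (w' / w) U`, which controls `U` on bounded intervals by the norm of `h`, while `-b` is
bounded below by `κ` outside `[-R, R]`. -/
theorem exists_gap_of_vanishing (hpos : ∀ z, 0 < w z) (hw : ∀ z, HasDerivAt w (w' z) z)
    (hw' : ∀ z, HasDerivAt w' (-(b z * w z)) z) (W : ℝ →ᵇ ℝ) (hW : ∀ z, W z = w' z / w z)
    {R κ : ℝ} (hκ : 0 < κ) (hR : 0 < R) (hb : ∀ z, R ≤ |z| → b z ≤ -κ) :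
    ∃ c > 0, ∀ (u v : L2 ℝ) (U : ℝ → ℝ), u =ᵐ[volume] U → IsPrimitive U v → U 0 = 0 →
      c * ‖u‖ ^ 2 ≤ ‖v‖ ^ 2 - ⟪mulL ℝ b u, u⟫_ℝ := by
  have hcw : Continuous w := continuous_iff_continuousAt.2 fun z => (hw z).continuousAt
  have hcw' : Continuous w' := continuous_iff_continuousAt.2 fun z => (hw' z).continuousAt
  have hne : (Icc (-R) R).Nonempty := ⟨0, by constructor <;> linarith⟩
  obtain ⟨zm, -, hm⟩ := isCompact_Icc.exists_isMinOn hne hcw.continuousOn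
  obtain ⟨zM, -, hM⟩ := isCompact_Icc.exists_isMaxOn hne hcw.continuousOn
  set m := w zm with hm_def
  set M := w zM with hM_def
  have hm0 : 0 < m := hpos _
  have hM0 : 0 < M := hpos _
  set K := (M / m * √(2 * R)) ^ 2 with hK
  have hK0 : 0 ≤ K := sq_nonneg _
  set D := 1 + (κ + ‖b‖) * K * (2 * R) with hD
  have hD0 : 0 < D := by positivity
  refine ⟨κ / D, by positivity, fun u v U hU hp hU0 => ?_⟩
  set h := v - mulL ℝ W u with hh
  have hq := quadratic_form_eq_norm_sq hpos hw hw' W hW hU hp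
  rw [← hh] at hq
  have hinv : IsPrimitive (fun z => (w z)⁻¹) (fun z => -w' z / w z ^ 2) :=
    .of_hasDerivAt (fun z => (hw z).inv (hpos z).ne')
      (hcw'.neg.div (hcw.pow 2) fun z => (pow_pos (hpos z) 2).ne')
  have hae : ∀ᵐ z, h z = v z - W z * U z := by
    filter_upwards [Lp.coeFn_sub v (mulL ℝ W u), coeFn_mulL W u, hU] with z h1 h2 h3
    rw [hh, h1, Pi.sub_apply, h2, h3, smul_eq_mul]
  have hquot : IsPrimitive (fun z => U z * (w z)⁻¹) (fun z => h z * (w z)⁻¹) := by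
    refine (hp.mul hinv).congr_ae ?_
    filter_upwards [hae] with z hz
    rw [hz, hW]
    have := (hpos z).ne'
    field_simp
    ring
  have hint : IntegrableOn (fun z => |h z|) (Icc (-R) R) :=
    ((L2.locallyIntegrable h).integrableOn_isCompact isCompact_Icc).abs
  have hloc : ∀ z ∈ Icc (-R) R, U z * U z ≤ K * ‖h‖ ^ 2 := by
    intro z hz
    have hsub : uIoc 0 z ⊆ Icc (-R) R := by
      refine uIoc_subset_uIcc.trans ?_
      rw [← uIcc_of_le (by linarith : -R ≤ R)]
      refine uIcc_subset_uIcc ?_ ?_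
      · rw [uIcc_of_le (by linarith)]
        constructor <;> linarith
      · rwa [uIcc_of_le (by linarith)]
    have h1 : |U z * (w z)⁻¹| ≤ m⁻¹ * (√(2 * R) * ‖h‖) := by
      have e := hquot.sub_eq 0 z
      rw [hU0, zero_mul, sub_zero] at e
      rw [e]
      have h2 := setIntegral_abs_le h (measurableSet_Icc (a := -R) (b := R)) measure_Icc_lt_top.ne
      rw [Real.volume_real_Icc_of_le (by linarith), sub_neg_eq_add, ← two_mul] at h2
      calc |∫ x in (0 : ℝ)..z, h x * (w x)⁻¹|
          ≤ ∫ x in uIoc 0 z, ‖h x * (w x)⁻¹‖ :=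
            intervalIntegral.norm_integral_le_integral_norm_uIoc (f := fun x => h x * (w x)⁻¹)
        _ ≤ ∫ x in uIoc 0 z, m⁻¹ * |h x| := by
            refine setIntegral_mono_on ?_ ?_ measurableSet_uIoc fun x hx => ?_
            · exact (intervalIntegrable_iff.1 (hquot.intervalIntegrable 0 z)).norm
            · exact (hint.mono_set hsub).const_mul _
            · rw [norm_mul, mul_comm, Real.norm_eq_abs, Real.norm_eq_abs, abs_inv,
                abs_of_pos (hpos x)]
              gcongr
              exact hm (hsub hx)
        _ ≤ ∫ x in Icc (-R) R, m⁻¹ * |h x| :=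
            setIntegral_mono_set (hint.const_mul _)
              (Eventually.of_forall fun x => by positivity) hsub.eventuallyLE
        _ ≤ m⁻¹ * (√(2 * R) * ‖h‖) := by
            rw [integral_const_mul]
            gcongr
    have h3 : |U z| ≤ M / m * √(2 * R) * ‖h‖ := by
      have e : |U z| = w z * |U z * (w z)⁻¹| := by
        rw [abs_mul, abs_inv, abs_of_pos (hpos z)]
        field_simp [(hpos z).ne']
      rw [e]
      calc w z * |U z * (w z)⁻¹| ≤ M * (m⁻¹ * (√(2 * R) * ‖h‖)) := by
            gcongr
            exact hM hz
        _ = _ := by ring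
    calc U z * U z = |U z| ^ 2 := by rw [sq_abs, sq]
      _ ≤ (M / m * √(2 * R) * ‖h‖) ^ 2 := by gcongr
      _ = _ := by rw [hK]; ring
  obtain ⟨i1, -⟩ := L2.integrable_mul_of_ae_eq v hU
  have ib : Integrable fun z => b z * (U z * U z) :=
    i1.bdd_mul b.continuous.aestronglyMeasurable (Eventually.of_forall b.norm_coe_le_norm)
  have ibn : Integrable fun z => -(b z * (U z * U z)) := ib.neg
  have hind : Integrable ((Icc (-R) R).indicator fun _ => (κ + ‖b‖) * (K * ‖h‖ ^ 2)) :=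
    (integrable_indicator_iff measurableSet_Icc).2 (integrableOn_const (by simp))
  have hmain : κ * ‖u‖ ^ 2 ≤ -⟪mulL ℝ b u, u⟫_ℝ + (κ + ‖b‖) * (K * ‖h‖ ^ 2) * (2 * R) := by
    have e1 : κ * ‖u‖ ^ 2 = ∫ z, κ * (U z * U z) := by
      rw [← real_inner_self_eq_norm_sq, L2.inner_real, ← integral_const_mul]
      refine integral_congr_ae ?_
      filter_upwards [hU] with z hz
      rw [hz]
    have e2 : ⟪mulL ℝ b u, u⟫_ℝ = ∫ z, b z * (U z * U z) := by
      rw [L2.inner_real]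
      refine integral_congr_ae ?_
      filter_upwards [coeFn_mulL b u, hU] with z h1 h2
      rw [h1, h2, smul_eq_mul, mul_assoc]
    have e3 : (κ + ‖b‖) * (K * ‖h‖ ^ 2) * (2 * R) =
        ∫ z, (Icc (-R) R).indicator (fun _ => (κ + ‖b‖) * (K * ‖h‖ ^ 2)) z := by
      rw [integral_indicator_const _ measurableSet_Icc,
        Real.volume_real_Icc_of_le (by linarith), smul_eq_mul]
      ring
    rw [e1, e2, e3, ← integral_neg, ← integral_add ibn hind]
    refine integral_mono (i1.const_mul _) (ibn.add hind) fun z => ?_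
    have hb' := (abs_le.1 (b.norm_coe_le_norm z)).2
    by_cases hz : z ∈ Icc (-R) R
    · have := hloc z hz
      simp only [indicator_of_mem hz]
      nlinarith [mul_self_nonneg (U z), norm_nonneg b]
    · simp only [indicator_of_notMem hz]
      have hz' : R ≤ |z| := by
        rw [mem_Icc, not_and_or, not_le, not_le] at hz
        rw [le_abs]
        rcases hz with hz | hz
        · right; linarith
        · left; linarith
      nlinarith [mul_self_nonneg (U z), hb z hz']
  rw [← hq, div_mul_eq_mul_div, div_le_iff₀ hD0, hD]
  nlinarith [sq_nonneg ‖v‖]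

/-- Spectral gap: the quadratic form of `-∂² - b` is bounded below on the orthogonal complement of
a positive null vector `w`. Adding a multiple of `w` to `ψ` makes it vanish at the origin, does not
change the quadratic form, and does not decrease the norm. -/
theorem exists_gap {a : ℤ → ℝ} (ha : IsLatticeCoupling a) (hpos : ∀ z, 0 < w z)
    (hw : ∀ z, HasDerivAt w (w' z) z)
    (hw' : ∀ z, HasDerivAt w' (-(b z * w z)) z) (W : ℝ →ᵇ ℝ) (hW : ∀ z, W z = w' z / w z)
    {R κ : ℝ} (hκ : 0 < κ) (hR : 0 < R) (hb : ∀ z, R ≤ |z| → b z ≤ -κ)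
    (wH : H2 ℝ) (hwH : H2.fnL ℝ wH =ᵐ[volume] w) (hker : schrL ℝ a b 0 wH = 0) :
    ∃ c > 0, ∀ ψ : H2 ℝ, ⟪H2.fnL ℝ wH, H2.fnL ℝ ψ⟫_ℝ = 0 →
      c * ‖H2.fnL ℝ ψ‖ ^ 2 ≤ ⟪schrL ℝ a b 0 ψ, H2.fnL ℝ ψ⟫_ℝ := by
  obtain ⟨c, hc, hgap⟩ := exists_gap_of_vanishing hpos hw hw' W hW hκ hR hb
  refine ⟨c, hc, fun ψ hψ => ?_⟩
  obtain ⟨U, hU, hp⟩ := ψ.isWeakDeriv_fnL.exists_isPrimitive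
  obtain ⟨w₁, hw₁, hp₁⟩ := wH.isWeakDeriv_fnL.exists_isPrimitive
  have hw₁w : w₁ = w := by
    have hcw : Continuous w := continuous_iff_continuousAt.2 fun z => (hw z).continuousAt
    exact (hp₁.continuous.ae_eq_iff_eq volume hcw).1 (hw₁.symm.trans hwH)
  subst hw₁w
  set α := -(U 0 / w₁ 0) with hα
  set χ := ψ + α • wH with hχ
  have h0 : U 0 + α * w₁ 0 = 0 := by
    rw [hα, neg_mul, div_mul_cancel₀ _ (hpos 0).ne', add_neg_cancel]
  have hχU : H2.fnL ℝ χ =ᵐ[volume] fun z => U z + α * w₁ z := by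
    rw [hχ, map_add, map_smul]
    filter_upwards [Lp.coeFn_add (H2.fnL ℝ ψ) (α • H2.fnL ℝ wH), Lp.coeFn_smul α (H2.fnL ℝ wH),
      hU, hwH] with z h1 h2 h3 h4
    rw [h1, Pi.add_apply, h2, Pi.smul_apply, h3, h4, smul_eq_mul]
  have hχp : IsPrimitive (fun z => U z + α * w₁ z) (H2.derivL ℝ χ) := by
    refine (hp.add (hp₁.const_mul α)).congr_ae ?_
    rw [hχ, map_add, map_smul]
    filter_upwards [Lp.coeFn_add (H2.derivL ℝ ψ) (α • H2.derivL ℝ wH),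
      Lp.coeFn_smul α (H2.derivL ℝ wH)] with z h1 h2
    rw [h1, Pi.add_apply, h2, Pi.smul_apply, smul_eq_mul]
  have h1 := hgap _ _ _ hχU hχp h0
  have hform : ∀ χ : H2 ℝ, ⟪schrL ℝ a b 0 χ, H2.fnL ℝ χ⟫_ℝ =
      ‖H2.derivL ℝ χ‖ ^ 2 - ⟪mulL ℝ b (H2.fnL ℝ χ), H2.fnL ℝ χ⟫_ℝ := by
    intro χ
    rw [schrL_apply', inner_sub_left, inner_sub_left, H2.inner_deriv2L, real_inner_self_eq_norm_sq]
    simp only [RCLike.ofReal_real_eq_id, id_eq, zero_smul, inner_zero_left]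
    ring
  rw [← hform] at h1
  have h2 : ⟪schrL ℝ a b 0 χ, H2.fnL ℝ χ⟫_ℝ = ⟪schrL ℝ a b 0 ψ, H2.fnL ℝ ψ⟫_ℝ := by
    have e : schrL ℝ a b 0 χ = schrL ℝ a b 0 ψ := by
      rw [hχ, map_add, map_smul, hker, smul_zero, add_zero]
    have e' : ⟪schrL ℝ a b 0 ψ, H2.fnL ℝ wH⟫_ℝ = 0 := by
      rw [inner_schrL ha, hker, inner_zero_right]
    rw [e, hχ, map_add, map_smul, inner_add_right, inner_smul_right, e', mul_zero, add_zero]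
  have h3 : ‖H2.fnL ℝ ψ‖ ^ 2 ≤ ‖H2.fnL ℝ χ‖ ^ 2 := by
    have hψ' : ⟪H2.fnL ℝ ψ, α • H2.fnL ℝ wH⟫_ℝ = 0 := by
      rw [inner_smul_right, real_inner_comm, hψ, mul_zero]
    rw [hχ, map_add, map_smul, sq ‖_ + _‖,
      norm_add_sq_eq_norm_sq_add_norm_sq_real hψ']
    nlinarith [norm_nonneg (α • H2.fnL ℝ wH)]
  rw [h2] at h1
  nlinarith

end Gap

/-! ### The heteroclinic -/

section Heteroclinic

open scoped BoundedContinuousFunction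

variable {f u₀ : ℝ → ℝ}

theorem IsBalancedBistable.hasDerivAt (hf : IsBalancedBistable f) (x : ℝ) :
    HasDerivAt f (deriv f x) x :=
  (hf.contDiff.differentiable (by norm_num) x).hasDerivAt

theorem IsBalancedBistable.contDiff_deriv (hf : IsBalancedBistable f) : ContDiff ℝ 1 (deriv f) :=
  ((contDiff_succ_iff_deriv (n := 1)).1 (by rw [one_add_one_eq_two]; exact hf.contDiff)).2.2

theorem hasDerivAt_primitive (hf : IsBalancedBistable f) (p x : ℝ) :
    HasDerivAt (fun u => ∫ s in p..u, f s) (f x) x :=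
  intervalIntegral.integral_hasDerivAt_right (hf.contDiff.continuous.intervalIntegrable _ _)
    (hf.contDiff.continuous.stronglyMeasurableAtFilter _ _) hf.contDiff.continuous.continuousAt

theorem IsHeteroclinic.hasDerivAt (hu : IsHeteroclinic f u₀) (z : ℝ) :
    HasDerivAt u₀ (deriv u₀ z) z :=
  (hu.contDiff.differentiable (by norm_num) z).hasDerivAt

theorem IsHeteroclinic.hasDerivAt_deriv (hu : IsHeteroclinic f u₀) (z : ℝ) :
    HasDerivAt (deriv u₀) (-f (u₀ z)) z := by
  have h : ContDiff ℝ 1 (deriv u₀) :=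
    ((contDiff_succ_iff_deriv (n := 1)).1 (by rw [one_add_one_eq_two]; exact hu.contDiff)).2.2
  have := (h.differentiable (by norm_num) z).hasDerivAt
  rwa [eq_neg_of_add_eq_zero_left (hu.ode z)] at this

/-- Conservation of energy along the heteroclinic. -/
theorem IsHeteroclinic.sq_deriv (hf : IsBalancedBistable f) (hu : IsHeteroclinic f u₀) (z : ℝ) :
    deriv u₀ z ^ 2 = -2 * ∫ s in (0 : ℝ)..u₀ z, f s := by
  set E : ℝ → ℝ := fun z => deriv u₀ z ^ 2 + 2 * ∫ s in (0 : ℝ)..u₀ z, f s with hE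
  have hE' : ∀ z, HasDerivAt E 0 z := by
    intro z
    have h1 := (hu.hasDerivAt_deriv z).pow 2
    have h2 := ((hasDerivAt_primitive hf 0 (u₀ z)).comp z (hu.hasDerivAt z)).const_mul 2
    refine (h1.add h2).congr_deriv ?_
    simp
    ring
  have hconst : ∀ x, E x = E z := fun x =>
    is_const_of_deriv_eq_zero (fun y => (hE' y).differentiableAt) (fun y => (hE' y).deriv) x z
  -- the energy `E` vanishes: `u₀'` tends to `0` along a sequence, by the mean value theorem
  obtain ⟨ξ, hξ⟩ : ∃ ξ : ℕ → ℝ, ∀ n : ℕ, (n : ℝ) < ξ n ∧ deriv u₀ (ξ n) = u₀ (n + 1) - u₀ n := by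
    have : ∀ n : ℕ, ∃ x : ℝ, (n : ℝ) < x ∧ deriv u₀ x = u₀ (n + 1) - u₀ n := by
      intro n
      obtain ⟨x, hx, hx'⟩ := exists_hasDerivAt_eq_slope u₀ (deriv u₀) (lt_add_one (n : ℝ))
        hu.contDiff.continuous.continuousOn fun x _ => hu.hasDerivAt x
      exact ⟨x, hx.1, by rw [hx']; simp⟩
    choose ξ hξ using this
    exact ⟨ξ, hξ⟩
  have hξt : Tendsto ξ Filter.atTop Filter.atTop :=
    tendsto_atTop_mono (fun n => (hξ n).1.le) tendsto_natCast_atTop_atTop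
  have h1 : Tendsto (fun n => deriv u₀ (ξ n)) Filter.atTop (𝓝 0) := by
    have h2 := (hu.atTop.comp ((tendsto_natCast_atTop_atTop (R := ℝ)).atTop_add
      (tendsto_const_nhds (x := (1 : ℝ))))).sub (hu.atTop.comp (tendsto_natCast_atTop_atTop (R := ℝ)))
    rw [sub_self] at h2
    exact h2.congr fun n => ((hξ n).2).symm
  have hFc : Continuous fun u => ∫ s in (0 : ℝ)..u, f s :=
    continuous_iff_continuousAt.2 fun x => (hasDerivAt_primitive hf 0 x).continuousAt
  have h2 : Tendsto (fun n => ∫ s in (0 : ℝ)..u₀ (ξ n), f s) Filter.atTop (𝓝 0) := by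
    have := (hFc.tendsto 1).comp (hu.atTop.comp hξt)
    rwa [hf.primitive_one] at this
  have h3 : Tendsto (fun n => E (ξ n)) Filter.atTop (𝓝 0) := by
    simpa [hE] using (h1.pow 2).add (h2.const_mul 2)
  have h4 : E z = 0 := tendsto_nhds_unique (tendsto_const_nhds.congr fun n => (hconst (ξ n)).symm) h3
  simp only [hE] at h4
  linarith

/-- A trajectory on the energy level of the equilibrium `p` which meets `p` stays there: the
primitive of `f` at `u` is of order `(u - p)²`, so `|u'| ≤ K |u - p|`, and Grönwall applies. -/
theorem eq_of_sq_deriv_eq (hf : IsBalancedBistable f) {p : ℝ} (hp : f p = 0) {u w : ℝ → ℝ}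
    (hu : ∀ z, HasDerivAt u (w z) z) (hE : ∀ z, w z ^ 2 = -2 * ∫ s in p..u z, f s) {x y : ℝ}
    (hx : u x = p) (hxy : x ≤ y) : u y = p := by
  have hcu : Continuous u := continuous_iff_continuousAt.2 fun z => (hu z).continuousAt
  obtain ⟨M, hM⟩ := (isCompact_Icc (a := x) (b := y)).exists_bound_of_continuousOn
    (hcu.sub (continuous_const (y := p))).continuousOn
  obtain ⟨C, hC⟩ := (isCompact_closedBall p M).exists_bound_of_continuousOn
    hf.contDiff_deriv.continuous.continuousOn
  have hC0 : ∀ z ∈ Icc x y, 0 ≤ C := fun z hz =>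
    (norm_nonneg _).trans (hC (u z) (by rw [mem_closedBall_iff_norm]; exact hM z hz))
  have hf_le : ∀ z ∈ Icc x y, ∀ s ∈ uIcc p (u z), |f s| ≤ C * |u z - p| := by
    intro z hz s hs
    have hs' : |s - p| ≤ |u z - p| := abs_sub_left_of_mem_uIcc hs
    have hb : ∀ t ∈ Metric.closedBall p M, ‖deriv f t‖ ≤ C := hC
    have h1 := (convex_closedBall p M).norm_image_sub_le_of_norm_deriv_le
      (fun t _ => (hf.hasDerivAt t).differentiableAt) hb (x := p) (y := s)
      (by simpa using (norm_nonneg _).trans (hM z hz))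
      (by rw [mem_closedBall_iff_norm]; exact hs'.trans (hM z hz))
    rw [hp, sub_zero] at h1
    exact h1.trans (mul_le_mul_of_nonneg_left hs' (hC0 z hz))
  have hw : ∀ z ∈ Icc x y, |w z| ≤ (1 + 2 * C) * |u z - p| := by
    intro z hz
    have h1 : |∫ s in p..u z, f s| ≤ C * |u z - p| * |u z - p| :=
      intervalIntegral.norm_integral_le_of_norm_le_const (f := f) fun s hs =>
        hf_le z hz s (uIoc_subset_uIcc hs)
    have h2 : |w z| ^ 2 ≤ 2 * (C * |u z - p| * |u z - p|) := by
      rw [sq_abs, hE]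
      linarith [(abs_le.1 h1).1]
    have := hC0 z hz
    refine le_of_sq_le_sq ?_ (by positivity)
    refine h2.trans ?_
    nlinarith [mul_nonneg this (sq_nonneg |u z - p|), sq_nonneg |u z - p|,
      mul_nonneg (sq_nonneg C) (sq_nonneg |u z - p|)]
  have := eq_zero_of_abs_deriv_le_mul_abs_self_of_eq_zero_right (f := fun z => u z - p) (f' := w)
    (K := 1 + 2 * C) (a := x) (b := y) (hcu.sub continuous_const).continuousOn
    (fun z _ => ((hu z).sub_const p).hasDerivWithinAt) (by simp [hx])
    (fun z hz => hw z (Ico_subset_Icc_self hz)) y (right_mem_Icc.2 hxy)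
  simpa [sub_eq_zero] using this

theorem IsHeteroclinic.ne_zero (hf : IsBalancedBistable f) (hu : IsHeteroclinic f u₀) (z : ℝ) :
    u₀ z ≠ 0 := by
  intro h0
  have h1 : Tendsto u₀ Filter.atTop (𝓝 0) := by
    refine tendsto_const_nhds.congr' ?_
    filter_upwards [eventually_ge_atTop z] with y hy
    exact (eq_of_sq_deriv_eq hf hf.zero hu.hasDerivAt (hu.sq_deriv hf) h0 hy).symm
  exact zero_ne_one (tendsto_nhds_unique h1 hu.atTop)

theorem IsHeteroclinic.ne_one (hf : IsBalancedBistable f) (hu : IsHeteroclinic f u₀) (z : ℝ) :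
    u₀ z ≠ 1 := by
  intro h0
  -- the argument at `0`, for the reflected trajectory `u₀ (-·)`
  have hd : ∀ y, HasDerivAt (fun y => u₀ (-y)) (-deriv u₀ (-y)) y := fun y => by
    exact ((hu.hasDerivAt (-y)).scomp y (hasDerivAt_neg y)).congr_deriv (by simp)
  have hE : ∀ y, (-deriv u₀ (-y)) ^ 2 = -2 * ∫ s in (1 : ℝ)..u₀ (-y), f s := fun y => by
    have hi : ∀ a b, IntervalIntegrable f volume a b :=
      fun a b => hf.contDiff.continuous.intervalIntegrable a b
    rw [neg_sq, hu.sq_deriv hf, ← intervalIntegral.integral_add_adjacent_intervals (hi 0 1) (hi _ _),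
      hf.primitive_one, zero_add]
  have h1 : Tendsto u₀ Filter.atBot (𝓝 1) := by
    refine tendsto_const_nhds.congr' ?_
    filter_upwards [eventually_le_atBot z] with y hy
    have := eq_of_sq_deriv_eq hf hf.one hd hE (x := -z) (y := -y) (by simpa using h0) (by simpa)
    simpa using this.symm
  exact zero_ne_one (tendsto_nhds_unique hu.atBot h1)

/-- The heteroclinic does not meet the equilibria, so it stays between them. -/
theorem IsHeteroclinic.mem_Ioo (hf : IsBalancedBistable f) (hu : IsHeteroclinic f u₀) (z : ℝ) :
    u₀ z ∈ Ioo (0 : ℝ) 1 := by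
  have hc := hu.contDiff.continuous
  constructor
  · by_contra! h
    obtain ⟨y, hy⟩ := (hu.atTop.eventually (lt_mem_nhds zero_lt_one)).exists
    obtain ⟨x, hx⟩ := mem_range_of_exists_le_of_exists_ge hc ⟨z, h⟩ ⟨y, hy.le⟩
    exact hu.ne_zero hf x hx
  · by_contra! h
    obtain ⟨y, hy⟩ := (hu.atBot.eventually (gt_mem_nhds zero_lt_one)).exists
    obtain ⟨x, hx⟩ := mem_range_of_exists_le_of_exists_ge hc ⟨y, hy.le⟩ ⟨z, h⟩
    exact hu.ne_one hf x hx

/-- `u₀'` does not vanish, since `F ≠ 0` on `(0, 1)`, so it has the sign of a slope of `u₀`. -/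
theorem IsHeteroclinic.deriv_pos (hf : IsBalancedBistable f) (hu : IsHeteroclinic f u₀) (z : ℝ) :
    0 < deriv u₀ z := by
  have hne : ∀ x, deriv u₀ x ≠ 0 := by
    intro x h
    have h1 := hu.sq_deriv hf x
    rw [h] at h1
    refine hf.primitive_ne _ (hu.mem_Ioo hf x) ?_
    linarith
  have hc : Continuous (deriv u₀) :=
    continuous_iff_continuousAt.2 fun z => (hu.hasDerivAt_deriv z).continuousAt
  by_contra! h
  obtain ⟨x₁, hx₁⟩ := (hu.atBot.eventually (gt_mem_nhds (show (0 : ℝ) < 1 / 2 by norm_num))).exists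
  obtain ⟨x₂, hx₂, hx₂'⟩ := ((hu.atTop.eventually
    (lt_mem_nhds (show (1 / 2 : ℝ) < 1 by norm_num))).and (eventually_gt_atTop x₁)).exists
  obtain ⟨x, -, hx⟩ := exists_hasDerivAt_eq_slope u₀ (deriv u₀) hx₂'
    hu.contDiff.continuous.continuousOn fun x _ => hu.hasDerivAt x
  have hx0 : 0 ≤ deriv u₀ x := by
    rw [hx]
    exact div_nonneg (by linarith) (by linarith)
  obtain ⟨y, hy⟩ := mem_range_of_exists_le_of_exists_ge hc ⟨z, h⟩ ⟨x, hx0⟩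
  exact hne y hy

/-- A continuous function on the line with finite limits at both ends is bounded. -/
theorem exists_abs_le_of_tendsto {g : ℝ → ℝ} (hg : Continuous g) {l₁ l₂ : ℝ}
    (h₁ : Tendsto g Filter.atBot (𝓝 l₁)) (h₂ : Tendsto g Filter.atTop (𝓝 l₂)) : ∃ B, ∀ z, |g z| ≤ B := by
  obtain ⟨x, hx⟩ := eventually_atBot.1 (h₁.abs.eventually (gt_mem_nhds (lt_add_one |l₁|)))
  obtain ⟨y, hy⟩ := eventually_atTop.1 (h₂.abs.eventually (gt_mem_nhds (lt_add_one |l₂|)))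
  obtain ⟨M, hM⟩ := (isCompact_Icc (a := x) (b := y)).exists_bound_of_continuousOn hg.continuousOn
  refine ⟨max M (max (|l₁| + 1) (|l₂| + 1)), fun z => ?_⟩
  rcases le_or_gt z x with h | h
  · exact ((hx z h).le.trans (le_max_left _ _)).trans (le_max_right _ _)
  rcases le_or_gt y z with h' | h'
  · exact ((hy z h').le.trans (le_max_right _ _)).trans (le_max_right _ _)
  · exact (hM z ⟨h.le, h'.le⟩).trans (le_max_left _ _)

/-- The logarithmic derivative of `u₀'` is bounded: its square `f² / (-2F)` at `u₀` tends to
`-f'(0)` and `-f'(1)` at the two ends, by l'Hôpital's rule. -/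
theorem IsHeteroclinic.exists_logDeriv_bound (hf : IsBalancedBistable f)
    (hu : IsHeteroclinic f u₀) : ∃ B, ∀ z, |-f (u₀ z) / deriv u₀ z| ≤ B := by
  set F : ℝ → ℝ := fun u => -2 * ∫ s in (0 : ℝ)..u, f s with hF
  have hF' : ∀ x, HasDerivAt F (-2 * f x) x := fun x => (hasDerivAt_primitive hf 0 x).const_mul _
  have hf2' : ∀ x, HasDerivAt (fun x => f x ^ 2) (2 * f x * deriv f x) x := fun x => by
    exact ((hf.hasDerivAt x).pow 2).congr_deriv (by simp)
  have hFc : Continuous F := continuous_iff_continuousAt.2 fun x => (hF' x).continuousAt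
  have hfc := hf.contDiff.continuous
  have hdc := hf.contDiff_deriv.continuous
  have hF0 : F 0 = 0 := by simp [hF]
  have hF1 : F 1 = 0 := by simp [hF, hf.primitive_one]
  have hlim : ∀ p, Tendsto (fun x => -deriv f x) (𝓝 p) (𝓝 (-deriv f p)) := fun p =>
    (hdc.neg.tendsto p)
  have hnz : ∀ p, f p = 0 → deriv f p < 0 → ∀ᶠ x in 𝓝[≠] p, f x ≠ 0 := fun p h h' =>
    (hf.hasDerivAt p).eventually_ne h'.ne
  have hratio : ∀ x, f x ≠ 0 → -deriv f x = 2 * f x * deriv f x / (-2 * f x) := by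
    intro x hx
    field_simp
  have h0 : Tendsto (fun x => f x ^ 2 / F x) (𝓝[>] 0) (𝓝 (-deriv f 0)) := by
    have hn : ∀ᶠ x in 𝓝[>] (0 : ℝ), f x ≠ 0 :=
      (hnz 0 hf.zero hf.deriv_zero).filter_mono (nhdsWithin_mono _ fun x hx => ne_of_gt hx)
    refine HasDerivAt.lhopital_zero_nhdsGT (Eventually.of_forall hf2') (Eventually.of_forall hF')
      (hn.mono fun x hx => by simpa using hx) ?_ ?_ ?_
    · exact ((hfc.pow 2).tendsto' 0 0 (by simp [hf.zero])).mono_left nhdsWithin_le_nhds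
    · simpa [hF0] using (hFc.tendsto 0).mono_left nhdsWithin_le_nhds
    · exact ((hlim 0).mono_left nhdsWithin_le_nhds).congr' (hn.mono hratio)
  have h1 : Tendsto (fun x => f x ^ 2 / F x) (𝓝[<] 1) (𝓝 (-deriv f 1)) := by
    have hn : ∀ᶠ x in 𝓝[<] (1 : ℝ), f x ≠ 0 :=
      (hnz 1 hf.one hf.deriv_one).filter_mono (nhdsWithin_mono _ fun x hx => ne_of_lt hx)
    refine HasDerivAt.lhopital_zero_nhdsLT (Eventually.of_forall hf2') (Eventually.of_forall hF')
      (hn.mono fun x hx => by simpa using hx) ?_ ?_ ?_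
    · exact ((hfc.pow 2).tendsto' 1 0 (by simp [hf.one])).mono_left nhdsWithin_le_nhds
    · simpa [hF1] using (hFc.tendsto 1).mono_left nhdsWithin_le_nhds
    · exact ((hlim 1).mono_left nhdsWithin_le_nhds).congr' (hn.mono hratio)
  have hdw : Continuous (deriv u₀) :=
    continuous_iff_continuousAt.2 fun z => (hu.hasDerivAt_deriv z).continuousAt
  have hcu := hu.contDiff.continuous
  have hsq : ∀ z, (-f (u₀ z) / deriv u₀ z) ^ 2 = f (u₀ z) ^ 2 / F (u₀ z) := by
    intro z
    rw [div_pow, neg_sq, hu.sq_deriv hf]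
  have hbot : Tendsto (fun z => (-f (u₀ z) / deriv u₀ z) ^ 2) Filter.atBot (𝓝 (-deriv f 0)) := by
    simp only [hsq]
    exact h0.comp (tendsto_nhdsWithin_iff.2 ⟨hu.atBot, Eventually.of_forall fun z =>
      (hu.mem_Ioo hf z).1⟩)
  have htop : Tendsto (fun z => (-f (u₀ z) / deriv u₀ z) ^ 2) Filter.atTop (𝓝 (-deriv f 1)) := by
    simp only [hsq]
    exact h1.comp (tendsto_nhdsWithin_iff.2 ⟨hu.atTop, Eventually.of_forall fun z =>
      (hu.mem_Ioo hf z).2⟩)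
  have hcont : Continuous fun z => (-f (u₀ z) / deriv u₀ z) ^ 2 :=
    ((hfc.comp hcu).neg.div hdw fun z => (hu.deriv_pos hf z).ne').pow 2
  obtain ⟨B, hB⟩ := exists_abs_le_of_tendsto hcont hbot htop
  refine ⟨B + 1, fun z => ?_⟩
  have := hB z
  rw [abs_of_nonneg (sq_nonneg _), ← sq_abs] at this
  nlinarith [sq_nonneg (|(-f (u₀ z) / deriv u₀ z)| - 1)]

/-- `u₀'` is bounded, by conservation of energy. -/
theorem IsHeteroclinic.exists_deriv_bound (hf : IsBalancedBistable f)
    (hu : IsHeteroclinic f u₀) : ∃ M, ∀ z, ‖deriv u₀ z‖ ≤ M := by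
  have hFc : Continuous fun u => -2 * ∫ s in (0 : ℝ)..u, f s :=
    continuous_iff_continuousAt.2 fun x => ((hasDerivAt_primitive hf 0 x).const_mul _).continuousAt
  obtain ⟨M, hM⟩ := (isCompact_Icc (a := (0 : ℝ)) (b := 1)).exists_bound_of_continuousOn
    hFc.continuousOn
  refine ⟨M + 1, fun z => ?_⟩
  have h1 := hM (u₀ z) (Ioo_subset_Icc_self (hu.mem_Ioo hf z))
  rw [← hu.sq_deriv hf, norm_pow] at h1
  nlinarith [sq_nonneg (‖deriv u₀ z‖ - 1)]

/-- `u₀'` is square integrable: it is positive and bounded, and its integral is at most `1`. -/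
theorem IsHeteroclinic.memLp_deriv (hf : IsBalancedBistable f) (hu : IsHeteroclinic f u₀) :
    MemLp (deriv u₀) 2 volume := by
  have hc : Continuous (deriv u₀) :=
    continuous_iff_continuousAt.2 fun z => (hu.hasDerivAt_deriv z).continuousAt
  have hi : Integrable (deriv u₀) := by
    refine integrable_of_intervalIntegral_norm_bounded (a := fun n : ℕ => -(n : ℝ))
      (b := fun n : ℕ => (n : ℝ)) (l := Filter.atTop) 1
      (fun n => (hc.integrableOn_Icc).mono_set Ioc_subset_Icc_self)
      (tendsto_neg_atTop_atBot.comp tendsto_natCast_atTop_atTop) tendsto_natCast_atTop_atTop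
      (Eventually.of_forall fun n => ?_)
    have e : ∀ z, ‖deriv u₀ z‖ = deriv u₀ z := fun z => by
      rw [Real.norm_eq_abs, abs_of_pos (hu.deriv_pos hf z)]
    simp only [e]
    rw [intervalIntegral.integral_eq_sub_of_hasDerivAt (fun x _ => hu.hasDerivAt x)
      (hc.intervalIntegrable _ _)]
    linarith [(hu.mem_Ioo hf n).2, (hu.mem_Ioo hf (-n)).1]
  obtain ⟨M, hb⟩ := hu.exists_deriv_bound hf
  rw [memLp_two_iff_integrable_sq hc.aestronglyMeasurable]
  simp only [sq]
  exact hi.bdd_mul hc.aestronglyMeasurable (Eventually.of_forall hb)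

end Heteroclinic

/-! ### Superposition operators and the ground state -/

section Superposition

open scoped BoundedContinuousFunction

/-- The superposition operator `v ↦ g ∘ v` on bounded continuous functions. -/
noncomputable def superpos (g : C(ℝ, ℝ)) (v : ℝ →ᵇ ℝ) : ℝ →ᵇ ℝ where
  toContinuousMap := g.comp v.toContinuousMap
  map_bounded' := by
    obtain ⟨C, hC⟩ := (isCompact_closedBall (0 : ℝ) ‖v‖).exists_bound_of_continuousOn
      g.continuous.continuousOn
    have h : ∀ z, ‖g (v z)‖ ≤ C := fun z => hC _ (by simpa using v.norm_coe_le_norm z)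
    exact ⟨C + C, fun x y => (dist_le_norm_add_norm _ _).trans (add_le_add (h x) (h y))⟩

@[simp]
theorem superpos_apply (g : C(ℝ, ℝ)) (v : ℝ →ᵇ ℝ) (z : ℝ) : superpos g v z = g (v z) := rfl

/-- Uniform continuity of `g` near the range of `v`, which is bounded. -/
theorem exists_modulus (g : C(ℝ, ℝ)) (v : ℝ →ᵇ ℝ) {η : ℝ} (hη : 0 < η) :
    ∃ δ > 0, ∀ z s, |s - v z| < δ → |g s - g (v z)| < η := by
  have hu := (isCompact_closedBall (0 : ℝ) (‖v‖ + 1)).uniformContinuousOn_of_continuous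
    g.continuous.continuousOn
  obtain ⟨δ, hδ, h⟩ := Metric.uniformContinuousOn_iff.1 hu η hη
  refine ⟨min δ 1, lt_min hδ one_pos, fun z s hs => ?_⟩
  have hv := v.norm_coe_le_norm z
  have h1 : |s| ≤ ‖v‖ + 1 := by
    have := abs_sub_abs_le_abs_sub s (v z)
    rw [Real.norm_eq_abs] at hv
    linarith [hs.trans_le (min_le_right δ 1)]
  exact h s (by simpa using h1) (v z) (by simp only [mem_closedBall_zero_iff]; linarith)
    (hs.trans_le (min_le_left _ _))

theorem continuous_superpos (g : C(ℝ, ℝ)) : Continuous (superpos g) := by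
  rw [Metric.continuous_iff]
  intro v η hη
  obtain ⟨δ, hδ, h⟩ := exists_modulus g v (half_pos hη)
  refine ⟨δ, hδ, fun u hu => lt_of_le_of_lt ?_ (half_lt_self hη)⟩
  rw [BoundedContinuousFunction.dist_le (half_pos hη).le]
  exact fun z => (h z (u z) ((u.dist_coe_le_dist z).trans_lt hu)).le

/-- Multiplication of bounded continuous functions as a bounded bilinear map. -/
noncomputable def bcfMul : (ℝ →ᵇ ℝ) →L[ℝ] (ℝ →ᵇ ℝ) →L[ℝ] (ℝ →ᵇ ℝ) :=
  LinearMap.mkContinuous₂ (LinearMap.mul ℝ (ℝ →ᵇ ℝ)) 1 fun u v => by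
    rw [one_mul]
    exact norm_mul_le u v

theorem bcfMul_apply (u v : ℝ →ᵇ ℝ) (z : ℝ) : bcfMul u v z = u z * v z := rfl

/-- The derivative of `v ↦ g ∘ v` is multiplication by `g' ∘ v`. -/
theorem hasFDerivAt_superpos {g g' : C(ℝ, ℝ)} (hg : ∀ x, HasDerivAt g (g' x) x) (v : ℝ →ᵇ ℝ) :
    HasFDerivAt (superpos g) (bcfMul (superpos g' v)) v := by
  rw [hasFDerivAt_iff_isLittleO_nhds_zero, Asymptotics.isLittleO_iff]
  intro η hη
  obtain ⟨δ, hδ, h⟩ := exists_modulus g' v hη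
  filter_upwards [Metric.ball_mem_nhds (0 : ℝ →ᵇ ℝ) hδ] with k hk
  rw [mem_ball_zero_iff] at hk
  rw [BoundedContinuousFunction.norm_le (by positivity)]
  intro z
  have hkz : |k z| ≤ ‖k‖ := k.norm_coe_le_norm z
  have hder : ∀ x ∈ uIcc (v z) (v z + k z),
      HasDerivWithinAt (fun x => g x - g' (v z) * x) (g' x - g' (v z)) (uIcc (v z) (v z + k z)) x :=
    fun x _ => ((hg x).sub (by simpa using (hasDerivAt_id x).const_mul (g' (v z)))).hasDerivWithinAt
  have hbd : ∀ x ∈ uIcc (v z) (v z + k z), ‖g' x - g' (v z)‖ ≤ η := by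
    intro x hx
    refine (h z x ?_).le
    have := abs_sub_left_of_mem_uIcc hx
    rw [add_sub_cancel_left] at this
    linarith
  have := (convex_uIcc _ _).norm_image_sub_le_of_norm_hasDerivWithin_le hder hbd
    left_mem_uIcc right_mem_uIcc
  rw [add_sub_cancel_left] at this
  have e : (superpos g (v + k) - superpos g v -
      bcfMul (superpos g' v) k) z =
      g (v z + k z) - g' (v z) * (v z + k z) - (g (v z) - g' (v z) * v z) := by
    rw [BoundedContinuousFunction.sub_apply, BoundedContinuousFunction.sub_apply, bcfMul_apply]
    simp only [superpos_apply, BoundedContinuousFunction.add_apply]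
    ring
  rw [e]
  exact this.trans (by gcongr; exact hkz)

/-- The superposition operator is as smooth as the function it is built from. -/
theorem contDiff_superpos (m : ℕ) : ∀ g : C(ℝ, ℝ), ContDiff ℝ m g → ContDiff ℝ m (superpos g) := by
  induction m with
  | zero =>
    intro g _
    exact contDiff_zero.2 (continuous_superpos g)
  | succ m ih =>
    intro g hg
    push_cast at hg
    have hd : ContDiff ℝ m (deriv g) := (contDiff_succ_iff_deriv.1 hg).2.2
    let g' : C(ℝ, ℝ) := ⟨deriv g, hd.continuous⟩
    have hg' : ∀ x, HasDerivAt g (g' x) x := fun x =>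
      ((contDiff_succ_iff_deriv.1 hg).1 x).hasDerivAt
    push_cast
    rw [contDiff_succ_iff_hasFDerivAt]
    have hmul : ContDiff ℝ m (bcfMul : (ℝ →ᵇ ℝ) → (ℝ →ᵇ ℝ) →L[ℝ] (ℝ →ᵇ ℝ)) := by
      fun_prop
    exact ⟨fun v => bcfMul (superpos g' v), hmul.comp (ih g' hd), hasFDerivAt_superpos hg'⟩

end Superposition

section GroundState

open scoped BoundedContinuousFunction

variable {f u₀ : ℝ → ℝ}

/-- The heteroclinic as a bounded continuous function. -/
theorem IsHeteroclinic.exists_bcf (hf : IsBalancedBistable f) (hu : IsHeteroclinic f u₀) :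
    ∃ v : ℝ →ᵇ ℝ, ∀ z, v z = u₀ z :=
  ⟨BoundedContinuousFunction.ofNormedAddCommGroup u₀ hu.contDiff.continuous 1 fun z => by
    have := hu.mem_Ioo hf z
    rw [Real.norm_eq_abs, abs_of_pos this.1]
    exact this.2.le, fun _ => rfl⟩

/-- `u₀'` is an element of `H²`, and a null vector of the linearization at `u₀` which is bounded
below on its orthogonal complement. -/
theorem IsHeteroclinic.exists_groundState (hf : IsBalancedBistable f) (hu : IsHeteroclinic f u₀)
    {a : ℤ → ℝ} (ha : IsLatticeCoupling a) {b : ℝ →ᵇ ℝ} (hb : ∀ z, b z = deriv f (u₀ z)) :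
    ∃ w : H2 ℝ, H2.fnL ℝ w =ᵐ[volume] deriv u₀ ∧
      H2.derivL ℝ w =ᵐ[volume] (fun z => -f (u₀ z)) ∧ schrL ℝ a b 0 w = 0 ∧
      ∃ c > 0, ∀ ψ : H2 ℝ, ⟪H2.fnL ℝ w, H2.fnL ℝ ψ⟫_ℝ = 0 →
        c * ‖H2.fnL ℝ ψ‖ ^ 2 ≤ ⟪schrL ℝ a b 0 ψ, H2.fnL ℝ ψ⟫_ℝ := by
  have hcu := hu.contDiff.continuous
  have hcw : Continuous (deriv u₀) :=
    continuous_iff_continuousAt.2 fun z => (hu.hasDerivAt_deriv z).continuousAt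
  have hw2 : ∀ z, HasDerivAt (fun z => -f (u₀ z)) (-(b z * deriv u₀ z)) z := fun z => by
    rw [hb]
    exact ((hf.hasDerivAt (u₀ z)).comp z (hu.hasDerivAt z)).neg
  have hcf : Continuous fun z => -f (u₀ z) := (hf.contDiff.continuous.comp hcu).neg
  obtain ⟨B, hB⟩ := hu.exists_logDeriv_bound hf
  let W : ℝ →ᵇ ℝ := BoundedContinuousFunction.ofNormedAddCommGroup
    (fun z => -f (u₀ z) / deriv u₀ z) (hcf.div hcw fun z => (hu.deriv_pos hf z).ne') B hB
  have hW : ∀ z, W z = -f (u₀ z) / deriv u₀ z := fun _ => rfl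
  set w₀ : L2 ℝ := (hu.memLp_deriv hf).toLp with hw₀
  have hw₀e : w₀ =ᵐ[volume] deriv u₀ := (hu.memLp_deriv hf).coeFn_toLp
  -- `u₀'' = W u₀'` is square integrable because the logarithmic derivative `W` is bounded
  set w₁ : L2 ℝ := mulL ℝ W w₀ with hw₁
  have hw₁e : w₁ =ᵐ[volume] fun z => -f (u₀ z) := by
    filter_upwards [coeFn_mulL W w₀, hw₀e] with z h1 h2
    rw [h1, h2, hW, smul_eq_mul, div_mul_cancel₀ _ (hu.deriv_pos hf z).ne']
  set w₂ : L2 ℝ := -mulL ℝ b w₀ with hw₂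
  have hw₂e : w₂ =ᵐ[volume] fun z => -(b z * deriv u₀ z) := by
    filter_upwards [Lp.coeFn_neg (mulL ℝ b w₀), coeFn_mulL b w₀, hw₀e] with z h1 h2 h3
    rw [hw₂, h1, Pi.neg_apply, h2, h3, smul_eq_mul]
  have hd1 : IsWeakDeriv w₀ w₁ :=
    ((IsPrimitive.of_hasDerivAt hu.hasDerivAt_deriv hcf).congr_ae hw₁e.symm).isWeakDeriv hw₀e
  have hd2 : IsWeakDeriv w₁ w₂ :=
    ((IsPrimitive.of_hasDerivAt hw2 (b.continuous.mul hcw).neg).congr_ae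
      hw₂e.symm).isWeakDeriv hw₁e
  have hker : schrL ℝ a b 0 (H2.mk hd1 hd2) = 0 := by
    rw [schrL_apply', H2.fnL_mk, H2.deriv2L_mk, hw₂]
    simp
  -- the potential is negative near both ends, as `f'(0), f'(1) < 0`
  obtain ⟨R, hR, κ, hκ, hbκ⟩ : ∃ R > 0, ∃ κ > 0, ∀ z, R ≤ |z| → b z ≤ -κ := by
    have hdc := hf.contDiff_deriv.continuous
    have h0 := ((hdc.tendsto 0).comp hu.atBot).eventually
      (gt_mem_nhds (show deriv f 0 < deriv f 0 / 2 by linarith [hf.deriv_zero]))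
    have h1 := ((hdc.tendsto 1).comp hu.atTop).eventually
      (gt_mem_nhds (show deriv f 1 < deriv f 1 / 2 by linarith [hf.deriv_one]))
    obtain ⟨x, hx⟩ := eventually_atBot.1 h0
    obtain ⟨y, hy⟩ := eventually_atTop.1 h1
    refine ⟨max 1 (max (-x) y), by positivity, min (-deriv f 0 / 2) (-deriv f 1 / 2),
      lt_min (by linarith [hf.deriv_zero]) (by linarith [hf.deriv_one]), fun z hz => ?_⟩
    rw [hb]
    have hz1 := ((le_max_left _ _).trans (le_max_right _ _)).trans hz
    have hz2 := ((le_max_right _ _).trans (le_max_right _ _)).trans hz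
    rcases le_total 0 z with h | h
    · rw [abs_of_nonneg h] at hz2
      have := hy z hz2
      simp only [Function.comp_apply] at this
      linarith [min_le_right (-deriv f 0 / 2) (-deriv f 1 / 2)]
    · rw [abs_of_nonpos h] at hz1
      have := hx z (by linarith)
      simp only [Function.comp_apply] at this
      linarith [min_le_left (-deriv f 0 / 2) (-deriv f 1 / 2)]
  exact ⟨H2.mk hd1 hd2, hw₀e, hw₁e, hker, exists_gap ha (hu.deriv_pos hf) hu.hasDerivAt_deriv hw2 W
    hW hκ hR hbκ _ hw₀e hker⟩

end GroundState

/-! ### The branch of eigenpairs -/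

section Branch

variable {X Y : Type*} [NormedAddCommGroup X] [NormedSpace ℝ X] [CompleteSpace X]
  [NormedAddCommGroup Y] [InnerProductSpace ℝ Y] [CompleteSpace Y]

/-- A simple null vector of `T 0` continues to a branch of eigenpairs of `T ε`. The branch is the
inverse image of `(ε, 0, 1)` under the local diffeomorphism
`(ε, l, x) ↦ (ε, T ε x - l J x, ⟨J φ₀, J x⟩)`, so it is as smooth as `T`, on an interval that does
not depend on the order of differentiability. -/
theorem exists_eigenbranch (J : X →L[ℝ] Y) (T : ℝ → X →L[ℝ] Y) (hT : ContDiff ℝ 1 T) {φ₀ : X}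
    (hφ₀ : ‖J φ₀‖ = 1) (hTφ₀ : T 0 φ₀ = 0)
    (hbij : Function.Bijective fun p : ℝ × X => (T 0 p.2 - p.1 • J φ₀, ⟪J φ₀, J p.2⟫_ℝ)) :
    ∃ (δ : ℝ) (l : ℝ → ℝ) (φ : ℝ → X), 0 < δ ∧ l 0 = 0 ∧ φ 0 = φ₀ ∧
      (∀ ε, |ε| < δ → T ε (φ ε) = l ε • J (φ ε) ∧ ⟪J φ₀, J (φ ε)⟫_ℝ = 1) ∧
      ∀ m : ℕ, ContDiff ℝ m T → ∀ ε, |ε| < δ → ContDiffAt ℝ m l ε ∧ ContDiffAt ℝ m φ ε := by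
  set Φ : ℝ × ℝ × X → ℝ × Y × ℝ :=
    fun p => (p.1, T p.1 p.2.2 - p.2.1 • J p.2.2, ⟪J φ₀, J p.2.2⟫_ℝ) with hΦ
  have hsmooth : ∀ m : ℕ, ContDiff ℝ m T → ContDiff ℝ m Φ := by
    intro m hm
    have h1 : ContDiff ℝ m fun p : ℝ × ℝ × X => T p.1 p.2.2 :=
      (hm.comp contDiff_fst).clm_apply (contDiff_snd.comp contDiff_snd)
    have hJ : ContDiff ℝ m fun p : ℝ × ℝ × X => J p.2.2 :=
      J.contDiff.comp (contDiff_snd.comp contDiff_snd)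
    have h2 : ContDiff ℝ m fun p : ℝ × ℝ × X => p.2.1 • J p.2.2 :=
      (contDiff_fst.comp contDiff_snd).smul hJ
    have h3 : ContDiff ℝ m fun p : ℝ × ℝ × X => ⟪J φ₀, J p.2.2⟫_ℝ :=
      (innerSL ℝ (J φ₀)).contDiff.comp hJ
    exact contDiff_fst.prodMk ((h1.sub h2).prodMk h3)
  have hΦ1 : ContDiff ℝ 1 Φ := hsmooth 1 (by exact_mod_cast hT)
  set p₀ : ℝ × ℝ × X := (0, 0, φ₀) with hp₀
  obtain ⟨D, hD⟩ : ∃ D : Y, ∀ q : ℝ × ℝ × X, fderiv ℝ Φ p₀ q =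
      (q.1, q.1 • D + T 0 q.2.2 - q.2.1 • J φ₀, ⟪J φ₀, J q.2.2⟫_ℝ) := by
    have hT' : HasFDerivAt T (fderiv ℝ T 0) (p₀.1) :=
      (hT.differentiable (by norm_num) 0).hasFDerivAt
    have h22 : HasFDerivAt (fun p : ℝ × ℝ × X => p.2.2)
        ((ContinuousLinearMap.snd ℝ ℝ X).comp (ContinuousLinearMap.snd ℝ ℝ (ℝ × X))) p₀ :=
      ((ContinuousLinearMap.snd ℝ ℝ X).comp
        (ContinuousLinearMap.snd ℝ ℝ (ℝ × X))).hasFDerivAt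
    have h21 : HasFDerivAt (fun p : ℝ × ℝ × X => p.2.1)
        ((ContinuousLinearMap.fst ℝ ℝ X).comp (ContinuousLinearMap.snd ℝ ℝ (ℝ × X))) p₀ :=
      ((ContinuousLinearMap.fst ℝ ℝ X).comp
        (ContinuousLinearMap.snd ℝ ℝ (ℝ × X))).hasFDerivAt
    have hJ := J.hasFDerivAt.comp p₀ h22
    have h1 := (hT'.comp p₀ hasFDerivAt_fst).clm_apply h22
    have h2 := h21.smul hJ
    have h3 := (innerSL ℝ (J φ₀)).hasFDerivAt.comp p₀ hJ
    have h := hasFDerivAt_fst.prodMk ((h1.sub h2).prodMk h3)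
    refine ⟨fderiv ℝ T 0 1 φ₀, fun q => ?_⟩
    have e : fderiv ℝ Φ p₀ = _ := h.fderiv
    rw [e]
    have e1 : fderiv ℝ T 0 q.1 = q.1 • fderiv ℝ T 0 1 := by
      rw [← map_smul, smul_eq_mul, mul_one]
    simp [hp₀, e1]
    abel
  -- the derivative at `(0, 0, φ₀)` is triangular, with the bordered operator on the diagonal
  have hinj : Function.Injective (fderiv ℝ Φ p₀) := by
    rw [injective_iff_map_eq_zero]
    intro q hq
    rw [hD] at hq
    simp only [Prod.mk_eq_zero] at hq
    obtain ⟨h1, h2, h3⟩ := hq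
    rw [h1, zero_smul, zero_add] at h2
    have : q.2 = 0 := hbij.1 (by simp [h2, h3])
    exact Prod.ext h1 this
  have hsurj : Function.Surjective (fderiv ℝ Φ p₀) := by
    rintro ⟨e, y, s⟩
    obtain ⟨q, hq⟩ := hbij.2 (y - e • D, s)
    refine ⟨(e, q), ?_⟩
    simp only [Prod.mk.injEq] at hq
    rw [hD]
    simp only [Prod.mk.injEq, true_and]
    refine ⟨?_, hq.2⟩
    rw [add_sub_assoc, hq.1]
    abel
  set A : (ℝ × ℝ × X) ≃L[ℝ] (ℝ × Y × ℝ) := ContinuousLinearEquiv.ofBijective (fderiv ℝ Φ p₀)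
    (LinearMap.ker_eq_bot.2 hinj) (LinearMap.range_eq_top.2 hsurj) with hA
  have hAe : (A : (ℝ × ℝ × X) →L[ℝ] (ℝ × Y × ℝ)) = fderiv ℝ Φ p₀ :=
    ContinuousLinearMap.ext fun _ => rfl
  have hder : HasFDerivAt Φ (A : (ℝ × ℝ × X) →L[ℝ] (ℝ × Y × ℝ)) p₀ := by
    rw [hAe]
    exact (hΦ1.differentiable (by norm_num) p₀).hasFDerivAt
  set e := hΦ1.contDiffAt.toOpenPartialHomeomorph Φ hder one_ne_zero with he
  have hesrc : p₀ ∈ e.source :=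
    hΦ1.contDiffAt.mem_toOpenPartialHomeomorph_source hder one_ne_zero
  have heΦ : ∀ p, e p = Φ p := fun p => rfl
  have hΦp₀ : Φ p₀ = (0, 0, 1) := by
    simp [hΦ, hp₀, hTφ₀, hφ₀]
  set γ : ℝ → ℝ × Y × ℝ := fun ε => (ε, 0, 1) with hγ
  have hγs : ∀ m : ℕ, ContDiff ℝ m γ := fun m => contDiff_id.prodMk contDiff_const
  have hγ0 : γ 0 = e p₀ := by rw [heΦ, hΦp₀]
  have htgt : γ 0 ∈ e.target := by
    rw [hγ0]
    exact e.map_source hesrc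
  have hsymm0 : e.symm (γ 0) = p₀ := by rw [hγ0, e.left_inv hesrc]
  have hγc : Continuous γ := (hγs 0).continuous
  have hopen : ∀ᶠ p in 𝓝 p₀, ∃ B : (ℝ × ℝ × X) ≃L[ℝ] (ℝ × Y × ℝ),
      (B : (ℝ × ℝ × X) →L[ℝ] (ℝ × Y × ℝ)) = fderiv ℝ Φ p := by
    have hc : ContinuousAt (fderiv ℝ Φ) p₀ := (hΦ1.continuous_fderiv (by norm_num)).continuousAt
    have hn := ContinuousLinearEquiv.nhds A
    rw [hAe] at hn
    exact hc.eventually hn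
  have hev : ∀ᶠ ε in 𝓝 (0 : ℝ), γ ε ∈ e.target ∧ ∃ B : (ℝ × ℝ × X) ≃L[ℝ] (ℝ × Y × ℝ),
      (B : (ℝ × ℝ × X) →L[ℝ] (ℝ × Y × ℝ)) = fderiv ℝ Φ (e.symm (γ ε)) := by
    refine (hγc.continuousAt.eventually (e.open_target.mem_nhds htgt)).and ?_
    have hc : ContinuousAt (fun ε => e.symm (γ ε)) 0 :=
      ContinuousAt.comp (e.continuousAt_symm htgt) hγc.continuousAt
    rw [← hsymm0] at hopen
    exact hc.eventually hopen
  -- invertibility of the derivative along the branch, which gives smoothness of the branch of any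
  -- order on the whole interval
  obtain ⟨δ, hδ, hball⟩ := Metric.eventually_nhds_iff.1 hev
  refine ⟨δ, fun ε => (e.symm (γ ε)).2.1, fun ε => (e.symm (γ ε)).2.2, hδ, ?_, ?_, ?_, ?_⟩
  · simp only [hsymm0, hp₀]
  · simp only [hsymm0, hp₀]
  · intro ε hε
    obtain ⟨h1, -⟩ := hball (by simpa using hε)
    have h2 := e.right_inv h1
    rw [heΦ] at h2
    simp only [hΦ, hγ, Prod.mk.injEq] at h2
    obtain ⟨h3, h4, h5⟩ := h2
    refine ⟨?_, h5⟩
    rw [h3] at h4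
    exact sub_eq_zero.1 h4
  · intro m hm ε hε
    obtain ⟨h1, B, hB⟩ := hball (y := ε) (by simpa using hε)
    have hder' : HasFDerivAt e (B : (ℝ × ℝ × X) →L[ℝ] (ℝ × Y × ℝ)) (e.symm (γ ε)) := by
      rw [hB]
      exact (hΦ1.differentiable (by norm_num) _).hasFDerivAt
    have hs : ContDiffAt ℝ m e.symm (γ ε) :=
      e.contDiffAt_symm h1 hder' (hsmooth m hm).contDiffAt
    have hsc : ContDiffAt ℝ m (fun ε => e.symm (γ ε)) ε := hs.comp ε (hγs m).contDiffAt
    exact ⟨hsc.snd.fst, hsc.snd.snd⟩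

end Branch

/-! ### The second order estimate of the eigenvalue -/

section Quadratic

open scoped BoundedContinuousFunction

/-- An element of `H²(ℝ)` has a bounded continuously differentiable representative. -/
theorem H2.exists_rep (u : H2 ℝ) : ∃ (U : ℝ →ᵇ ℝ) (V : ℝ → ℝ), H2.fnL ℝ u =ᵐ[volume] U ∧
    H2.derivL ℝ u =ᵐ[volume] V ∧ (∀ z, HasDerivAt U (V z) z) ∧ Continuous V := by
  obtain ⟨U, hU, hp⟩ := u.isWeakDeriv_fnL.exists_isPrimitive
  obtain ⟨V, hV, hp'⟩ := u.isWeakDeriv_derivL.exists_isPrimitive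
  obtain ⟨B, hB⟩ := hp.exists_bound hU
  have hVc := hp'.continuous
  refine ⟨BoundedContinuousFunction.ofNormedAddCommGroup U hp.continuous B hB, V, hU, hV, ?_, hVc⟩
  have h := (hp.congr_ae hV).eq_add 0
  intro z
  change HasDerivAt U (V z) z
  rw [h]
  exact (intervalIntegral.integral_hasDerivAt_right (hVc.intervalIntegrable _ _)
    (hVc.stronglyMeasurableAtFilter _ _) hVc.continuousAt).const_add _

variable {f u₀ : ℝ → ℝ} {a : ℤ → ℝ}

/-- The weak derivative of `Δ u₀`, which lies in `L²` by the equation for `u₁`, is `Δ u₀'`. -/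
theorem isWeakDeriv_latticeL (hf : IsBalancedBistable f) (hu : IsHeteroclinic f u₀)
    (ha : IsLatticeCoupling a) {G w : L2 ℝ} (hG : ∀ᵐ z, G z = latticeOp a u₀ z)
    (hw : w =ᵐ[volume] deriv u₀) : IsWeakDeriv G (latticeL ℝ a w) := by
  obtain ⟨M, hM⟩ := hu.exists_deriv_bound hf
  have hcw : Continuous (deriv u₀) :=
    continuous_iff_continuousAt.2 fun z => (hu.hasDerivAt_deriv z).continuousAt
  have hbd : ∀ (k : ℤ) (z : ℝ), ‖a k • deriv u₀ (z - k)‖ ≤ |a k| * M := fun k z => by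
    rw [norm_smul, Real.norm_eq_abs]
    gcongr
    exact hM _
  have hder : ∀ z, HasDerivAt (latticeOp a u₀) (∑' k : ℤ, a k • deriv u₀ (z - k)) z := by
    intro z
    refine hasDerivAt_tsum (u := fun k : ℤ => |a k| * M) (ha.summable_abs.mul_right M)
      (g := fun k z => a k • u₀ (z - k)) (fun k y => ?_) hbd (y₀ := 0) ?_ z
    · exact ((hu.hasDerivAt (y - k)).comp_sub_const y k).const_smul (a k)
    · refine Summable.of_norm_bounded ha.summable_abs fun k => ?_
      rw [norm_smul, Real.norm_eq_abs]
      have := hu.mem_Ioo hf (0 - k)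
      refine mul_le_of_le_one_right (abs_nonneg _) ?_
      rw [Real.norm_eq_abs, abs_of_pos this.1]
      exact this.2.le
  have hcont : Continuous fun z => ∑' k : ℤ, a k • deriv u₀ (z - k) :=
    continuous_tsum (fun k => by fun_prop) (ha.summable_abs.mul_right M) hbd
  refine ((IsPrimitive.of_hasDerivAt hder hcont).congr_ae ?_).isWeakDeriv hG
  filter_upwards [ae_hasSum_latticeL ha w, ae_shift_eq hw] with z h1 h2
  rw [← h1.tsum_eq]
  simp only [h2]

/-- Second order Taylor estimate for `f`, uniform for base points in `[0, 1]`. -/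
theorem exists_taylor_bound (hf : IsBalancedBistable f) (B : ℝ) :
    ∃ M, 0 ≤ M ∧ ∀ x ∈ Icc (0 : ℝ) 1, ∀ h, |h| ≤ B →
      |f (x + h) - f x - deriv f x * h| ≤ M * h ^ 2 := by
  obtain ⟨M, hM⟩ := (isCompact_Icc (a := -B) (b := 1 + B)).exists_bound_of_continuousOn
    (hf.contDiff_deriv.continuous_deriv le_rfl).continuousOn
  refine ⟨max M 0, le_max_right _ _, fun x hx h hh => ?_⟩
  have hhB := abs_le.1 hh
  have hsub : uIcc x (x + h) ⊆ Icc (-B) (1 + B) := by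
    rw [← uIcc_of_le (by linarith [hx.1, hx.2] : -B ≤ 1 + B)]
    refine uIcc_subset_uIcc ?_ ?_ <;> rw [uIcc_of_le (by linarith [hx.1, hx.2])] <;>
      constructor <;> linarith [hx.1, hx.2]
  have hd : ∀ t ∈ uIcc x (x + h), ‖deriv f t - deriv f x‖ ≤ max M 0 * |h| := by
    intro t ht
    have h1 := (convex_uIcc x (x + h)).norm_image_sub_le_of_norm_deriv_le
      (fun s _ => hf.contDiff_deriv.differentiable (by norm_num) s)
      (fun s hs => (hM s (hsub hs)).trans (le_max_left M 0)) left_mem_uIcc ht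
    refine h1.trans ?_
    gcongr
    have := abs_sub_left_of_mem_uIcc ht
    rwa [add_sub_cancel_left] at this
  have h2 := (convex_uIcc x (x + h)).norm_image_sub_le_of_norm_hasDerivWithin_le
    (f := fun t => f t - deriv f x * t) (f' := fun t => deriv f t - deriv f x)
    (fun t _ => ((hf.hasDerivAt t).sub
      (by simpa using (hasDerivAt_id t).const_mul (deriv f x))).hasDerivWithinAt)
    hd left_mem_uIcc right_mem_uIcc
  rw [add_sub_cancel_left, Real.norm_eq_abs, Real.norm_eq_abs, mul_assoc, ← sq, sq_abs] at h2
  convert h2 using 2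
  ring

theorem H2.norm_fnL_le (U : H2 ℝ) : ‖H2.fnL ℝ U‖ ≤ ‖U‖ := PiLp.norm_apply_le U.1 0

theorem H2.norm_derivL_le (U : H2 ℝ) : ‖H2.derivL ℝ U‖ ≤ ‖U‖ := PiLp.norm_apply_le U.1 1

/-- Pairing the eigenvalue equation with `u₀' + ε u₁'`, the derivative of the approximate profile
`u₀ + ε u₁`, and integrating by parts leaves only the residual of the profile equation, which is of
second order in `ε`. -/
theorem exists_eigenvalue_pairing_bound (hf : IsBalancedBistable f) (hu : IsHeteroclinic f u₀)
    (ha : IsLatticeCoupling a) {u₁ : H2 ℝ} (hu₁ : IsFirstCorrector f a u₀ u₁) {w : H2 ℝ}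
    (hw : H2.fnL ℝ w =ᵐ[volume] deriv u₀)
    (hw' : H2.derivL ℝ w =ᵐ[volume] (fun z => -f (u₀ z))) {U : ℝ →ᵇ ℝ} {V : ℝ → ℝ}
    (hU : H2.fnL ℝ u₁ =ᵐ[volume] U) (hV : H2.derivL ℝ u₁ =ᵐ[volume] V)
    (hUV : ∀ z, HasDerivAt U (V z) z) (hVc : Continuous V) {b : ℝ → ℝ →ᵇ ℝ}
    (hb : ∀ ε z, b ε z = deriv f (u₀ z + ε * U z)) :
    ∃ K, ∀ ε ∈ Icc (0 : ℝ) 1, ∀ (φ : H2 ℝ) (l : ℝ),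
      schrL ℝ a (b ε) ε φ = l • H2.fnL ℝ φ →
      |l * ⟪H2.fnL ℝ φ, H2.fnL ℝ w + ε • H2.derivL ℝ u₁⟫_ℝ| ≤ K * ε ^ 2 * ‖φ‖ := by
  obtain ⟨M, hM0, hM⟩ := exists_taylor_bound hf ‖U‖
  have hcu := hu.contDiff.continuous
  have hcf := hf.contDiff.continuous
  refine ⟨M * ‖U‖ * ‖H2.fnL ℝ u₁‖ + ‖latticeL ℝ a (H2.derivL ℝ u₁)‖, fun ε hε φ l hφ => ?_⟩
  set w₀ := H2.fnL ℝ w with hw₀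
  set w₁ := H2.derivL ℝ w with hw₁
  set v := H2.derivL ℝ u₁ with hv
  -- the remainder of the first order Taylor expansion of `f (u₀ + ε u₁)`
  set ρ₀ : ℝ → ℝ := fun z => f (u₀ z + ε * U z) - f (u₀ z) - deriv f (u₀ z) * (ε * U z) with hρ₀
  have hρ₀b : ∀ z, ‖ρ₀ z‖ ≤ M * ε ^ 2 * ‖U‖ * ‖U z‖ := by
    intro z
    have hUz := U.norm_coe_le_norm z
    have h1 : |ε * U z| ≤ ‖U‖ := by
      rw [abs_mul, abs_of_nonneg hε.1]
      calc ε * |U z| ≤ 1 * ‖U‖ := by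
            gcongr
            · exact hε.2
            · exact hUz
        _ = ‖U‖ := one_mul _
    refine (hM (u₀ z) (Ioo_subset_Icc_self (hu.mem_Ioo hf z)) _ h1).trans ?_
    have e : M * (ε * U z) ^ 2 = M * ε ^ 2 * ‖U z‖ * ‖U z‖ := by
      rw [Real.norm_eq_abs, mul_assoc, mul_assoc, abs_mul_abs_self]
      ring
    rw [e]
    gcongr
  have hρ₀c : Continuous ρ₀ := by
    have := hf.contDiff_deriv.continuous
    fun_prop
  have hρ₀m : MemLp ρ₀ 2 volume := by
    refine (Lp.memLp (H2.fnL ℝ u₁)).of_le_mul (c := M * ε ^ 2 * ‖U‖) hρ₀c.aestronglyMeasurable ?_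
    filter_upwards [hU] with z hz
    rw [hz]
    exact hρ₀b z
  set ρ : L2 ℝ := hρ₀m.toLp with hρ
  have hρe : ρ =ᵐ[volume] ρ₀ := hρ₀m.coeFn_toLp
  have hρn : ‖ρ‖ ≤ M * ε ^ 2 * ‖U‖ * ‖H2.fnL ℝ u₁‖ := by
    refine Lp.norm_le_mul_norm_of_ae_le_mul ?_
    filter_upwards [hρe, hU] with z h1 h2
    rw [h1, h2]
    exact hρ₀b z
  -- `f (u₀ + ε u₁)` as an element of `L²`, and its derivative
  set r : L2 ℝ := ρ - w₁ + ε • mulL ℝ (b 0) (H2.fnL ℝ u₁) with hr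
  have hre : ∀ᵐ z, r z = f (u₀ z + ε * U z) := by
    filter_upwards [Lp.coeFn_add (ρ - w₁) (ε • mulL ℝ (b 0) (H2.fnL ℝ u₁)), Lp.coeFn_sub ρ w₁,
      Lp.coeFn_smul ε (mulL ℝ (b 0) (H2.fnL ℝ u₁)), coeFn_mulL (b 0) (H2.fnL ℝ u₁), hρe, hw',
      hU] with z h1 h2 h3 h4 h5 h6 h7
    rw [hr, h1, Pi.add_apply, h2, Pi.sub_apply, h3, Pi.smul_apply, h4, h5, h6, h7, hb, hρ₀]
    simp only [smul_eq_mul, zero_mul, add_zero]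
    ring
  set q : L2 ℝ := w₀ + ε • v with hq
  have hqe : ∀ᵐ z, q z = deriv u₀ z + ε * V z := by
    filter_upwards [Lp.coeFn_add w₀ (ε • v), Lp.coeFn_smul ε v, hw, hV] with z h1 h2 h3 h4
    rw [hq, h1, Pi.add_apply, h2, Pi.smul_apply, h3, h4, smul_eq_mul]
  have hrd : IsWeakDeriv r (mulL ℝ (b ε) q) := by
    have hd : ∀ z, HasDerivAt (fun z => f (u₀ z + ε * U z))
        (b ε z * (deriv u₀ z + ε * V z)) z := fun z => by
      rw [hb]
      exact (hf.hasDerivAt _).comp z ((hu.hasDerivAt z).add ((hUV z).const_mul ε))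
    have hcw : Continuous (deriv u₀) :=
      continuous_iff_continuousAt.2 fun z => (hu.hasDerivAt_deriv z).continuousAt
    refine ((IsPrimitive.of_hasDerivAt hd (by fun_prop)).congr_ae ?_).isWeakDeriv hre
    filter_upwards [coeFn_mulL (b ε) q, hqe] with z h1 h2
    rw [h1, h2, smul_eq_mul]
  -- `G = Δ u₀` is in `L²` although `u₀` is not
  set G : L2 ℝ := H2.deriv2L ℝ u₁ + mulL ℝ (b 0) (H2.fnL ℝ u₁) with hG
  have hGd : IsWeakDeriv G (latticeL ℝ a w₀) := by
    refine isWeakDeriv_latticeL hf hu ha ?_ hw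
    filter_upwards [Lp.coeFn_add (H2.deriv2L ℝ u₁) (mulL ℝ (b 0) (H2.fnL ℝ u₁)),
      coeFn_mulL (b 0) (H2.fnL ℝ u₁), hu₁.eqn] with z h1 h2 h3
    rw [hG, h1, Pi.add_apply, h2, hb, zero_mul, add_zero, smul_eq_mul, ← h3]
    rfl
  have hφ1 := φ.isWeakDeriv_fnL
  have p1 : ⟪H2.derivL ℝ φ, r⟫_ℝ = -⟪H2.fnL ℝ φ, mulL ℝ (b ε) q⟫_ℝ := hφ1.inner_real hrd
  have p2 : ⟪H2.derivL ℝ φ, G⟫_ℝ = -⟪H2.fnL ℝ φ, latticeL ℝ a w₀⟫_ℝ := hφ1.inner_real hGd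
  have p3 : ⟪H2.deriv2L ℝ φ, q⟫_ℝ = -⟪H2.derivL ℝ φ, w₁ + ε • H2.deriv2L ℝ u₁⟫_ℝ :=
    φ.isWeakDeriv_derivL.inner_real (w.isWeakDeriv_fnL.add (u₁.isWeakDeriv_derivL.smul ε))
  -- the terms of order `1` and `ε` cancel by the equations for `u₀` and `u₁`
  have key : l * ⟪H2.fnL ℝ φ, q⟫_ℝ =
      ⟪H2.derivL ℝ φ, ρ⟫_ℝ + ε ^ 2 * ⟪H2.fnL ℝ φ, latticeL ℝ a v⟫_ℝ := by
    have h1 := congrArg (fun y => ⟪y, q⟫_ℝ) hφ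
    simp only [inner_smul_left, RCLike.conj_to_real] at h1
    rw [← h1, schrL_apply', inner_sub_left, inner_sub_left, inner_smul_left, inner_mulL,
      inner_latticeL ha, p3, RCLike.conj_to_real]
    have h2 : latticeL ℝ a q = latticeL ℝ a w₀ + ε • latticeL ℝ a v := by
      rw [hq, map_add, map_smul]
    have h3 : ρ = r + w₁ - ε • mulL ℝ (b 0) (H2.fnL ℝ u₁) := by
      rw [hr]
      abel
    rw [h2, h3]
    simp only [hG, inner_add_right, inner_sub_right, inner_smul_right] at p1 p2 ⊢
    simp only [RCLike.ofReal_real_eq_id, id_eq]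
    linear_combination ε * p2 - p1
  rw [key]
  have q1 : |⟪H2.derivL ℝ φ, ρ⟫_ℝ| ≤ ‖φ‖ * (M * ε ^ 2 * ‖U‖ * ‖H2.fnL ℝ u₁‖) :=
    (abs_real_inner_le_norm _ _).trans (by gcongr; exact φ.norm_derivL_le)
  have q2 : |⟪H2.fnL ℝ φ, latticeL ℝ a v⟫_ℝ| ≤ ‖φ‖ * ‖latticeL ℝ a v‖ :=
    (abs_real_inner_le_norm _ _).trans (by gcongr; exact φ.norm_fnL_le)
  calc |⟪H2.derivL ℝ φ, ρ⟫_ℝ + ε ^ 2 * ⟪H2.fnL ℝ φ, latticeL ℝ a v⟫_ℝ|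
      ≤ |⟪H2.derivL ℝ φ, ρ⟫_ℝ| + ε ^ 2 * |⟪H2.fnL ℝ φ, latticeL ℝ a v⟫_ℝ| := by
        refine (abs_add_le _ _).trans ?_
        rw [abs_mul, abs_of_nonneg (sq_nonneg ε)]
    _ ≤ ‖φ‖ * (M * ε ^ 2 * ‖U‖ * ‖H2.fnL ℝ u₁‖) + ε ^ 2 * (‖φ‖ * ‖latticeL ℝ a v‖) := by gcongr
    _ = _ := by ring

end Quadratic

/-! ### The spectrum of the unbounded operator -/

section Spectrum

open scoped BoundedContinuousFunction

variable {a : ℤ → ℝ} {V : ℝ → ℝ} {b : ℝ →ᵇ ℝ} {ε : ℝ}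

/-- The domain of the unbounded operator is `H²`, on which it acts as `schrL`. -/
theorem exists_of_mem_domain (ha : IsLatticeCoupling a) (hV : V =ᵐ[volume] b)
    (x : (negLinOp a V ε).domain) :
    ∃ U : H2 ℂ, H2.fnL ℂ U = x ∧ schrL ℂ a b ε U = negLinOp a V ε x := by
  have h := (negLinOp a V ε).mem_graph x
  rw [negLinOp_graph, mem_negLinGraph_iff ha hV] at h
  exact h

theorem exists_domain_of_H2 (ha : IsLatticeCoupling a) (hV : V =ᵐ[volume] b) (U : H2 ℂ) :
    ∃ x : (negLinOp a V ε).domain, (x : L2 ℂ) = H2.fnL ℂ U ∧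
      negLinOp a V ε x = schrL ℂ a b ε U := by
  have h : (H2.fnL ℂ U, schrL ℂ a b ε U) ∈ (negLinOp a V ε).graph := by
    rw [negLinOp_graph, mem_negLinGraph_iff ha hV]
    exact ⟨U, rfl, rfl⟩
  exact LinearPMap.mem_graph_iff _ |>.1 h

theorem inResolventSet_of_bijective (ha : IsLatticeCoupling a) (hV : V =ᵐ[volume] b) {μ : ℂ}
    (hbij : Function.Bijective fun U => schrL ℂ a b ε U - μ • H2.fnL ℂ U) :
    InResolventSet (negLinOp a V ε) μ := by
  set A := ContinuousLinearEquiv.ofBijective (schrL ℂ a b ε - μ • H2.fnL ℂ)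
    (LinearMap.ker_eq_bot.2 hbij.1) (LinearMap.range_eq_top.2 hbij.2) with hA
  have hAU : ∀ U, A U = schrL ℂ a b ε U - μ • H2.fnL ℂ U := fun _ => rfl
  refine ⟨H2.fnL ℂ ∘L (A.symm : L2 ℂ →L[ℂ] H2 ℂ), fun y => ?_, fun x => ?_⟩
  · obtain ⟨x, hx, hTx⟩ := exists_domain_of_H2 (ε := ε) ha hV (A.symm y)
    refine ⟨x, hx, ?_⟩
    rw [hx, hTx, ← hAU, A.apply_symm_apply]
  · obtain ⟨U, hU, hTU⟩ := exists_of_mem_domain ha hV x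
    rw [← hU, ← hTU, ← hAU]
    change H2.fnL ℂ (A.symm (A U)) = _
    rw [A.symm_apply_apply]

variable {χ : H2 ℂ} {l c : ℝ}

/-- Away from an eigenvalue `l`, the spectrum starts at the lower bound `c` of the quadratic form on
the complement of the eigenvector. -/
theorem spectrum_subset_of_gap (ha : IsLatticeCoupling a) (hV : V =ᵐ[volume] b)
    (hχ : H2.fnL ℂ χ ≠ 0) (hTχ : schrL ℂ a b ε χ = (l : ℂ) • H2.fnL ℂ χ)
    (hgap : ∀ ψ, ⟪H2.fnL ℂ χ, H2.fnL ℂ ψ⟫_ℂ = 0 →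
      c * ‖H2.fnL ℂ ψ‖ ^ 2 ≤ RCLike.re ⟪schrL ℂ a b ε ψ, H2.fnL ℂ ψ⟫_ℂ) :
    unboundedSpectrum (negLinOp a V ε) ⊆ {(l : ℂ)} ∪ {μ : ℂ | ∃ t : ℝ, c ≤ t ∧ μ = (t : ℂ)} := by
  intro μ hμ
  by_contra hn
  simp only [mem_union, mem_singleton_iff, not_or] at hn
  obtain ⟨hμl, hμc⟩ := hn
  refine hμ (inResolventSet_of_bijective ha hV ?_)
  have hcl : IsClosed ((fun t : ℝ => (t : ℂ)) '' Ici c) :=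
    Complex.isometry_ofReal.isClosedEmbedding.isClosedMap _ isClosed_Ici
  have hμc' : μ ∉ (fun t : ℝ => (t : ℂ)) '' Ici c := by
    rintro ⟨t, ht, rfl⟩
    exact hμc ⟨t, ht, rfl⟩
  have hd := (hcl.notMem_iff_infDist_pos ⟨_, mem_image_of_mem _ self_mem_Ici⟩).1 hμc'
  set δ := min ‖(l : ℂ) - μ‖ (Metric.infDist μ ((fun t : ℝ => (t : ℂ)) '' Ici c)) with hδ
  have hδ0 : 0 < δ := lt_min (norm_pos_iff.2 (sub_ne_zero.2 (Ne.symm hμl))) hd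
  have hδt : ∀ t : ℝ, c ≤ t → δ ≤ ‖(t : ℂ) - μ‖ := fun t ht => by
    rw [← dist_eq_norm, dist_comm]
    exact (min_le_right _ _).trans (Metric.infDist_le_dist_of_mem (mem_image_of_mem _ ht))
  have hconj : ∀ t : ℝ, ‖(t : ℂ) - (starRingEnd ℂ) μ‖ = ‖(t : ℂ) - μ‖ := fun t => by
    rw [← Complex.norm_conj, map_sub, Complex.conj_conj, Complex.conj_ofReal]
  have hsym : ∀ x y, ⟪schrL ℂ a b ε x, H2.fnL ℂ y⟫_ℂ = ⟪H2.fnL ℂ x, schrL ℂ a b ε y⟫_ℂ :=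
    inner_schrL ha b ε
  have hn0 : ‖H2.fnL ℂ χ‖ ≠ 0 := norm_ne_zero_iff.2 hχ
  set e : H2 ℂ := ((‖H2.fnL ℂ χ‖⁻¹ : ℝ) : ℂ) • χ with he
  have hJe : ‖H2.fnL ℂ e‖ = 1 := by
    rw [he, map_smul, norm_smul, Complex.norm_real, norm_inv, norm_norm, inv_mul_cancel₀ hn0]
  have hTe : schrL ℂ a b ε e = (l : ℂ) • H2.fnL ℂ e := by
    rw [he, map_smul, map_smul, hTχ, smul_comm]
  have hgape : ∀ ψ, ⟪H2.fnL ℂ e, H2.fnL ℂ ψ⟫_ℂ = 0 →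
      c * ‖H2.fnL ℂ ψ‖ ^ 2 ≤ RCLike.re ⟪schrL ℂ a b ε ψ, H2.fnL ℂ ψ⟫_ℂ := by
    intro ψ hψ
    refine hgap ψ ?_
    rw [he, map_smul, inner_smul_left] at hψ
    exact (mul_eq_zero.1 hψ).resolve_left (by simpa using hχ)
  have hlow : ∀ ν : ℂ, (∀ t : ℝ, ‖(t : ℂ) - ν‖ = ‖(t : ℂ) - μ‖) → ∀ x,
      δ * ‖H2.fnL ℂ x‖ ≤ ‖H2.helmholtzEquiv ℂ x + potentialL ℂ a b ε (H2.fnL ℂ x)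
        - ν • H2.fnL ℂ x‖ := by
    intro ν hν x
    have h := lower_bound_of_gap hsym hJe hTe hgape 0 ν hδ0.le
      (by rw [add_zero]; exact (min_le_left _ _).trans (hν l).ge)
      (fun t ht => (hδt t ht).trans (hν t).ge) x
    rwa [RCLike.ofReal_zero, zero_smul, add_zero, schrL_apply] at h
  exact bijective_of_lower_bound (H2.helmholtzEquiv ℂ) (H2.fnL ℂ) (potentialL ℂ a b ε)
    H2.inner_helmholtzL (inner_potentialL ha b ε) μ hδ0 (hlow μ fun _ => rfl) (hlow _ hconj)

/-- An eigenvalue below the lower bound on the complement of its eigenvector is simple: an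
eigenvector orthogonal to `χ` would violate the bound, and by symmetry `T - l` maps into the
complement of `χ`. -/
theorem isSimpleEigenpair_of_gap (ha : IsLatticeCoupling a) (hV : V =ᵐ[volume] b)
    (hχ : H2.fnL ℂ χ ≠ 0) (hTχ : schrL ℂ a b ε χ = (l : ℂ) • H2.fnL ℂ χ) (hlc : l < c)
    (hgap : ∀ ψ, ⟪H2.fnL ℂ χ, H2.fnL ℂ ψ⟫_ℂ = 0 →
      c * ‖H2.fnL ℂ ψ‖ ^ 2 ≤ RCLike.re ⟪schrL ℂ a b ε ψ, H2.fnL ℂ ψ⟫_ℂ) :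
    IsSimpleEigenpair (negLinOp a V ε) (l : ℂ) (H2.fnL ℂ χ) := by
  have hχχ : ⟪H2.fnL ℂ χ, H2.fnL ℂ χ⟫_ℂ ≠ 0 := inner_self_ne_zero.2 hχ
  refine ⟨hχ, ?_, fun y hy => ?_, fun y hy => ?_⟩
  · obtain ⟨x, hx, hTx⟩ := exists_domain_of_H2 (ε := ε) ha hV χ
    refine ⟨hx ▸ x.2, ?_⟩
    have e : (⟨H2.fnL ℂ χ, hx ▸ x.2⟩ : (negLinOp a V ε).domain) = x := Subtype.ext hx.symm
    rw [e, hTx, hTχ]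
  · obtain ⟨ψ, hψ, hTψ⟩ := exists_of_mem_domain ha hV y
    rw [hy, ← hψ] at hTψ
    set β := ⟪H2.fnL ℂ χ, H2.fnL ℂ ψ⟫_ℂ / ⟪H2.fnL ℂ χ, H2.fnL ℂ χ⟫_ℂ with hβ
    have h0 : ⟪H2.fnL ℂ χ, H2.fnL ℂ (ψ - β • χ)⟫_ℂ = 0 := by
      rw [map_sub, map_smul, inner_sub_right, inner_smul_right, hβ, div_mul_cancel₀ _ hχχ, sub_self]
    have h1 : schrL ℂ a b ε (ψ - β • χ) = (l : ℂ) • H2.fnL ℂ (ψ - β • χ) := by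
      rw [map_sub, map_sub, map_smul, map_smul, hTψ, hTχ, smul_sub, smul_comm]
    have h2 := hgap _ h0
    rw [h1, inner_smul_left, inner_self_eq_norm_sq_to_K, Complex.conj_ofReal] at h2
    have h3 : RCLike.re ((l : ℂ) * (((‖H2.fnL ℂ (ψ - β • χ)‖ : ℝ) : ℂ)) ^ 2) =
        l * ‖H2.fnL ℂ (ψ - β • χ)‖ ^ 2 := by
      rw [← Complex.ofReal_pow, ← Complex.ofReal_mul]
      exact Complex.ofReal_re _
    have h4 : c * ‖H2.fnL ℂ (ψ - β • χ)‖ ^ 2 ≤ l * ‖H2.fnL ℂ (ψ - β • χ)‖ ^ 2 := h2.trans_eq h3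
    have h5 : ‖H2.fnL ℂ (ψ - β • χ)‖ = 0 := by
      by_contra hne
      have : 0 < ‖H2.fnL ℂ (ψ - β • χ)‖ ^ 2 := by positivity
      nlinarith
    refine ⟨β, ?_⟩
    rw [norm_eq_zero, map_sub, map_smul, sub_eq_zero] at h5
    rw [← hψ, h5]
  · obtain ⟨ψ, hψ, hTψ⟩ := exists_of_mem_domain ha hV y
    rw [← hψ, ← hTψ] at hy
    refine hχχ ?_
    nth_rw 1 [← hy]
    rw [inner_sub_left, inner_schrL ha, hTχ, inner_smul_left, inner_smul_right,
      Complex.conj_ofReal, sub_self]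

variable {φ : H2 ℝ}

/-- The complexification of an `H²` function. -/
noncomputable def H2.complexify (φ : H2 ℝ) : H2 ℂ := H2.map Complex.ofRealCLM φ

theorem H2.fnL_complexify (φ : H2 ℝ) : H2.fnL ℂ φ.complexify = _root_.complexify φ.fn := rfl

theorem reL_complexify (g : L2 ℝ) : reL ℂ (complexify g) = g := by
  refine Lp.ext ?_
  filter_upwards [coeFn_reL (complexify g), Complex.ofRealCLM.coeFn_compLp g] with z h1 h2
  rw [h1]
  change RCLike.re (Complex.ofRealCLM.compLp g z) = _
  rw [h2]
  simp

theorem imL_complexify (g : L2 ℝ) : imL ℂ (complexify g) = 0 := by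
  refine Lp.ext ?_
  filter_upwards [coeFn_imL (complexify g), Complex.ofRealCLM.coeFn_compLp g,
    Lp.coeFn_zero ℝ 2 (volume : Measure ℝ)] with z h1 h2 h3
  rw [h1, h3]
  change RCLike.im (Complex.ofRealCLM.compLp g z) = _
  rw [h2]
  simp

theorem schrL_complexify (ha : IsLatticeCoupling a)
    (hTφ : schrL ℝ a b ε φ = l • H2.fnL ℝ φ) :
    schrL ℂ a b ε φ.complexify = (l : ℂ) • H2.fnL ℂ φ.complexify := by
  rw [H2.complexify, schrL_map ha, hTφ, H2.fnL_map]
  exact (map_smul (Complex.ofRealCLM.compLpL 2 volume) l (H2.fnL ℝ φ)).trans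
    (Complex.coe_smul _ _).symm

/-- As the operator is real, a lower bound for real functions holds for complex ones. -/
theorem gap_complexify (ha : IsLatticeCoupling a)
    (hgap : ∀ ψ, ⟪H2.fnL ℝ φ, H2.fnL ℝ ψ⟫_ℝ = 0 →
      c * ‖H2.fnL ℝ ψ‖ ^ 2 ≤ ⟪schrL ℝ a b ε ψ, H2.fnL ℝ ψ⟫_ℝ) (ψ : H2 ℂ)
    (hψ : ⟪H2.fnL ℂ φ.complexify, H2.fnL ℂ ψ⟫_ℂ = 0) :
    c * ‖H2.fnL ℂ ψ‖ ^ 2 ≤ RCLike.re ⟪schrL ℂ a b ε ψ, H2.fnL ℂ ψ⟫_ℂ := by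
  have h1 := re_inner_eq (H2.fnL ℂ φ.complexify) (H2.fnL ℂ ψ)
  have h2 := im_inner_eq (H2.fnL ℂ φ.complexify) (H2.fnL ℂ ψ)
  rw [hψ, H2.fnL_complexify, reL_complexify, imL_complexify, inner_zero_left, map_zero] at h1 h2
  rw [add_zero] at h1
  rw [sub_zero] at h2
  have h3 := hgap (H2.map RCLike.reCLM ψ) h1.symm
  have h4 := hgap (H2.map RCLike.imCLM ψ) h2.symm
  rw [re_inner_schrL ha, norm_sq_eq_reL_add_imL, mul_add]
  exact add_le_add h3 h4

/-- A lower bound on the complement of a fixed `w` is stable under bounded perturbations. -/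
theorem gap_of_perturbation {b₀ : ℝ →ᵇ ℝ} {w : L2 ℝ} {η : ℝ}
    (hgap : ∀ ψ, ⟪w, H2.fnL ℝ ψ⟫_ℝ = 0 →
      c * ‖H2.fnL ℝ ψ‖ ^ 2 ≤ ⟪schrL ℝ a b₀ 0 ψ, H2.fnL ℝ ψ⟫_ℝ)
    (hη : |ε| * ‖latticeL ℝ a‖ + ‖b - b₀‖ ≤ η) (ψ : H2 ℝ) (hψ : ⟪w, H2.fnL ℝ ψ⟫_ℝ = 0) :
    (c - η) * ‖H2.fnL ℝ ψ‖ ^ 2 ≤ ⟪schrL ℝ a b ε ψ, H2.fnL ℝ ψ⟫_ℝ := by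
  set g := H2.fnL ℝ ψ with hg
  have e : schrL ℝ a b ε ψ = schrL ℝ a b₀ 0 ψ + (ε • latticeL ℝ a g - mulL ℝ (b - b₀) g) := by
    rw [schrL_apply', schrL_apply', map_sub, sub_apply]
    simp only [RCLike.ofReal_real_eq_id, id_eq, zero_smul]
    abel
  have h1 : ‖ε • latticeL ℝ a g - mulL ℝ (b - b₀) g‖ ≤ η * ‖g‖ := by
    refine (norm_sub_le _ _).trans (le_trans ?_ (mul_le_mul_of_nonneg_right hη (norm_nonneg g)))
    rw [add_mul, norm_smul, Real.norm_eq_abs, mul_assoc]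
    gcongr
    · exact (latticeL ℝ a).le_opNorm g
    · exact (ContinuousLinearMap.le_opNorm _ g).trans (by gcongr; exact norm_mulL_le _)
  have h2 := (abs_le.1 (abs_real_inner_le_norm (ε • latticeL ℝ a g - mulL ℝ (b - b₀) g) g)).1
  have h3 : ‖ε • latticeL ℝ a g - mulL ℝ (b - b₀) g‖ * ‖g‖ ≤ η * ‖g‖ * ‖g‖ := by gcongr
  rw [e, inner_add_left]
  nlinarith [hgap ψ hψ]

end Spectrum

/-! ### The branch of the linearized operator -/

section Unperturbed

open scoped BoundedContinuousFunction

/-- The operator depends on `ε` as smoothly as its potential. -/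
theorem contDiff_schrL (a : ℤ → ℝ) {b : ℝ → ℝ →ᵇ ℝ} {m : ℕ} (hb : ContDiff ℝ m b) :
    ContDiff ℝ m fun ε => schrL ℝ a (b ε) ε := by
  have h1 : ContDiff ℝ m fun ε => mulL ℝ (b ε) := (mulL ℝ).contDiff.comp hb
  have h2 : ContDiff ℝ m fun ε => potentialL ℝ a (b ε) ε := by
    unfold potentialL
    simp only [RCLike.ofReal_real_eq_id, id_eq]
    exact ((contDiff_id.smul contDiff_const).sub h1).sub contDiff_const
  exact contDiff_const.add (h2.clm_comp contDiff_const)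

/-- The bordered operator of a normalized null vector is bijective: adding the projection onto the
null vector to the operator makes it bounded below, by `min 1 c`. -/
theorem bordered_schrL_bijective {a : ℤ → ℝ} (ha : IsLatticeCoupling a) {b : ℝ →ᵇ ℝ} {φ : H2 ℝ}
    (hφ : ‖H2.fnL ℝ φ‖ = 1) (hTφ : schrL ℝ a b 0 φ = 0) {c : ℝ} (hc : 0 < c)
    (hgap : ∀ ψ, ⟪H2.fnL ℝ φ, H2.fnL ℝ ψ⟫_ℝ = 0 →
      c * ‖H2.fnL ℝ ψ‖ ^ 2 ≤ ⟪schrL ℝ a b 0 ψ, H2.fnL ℝ ψ⟫_ℝ) :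
    Function.Bijective fun p : ℝ × H2 ℝ =>
      (schrL ℝ a b 0 p.2 - p.1 • H2.fnL ℝ φ, ⟪H2.fnL ℝ φ, H2.fnL ℝ p.2⟫_ℝ) := by
  refine bordered_bijective (inner_schrL ha b 0) hφ hTφ ?_
  set K : L2 ℝ →L[ℝ] L2 ℝ :=
    potentialL ℝ a b 0 + (innerSL ℝ (H2.fnL ℝ φ)).smulRight (H2.fnL ℝ φ) with hK
  have hKx : ∀ x, K x = potentialL ℝ a b 0 x + ⟪H2.fnL ℝ φ, x⟫_ℝ • H2.fnL ℝ φ := fun _ => rfl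
  have hKs : ∀ x y, ⟪K x, y⟫_ℝ = ⟪x, K y⟫_ℝ := by
    intro x y
    rw [hKx, hKx, inner_add_left, inner_add_right, inner_potentialL ha, real_inner_smul_left,
      real_inner_smul_right, real_inner_comm x, mul_comm]
  have hlow : ∀ x, min 1 c * ‖H2.fnL ℝ x‖ ≤
      ‖H2.helmholtzEquiv ℝ x + K (H2.fnL ℝ x) - (0 : ℝ) • H2.fnL ℝ x‖ := by
    intro x
    have h := lower_bound_of_gap (𝕜 := ℝ) (l := 0) (inner_schrL ha b 0) hφ (by simpa using hTφ)
      hgap 1 0 (δ := min 1 c) (by positivity) (by simp)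
      (fun t ht => by simpa using Or.inr (ht.trans (le_abs_self t))) x
    rw [schrL_apply] at h
    rw [hKx, ← add_assoc]
    simpa using h
  have h := bijective_of_lower_bound (H2.helmholtzEquiv ℝ) (H2.fnL ℝ) K H2.inner_helmholtzL hKs 0
    (lt_min one_pos hc) hlow (by simpa using hlow)
  convert h using 2 with x
  rw [hKx, schrL_apply, zero_smul, sub_zero, add_assoc]

end Unperturbed

open scoped BoundedContinuousFunction

theorem proposition2 (f : ℝ → ℝ) (hf : IsBalancedBistable f)
    (a : ℤ → ℝ) (ha : IsLatticeCoupling a)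
    (u₀ : ℝ → ℝ) (hu₀ : IsHeteroclinic f u₀)
    (u₁ : H2 ℝ) (hu₁ : IsFirstCorrector f a u₀ u₁) :
    ∃ w : H2 ℝ, (∀ᵐ z : ℝ, w.fn z = deriv u₀ z) ∧ w ≠ 0 ∧
    ∃ (ε₀ c C : ℝ) (lam : ℝ → ℝ) (phi : ℝ → H2 ℝ), 0 < ε₀ ∧ 0 < c ∧
      (∀ ε ∈ Icc 0 ε₀,
        unboundedSpectrum (negLinOp a (fun z => deriv f (u₀ z + ε * u₁.fn z)) ε) ⊆
          {(lam ε : ℂ)} ∪ {μ : ℂ | ∃ t : ℝ, c ≤ t ∧ μ = (t : ℂ)} ∧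
        IsSimpleEigenpair (negLinOp a (fun z => deriv f (u₀ z + ε * u₁.fn z)) ε)
          (lam ε : ℂ) (complexify (phi ε).fn) ∧
        ‖phi ε‖ = 1 ∧
        |lam ε| ≤ C * ε ^ 2 ∧
        ‖phi ε - ‖w‖⁻¹ • w‖ ≤ C * ε) ∧
      (∀ m : ℕ, 1 ≤ m → ContDiff ℝ (m + 1) f →
        ContDiffOn ℝ m lam (Icc 0 ε₀) ∧ ContDiffOn ℝ m phi (Icc 0 ε₀)) := by
  obtain ⟨U, V, hU, hV, hUV, hVc⟩ := u₁.exists_rep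
  obtain ⟨v, hv⟩ := hu₀.exists_bcf hf
  -- the potential `f'(u₀ + ε u₁)` as a curve of bounded continuous functions
  let g : C(ℝ, ℝ) := ⟨deriv f, hf.contDiff_deriv.continuous⟩
  set b : ℝ → ℝ →ᵇ ℝ := fun ε => superpos g (v + ε • U) with hbdef
  have hb : ∀ ε z, b ε z = deriv f (u₀ z + ε * U z) := fun ε z => by
    rw [hbdef, superpos_apply, ← hv]
    rfl
  have hbV : ∀ ε, (fun z => deriv f (u₀ z + ε * u₁.fn z)) =ᵐ[volume] b ε := fun ε => by
    filter_upwards [hU] with z hz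
    rw [hb, ← hz]
    rfl
  have hbs : ∀ m : ℕ, ContDiff ℝ (m + 1) f → ContDiff ℝ m b := fun m hm =>
    (contDiff_superpos m g (contDiff_succ_iff_deriv.1 hm).2.2).comp
      (contDiff_const.add (contDiff_id.smul contDiff_const))
  have hb1 : ContDiff ℝ 1 b := by
    have := hbs 1 (by
      have := hf.contDiff
      rw [← one_add_one_eq_two] at this
      exact_mod_cast this)
    exact_mod_cast this
  obtain ⟨w, hw, hw', hTw, c, hc, hgap⟩ := hu₀.exists_groundState hf ha (b := b 0)
    (fun z => by rw [hb, zero_mul, add_zero])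
  have hJw : H2.fnL ℝ w ≠ 0 := by
    intro h0
    rw [h0] at hw
    have h1 : ∀ᵐ _ : ℝ, False := by
      filter_upwards [hw, Lp.coeFn_zero ℝ 2 (volume : Measure ℝ)] with z h1 h2
      rw [h2] at h1
      exact (hu₀.deriv_pos hf z).ne h1
    exact h1.exists.choose_spec
  have hn : 0 < ‖H2.fnL ℝ w‖ := norm_pos_iff.2 hJw
  have hw0 : w ≠ 0 := fun h => hJw (by rw [h, map_zero])
  set n := ‖H2.fnL ℝ w‖ with hn_def
  -- the branch is normalized by `⟪φ₀, φ ε⟫ = 1` in `L²`; the `H²` normalization comes last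
  set φ₀ : H2 ℝ := n⁻¹ • w with hφ₀
  have hJφ₀ : ‖H2.fnL ℝ φ₀‖ = 1 := by
    rw [hφ₀, map_smul, norm_smul, norm_inv, norm_norm, inv_mul_cancel₀ hn.ne']
  have hTφ₀ : schrL ℝ a (b 0) 0 φ₀ = 0 := by rw [hφ₀, map_smul, hTw, smul_zero]
  have hgapφ₀ : ∀ ψ, ⟪H2.fnL ℝ φ₀, H2.fnL ℝ ψ⟫_ℝ = 0 →
      c * ‖H2.fnL ℝ ψ‖ ^ 2 ≤ ⟪schrL ℝ a (b 0) 0 ψ, H2.fnL ℝ ψ⟫_ℝ := fun ψ hψ => by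
    refine hgap ψ ?_
    rw [hφ₀, map_smul, real_inner_smul_left] at hψ
    exact (mul_eq_zero.1 hψ).resolve_left (inv_ne_zero hn.ne')
  obtain ⟨δ, l, φ, hδ, hl0, hφ0, heig, hsmooth⟩ := exists_eigenbranch (H2.fnL ℝ)
    (fun ε => schrL ℝ a (b ε) ε) (by exact_mod_cast contDiff_schrL (m := 1) a (by exact_mod_cast hb1))
    hJφ₀ hTφ₀ (bordered_schrL_bijective ha hJφ₀ hTφ₀ hc hgapφ₀)
  have hφne : ∀ ε, |ε| < δ → φ ε ≠ 0 := fun ε hε h0 => by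
    have := (heig ε hε).2
    rw [h0, map_zero, inner_zero_right] at this
    exact zero_ne_one this
  have hsm : ∀ m : ℕ, ContDiff ℝ (m + 1) f → ∀ ε, |ε| < δ →
      ContDiffAt ℝ m l ε ∧ ContDiffAt ℝ m φ ε ∧ ContDiffAt ℝ m (fun ε => ‖φ ε‖⁻¹ • φ ε) ε := by
    intro m hm ε hε
    obtain ⟨h1, h2⟩ := hsmooth m (contDiff_schrL a (hbs m hm)) ε hε
    exact ⟨h1, h2, ((h2.norm ℝ (hφne ε hε)).inv (norm_ne_zero_iff.2 (hφne ε hε))).smul h2⟩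
  have h00 : |(0 : ℝ)| < δ := by rwa [abs_zero]
  obtain ⟨hls, hφs, hphis⟩ := hsm 1 (by
    have := hf.contDiff
    rw [← one_add_one_eq_two] at this
    exact_mod_cast this) 0 h00
  -- the pairing bound gives `|l| = O(ε²)` since `φ ε` pairs with `u₀' + ε u₁'` to about `‖u₀'‖`
  obtain ⟨K, hK⟩ := exists_eigenvalue_pairing_bound hf hu₀ ha hu₁ hw hw' hU hV hUV hVc hb
  obtain ⟨C₁, hC₁⟩ := (hphis.differentiableAt (by simp)).isBigO_sub.bound
  -- conditions that hold at `ε = 0`, hence nearby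
  have ev1 : ∀ᶠ ε in 𝓝 (0 : ℝ), |ε| < δ := continuous_abs.continuousAt.eventually_lt_const h00
  have ev2 : ∀ᶠ ε in 𝓝 (0 : ℝ), |ε| * ‖latticeL ℝ a‖ + ‖b ε - b 0‖ < c / 2 := by
    have : Continuous fun ε : ℝ => |ε| * ‖latticeL ℝ a‖ + ‖b ε - b 0‖ := by
      have := hb1.continuous
      fun_prop
    exact this.continuousAt.eventually_lt_const (by simpa using hc)
  have ev3 : ∀ᶠ ε in 𝓝 (0 : ℝ), l ε < c / 2 :=
    hls.continuousAt.eventually_lt_const (by rw [hl0]; positivity)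
  have ev4 : ∀ᶠ ε in 𝓝 (0 : ℝ), ‖φ ε‖ < ‖φ₀‖ + 1 :=
    hφs.continuousAt.norm.eventually_lt_const (by simp only [hφ0]; linarith)
  have ev5 : ∀ᶠ ε in 𝓝 (0 : ℝ),
      n / 2 < ⟪H2.fnL ℝ (φ ε), H2.fnL ℝ w + ε • H2.derivL ℝ u₁⟫_ℝ := by
    have h1 : ContinuousAt (fun ε => ⟪H2.fnL ℝ (φ ε), H2.fnL ℝ w + ε • H2.derivL ℝ u₁⟫_ℝ) 0 :=
      ((H2.fnL ℝ).continuous.continuousAt.comp hφs.continuousAt).inner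
        (continuous_const.add (continuous_id.smul continuous_const)).continuousAt
    refine h1.eventually_const_lt ?_
    beta_reduce
    rw [hφ0, hφ₀, map_smul, zero_smul, add_zero, real_inner_smul_left, real_inner_self_eq_norm_sq,
      ← hn_def, sq, inv_mul_cancel_left₀ hn.ne']
    exact half_lt_self hn
  obtain ⟨r, hr, hball⟩ := Metric.eventually_nhds_iff.1
    (((((ev1.and ev2).and ev3).and ev4).and ev5).and hC₁)
  have hε₀ : 0 < min 1 (r / 2) := by positivity
  have hmem : ∀ ε ∈ Icc 0 (min 1 (r / 2)), dist ε 0 < r := fun ε hε => by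
    rw [Real.dist_eq, sub_zero, abs_of_nonneg hε.1]
    linarith [hε.2.trans (min_le_right _ _)]
  refine ⟨w, hw, hw0, min 1 (r / 2), c / 2, max C₁ (|K| * (‖φ₀‖ + 1) * (2 / n)), l,
    fun ε => ‖φ ε‖⁻¹ • φ ε, hε₀, half_pos hc, fun ε hε => ?_, fun m _ hm => ?_⟩
  · obtain ⟨⟨⟨⟨⟨g1, g2⟩, g3⟩, g4⟩, g5⟩, g6⟩ := hball (hmem ε hε)
    obtain ⟨hT, hpair⟩ := heig ε g1
    have hne := hφne ε g1
    have hn' : ‖φ ε‖ ≠ 0 := norm_ne_zero_iff.2 hne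
    set p : H2 ℝ := ‖φ ε‖⁻¹ • φ ε with hp
    have hTp : schrL ℝ a (b ε) ε p = l ε • H2.fnL ℝ p := by
      rw [hp, map_smul, map_smul, hT, smul_comm]
    have hwp : ⟪H2.fnL ℝ w, H2.fnL ℝ p⟫_ℝ ≠ 0 := by
      rw [hφ₀, map_smul, real_inner_smul_left] at hpair
      rw [hp, map_smul, real_inner_smul_right]
      exact mul_ne_zero (inv_ne_zero hn') (right_ne_zero_of_mul (hpair.trans_ne one_ne_zero))
    have hgapε := gap_complexify ha (gap_of_eigenvector (𝕜 := ℝ) (inner_schrL ha (b ε) ε) hTp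
      (by linarith) hwp (gap_of_perturbation hgap g2.le))
    have hJp : H2.fnL ℂ p.complexify ≠ 0 := by
      intro h0
      rw [H2.fnL_complexify] at h0
      have h1 := reL_complexify p.fn
      rw [h0, map_zero] at h1
      refine hwp ?_
      rw [H2.fnL_apply p, ← h1, inner_zero_right]
    have hTc := schrL_complexify ha hTp
    refine ⟨?_, ?_, ?_, ?_, ?_⟩
    · have := spectrum_subset_of_gap ha (hbV ε) hJp hTc hgapε
      rwa [sub_half] at this
    · exact isSimpleEigenpair_of_gap ha (hbV ε) hJp hTc (by linarith) hgapε
    · change ‖‖φ ε‖⁻¹ • φ ε‖ = 1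
      rw [norm_smul, norm_inv, norm_norm, inv_mul_cancel₀ hn']
    · have h1 := hK ε ⟨hε.1, hε.2.trans (min_le_left _ _)⟩ (φ ε) (l ε) hT
      rw [abs_mul, abs_of_pos ((half_pos hn).trans g5)] at h1
      have h2 : |l ε| * (n / 2) ≤ |K| * ε ^ 2 * (‖φ₀‖ + 1) :=
        calc |l ε| * (n / 2) ≤ K * ε ^ 2 * ‖φ ε‖ := le_trans (by gcongr) h1
          _ ≤ _ := by
            gcongr
            exact le_abs_self K
      calc |l ε| = |l ε| * (n / 2) * (2 / n) := by field_simp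
        _ ≤ |K| * ε ^ 2 * (‖φ₀‖ + 1) * (2 / n) := by gcongr
        _ = |K| * (‖φ₀‖ + 1) * (2 / n) * ε ^ 2 := by ring
        _ ≤ _ := by
          gcongr
          exact le_max_right _ _
    · have e : ‖φ 0‖⁻¹ • φ 0 = ‖w‖⁻¹ • w := by
        rw [hφ0, hφ₀, norm_smul, norm_inv, Real.norm_of_nonneg hn.le, mul_inv, inv_inv, smul_smul]
        congr 1
        field_simp
      rw [e, sub_zero, Real.norm_eq_abs, abs_of_nonneg hε.1] at g6
      refine g6.trans ?_
      gcongr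
      · exact hε.1
      · exact le_max_left _ _
  · have h : ∀ ε ∈ Icc 0 (min 1 (r / 2)), |ε| < δ := fun ε hε => (hball (hmem ε hε)).1.1.1.1.1
    exact ⟨fun ε hε => (hsm m hm ε (h ε hε)).1.contDiffWithinAt,
      fun ε hε => (hsm m hm ε (h ε hε)).2.2.contDiffWithinAt⟩
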